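/- Let $\mathbb{R}^{4,2}$ be $\mathbb{R}^6$ with an inner product $(\cdot,\cdot)$ of signature $(-++++-)$. Let $D\subset\mathbb{R}^2$ be open and let $\Lambda$ be a Legendre immersion of $D$, that is, a smooth family of $2$-dimensional null subspaces $\Lambda(x)\subset\mathbb{R}^{4,2}$, $x\in D$, such that $(d\sigma,\tau)=0$ for all local sections $\sigma,\tau$ of $\Lambda$, and such that $X=0$ whenever $X\in T_xD$ satisfies $d_x\sigma(X)\in\Lambda(x)$ for all sections $\sigma$ near $x$. A curvature sphere of $\Lambda$ at $x$ is a line $\langle k\rangle\subset\Lambda(x)$ such that, for some $X\ne0$, $d_x\sigma(X)\in\Lambda(x)$ for every section $\sigma$ near $x$ with $\sigma(x)=k$. $\Lambda$ is called *channel* if there is a field of lines $s(x)\subset\Lambda(x)$, $x \in D$, that depends on one parameter only (locally $s=\langle\gamma\circ t\rangle$ with a smooth real function $t$ and a smooth curve $\gamma$ of non-zero vectors). $\Lambda$ is an *$\Omega$-surface on* $W\subset D$ if there are fields of (possibly complex) lines $s^\pm=\langle\sigma^\pm\rangle\subset\Lambda\otimes\mathbb{C}$ on $W$, either both real or complex conjugate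 to each other, such that * each is isothermic: with smooth nowhere vanishing lifts $\sigma^\pm$ (real, respectively complex conjugate) and suitable smooth coordinates $(u,v)$ mapping $W$ diffeomorphically onto an open rectangle $I\times J$ (the coordinates may depend on the sign), $\sigma^\pm_{uv}$ is everywhere a multiple of $\sigma^\pm$; * at every point of $W$ there are two distinct curvature spheres of $\Lambda$, and they are separated harmonically by the distinct lines $s^+,s^-$. $\Lambda$ is an *$\Omega$-surface* if every point of $D$ lies in some such open $W \subset D$. A *Euclidean subgeometry* is given by $p,q\in\mathbb{R}^{4,2}$ with $(p,p)=-1$, $(p,q)=(q,q)=0$, $q\neq0$. Its Euclidean $3$-space is $\{f : (f,f)=(f,p)=0,\ (f,q)=-1\}$, its oriented planes are represented by $\{t : (t,t)=(t,q)=0,\ (t,p)=-1\}$, and the Legendre lift of a surface with points $f$ and tangent planes $t$ is $\langle f,t\rangle$. **Theorem.** Let $\Lambda$ be a channel $\Omega$-surface on $D$. If $\Lambda$ is an $\Omega$-surface on $W\subset D$ in the above sense, then, on all of $W$, at least one of the following holds: 1. $\Lambda$ is (part of) a Dupin cyclide: there is an orthogonal splitting of $\mathbb{R}^{4,2}$ into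 two subspaces of signature $(2,1)$ such that one curvature sphere congruence of $\Lambda$ takes values in the first and the other one in the second; 2. in a suitably chosen Euclidean subgeometry, $\Lambda$ is the Legendre lift of a cone, a cylinder or a surface of revolution: in suitable smooth coordinates $(t,\theta)$ mapping $W$ diffeomorphically onto an open rectangle, and in suitable Cartesian coordinates of Euclidean space, its points and unit normals are, with smooth functions of $t$, * (cone) $e^\theta c(t)$ with $c(t)\ne0$, and $n(t)$; * (cylinder) $(x(t),y(t),\theta)$ and $(a(t),b(t),0)$; or * (surface of revolution) $(r(t)\cos\theta,\,r(t)\sin\theta,\,h(t))$ and $(a(t)\cos\theta,\,a(t)\sin\theta,\,b(t))$. In particular, every point of $D$ has an open neighbourhood on which 1 or 2 holds. -/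

import Mathlib

open scoped ContDiff

noncomputable section

/-! ### Lie sphere geometry -/

/-- The six-dimensional real vector space underlying `ℝ^{4,2}`. -/
abbrev LieSpace : Type := Fin 6 → ℝ

/-- The inner product of `ℝ^{4,2}`, of signature `(-++++-)`. -/
def lieInner (x y : LieSpace) : ℝ :=
  -(x 0 * y 0) + x 1 * y 1 + x 2 * y 2 + x 3 * y 3 + x 4 * y 4 - x 5 * y 5

/-! ### Legendre immersions -/

/-- `σ` is a smooth section over `U` of the family `L` of subspaces of `ℝ^{4,2}`. -/
def IsSection (L : ℝ × ℝ → Submodule ℝ LieSpace) (U : Set (ℝ × ℝ))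
    (σ : ℝ × ℝ → LieSpace) : Prop :=
  ContDiffOn ℝ ∞ σ U ∧ ∀ x ∈ U, σ x ∈ L x

/-- `L` is a Legendre immersion of the parameter domain `D`: a smooth family of null
`2`-planes of `ℝ^{4,2}` (lines of the Lie quadric, i.e. oriented contact elements) that satisfies
the contact condition `(dσ, τ) = 0` for all sections `σ`, `τ`, and for which a tangent
vector `X` at `x` vanishes as soon as `dσ(X) ∈ L x` for all sections `σ` near `x`. -/
structure IsLegendreImmersion (L : ℝ × ℝ → Submodule ℝ LieSpace) (D : Set (ℝ × ℝ)) : Prop where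
  smooth : ∀ x ∈ D, ∃ U ⊆ D, IsOpen U ∧ x ∈ U ∧ ∃ σ τ : ℝ × ℝ → LieSpace,
    IsSection L U σ ∧ IsSection L U τ ∧
      ∀ y ∈ U, LinearIndependent ℝ ![σ y, τ y] ∧ L y = Submodule.span ℝ {σ y, τ y}
  null : ∀ x ∈ D, ∀ a ∈ L x, ∀ b ∈ L x, lieInner a b = 0
  contact : ∀ U ⊆ D, IsOpen U → ∀ σ τ : ℝ × ℝ → LieSpace, IsSection L U σ → IsSection L U τ →
    ∀ x ∈ U, ∀ X : ℝ × ℝ, lieInner (fderiv ℝ σ x X) (τ x) = 0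
  immersion : ∀ x ∈ D, ∀ X : ℝ × ℝ,
    (∀ U ⊆ D, IsOpen U → x ∈ U → ∀ σ : ℝ × ℝ → LieSpace, IsSection L U σ →
      fderiv ℝ σ x X ∈ L x) → X = 0

/-- The nonzero vector `k ∈ L x` spans a curvature sphere of `L` at `x`: in some direction `X ≠ 0`
every section `σ` of `L` near `x` with `σ x = k` satisfies `dσ(X) ∈ L x`. (For a Legendre
immersion, `dσ(X)` modulo `L x` depends on `σ` only through `σ x`.) -/
def IsCurvatureSphere (L : ℝ × ℝ → Submodule ℝ LieSpace) (x : ℝ × ℝ) (k : LieSpace) : Prop :=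
  k ∈ L x ∧ k ≠ 0 ∧ ∃ X : ℝ × ℝ, X ≠ 0 ∧
    ∀ U : Set (ℝ × ℝ), IsOpen U → x ∈ U → ∀ σ : ℝ × ℝ → LieSpace, IsSection L U σ →
      σ x = k → fderiv ℝ σ x X ∈ L x

/-- `L` is a channel surface over `D`: it envelops a sphere congruence `s` (a field of lines
`s x ⊆ L x`) that depends on one parameter only, i.e. locally `s = ⟨γ(t)⟩` for a smooth
function `t` on the surface and a smooth curve `γ` of (nonzero) light-like vectors. -/
def IsChannel (L : ℝ × ℝ → Submodule ℝ LieSpace) (D : Set (ℝ × ℝ)) : Prop :=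
  ∃ s : ℝ × ℝ → Submodule ℝ LieSpace, (∀ x ∈ D, s x ≤ L x) ∧
    ∀ x ∈ D, ∃ U ⊆ D, IsOpen U ∧ x ∈ U ∧
      ∃ (t : ℝ × ℝ → ℝ) (T : Set ℝ) (γ : ℝ → LieSpace),
        ContDiffOn ℝ ∞ t U ∧ IsOpen T ∧ Set.MapsTo t U T ∧ ContDiffOn ℝ ∞ γ T ∧
          ∀ y ∈ U, γ (t y) ≠ 0 ∧ s y = Submodule.span ℝ {γ (t y)}

/-! ### Isothermic sphere congruences and Ω-surfaces -/

/-- `κ` is a smooth coordinate system on `W` whose image is the open rectangle `I × J`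
(`I`, `J` open intervals, possibly unbounded). -/
def IsCoordinateRectangle (κ : OpenPartialHomeomorph (ℝ × ℝ) (ℝ × ℝ)) (W : Set (ℝ × ℝ))
    (I J : Set ℝ) : Prop :=
  κ.source = W ∧ κ.target = I ×ˢ J ∧ IsOpen I ∧ I.OrdConnected ∧ IsOpen J ∧ J.OrdConnected ∧
    ContDiffOn ℝ ∞ κ κ.source ∧ ContDiffOn ℝ ∞ κ.symm κ.target

/-- The possibly complex sphere congruence spanned by the lift `m` is isothermic on `W`, with
Moutard lift `m`: in suitable coordinates `(u, v)` on `W`, `m_{uv}` is a multiple of `m`. -/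
def IsMoutardLift (m : ℝ × ℝ → (Fin 6 → ℂ)) (W : Set (ℝ × ℝ)) : Prop :=
  ContDiffOn ℝ ∞ m W ∧ (∀ x ∈ W, m x ≠ 0) ∧
    ∃ (κ : OpenPartialHomeomorph (ℝ × ℝ) (ℝ × ℝ)) (I J : Set ℝ), IsCoordinateRectangle κ W I J ∧
      ∀ w ∈ κ.target, ∃ c : ℂ,
        fderiv ℝ (fun z => fderiv ℝ (m ∘ κ.symm) z (1, 0)) w (0, 1) = c • m (κ.symm w)

/-- The complex lines spanned by `m` and `m'` separate the lines spanned by the (linearly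
independent) real vectors `k₁`, `k₂` harmonically: the four lines are distinct lines of one
complex `2`-plane and have cross-ratio `-1`. -/
def SeparateHarmonically (m m' : Fin 6 → ℂ) (k₁ k₂ : LieSpace) : Prop :=
  ∃ a b c d : ℂ,
    (∀ i, m i = a * (k₁ i : ℂ) + b * (k₂ i : ℂ)) ∧
    (∀ i, m' i = c * (k₁ i : ℂ) + d * (k₂ i : ℂ)) ∧
    a * d - b * c ≠ 0 ∧ a * d + b * c = 0

/-- `L` is an Ω-surface on all of `W`: there are a pair of isothermic sphere congruences with
Moutard lifts `m`, `m'` defined on `W`, either both real or complex conjugate, which are enveloped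
by `L` and separate the two curvature spheres of `L` harmonically.
(Enveloping is contained in the last clause, since curvature spheres at `x` are elements of `L x`.
Note that a Legendre immersion with two distinct curvature spheres at `x` has no umbilic there.) -/
def IsOmegaPatch (L : ℝ × ℝ → Submodule ℝ LieSpace) (W : Set (ℝ × ℝ)) : Prop :=
  ∃ m m' : ℝ × ℝ → (Fin 6 → ℂ),
    IsMoutardLift m W ∧ IsMoutardLift m' W ∧
    ((∀ x ∈ W, star (m x) = m x ∧ star (m' x) = m' x) ∨ (∀ x ∈ W, m' x = star (m x))) ∧
    ∀ x ∈ W, ∃ k₁ k₂ : LieSpace, IsCurvatureSphere L x k₁ ∧ IsCurvatureSphere L x k₂ ∧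
      LinearIndependent ℝ ![k₁, k₂] ∧ SeparateHarmonically (m x) (m' x) k₁ k₂

/-- `L` is an Ω-surface over `D`; coordinates and Moutard lifts are only required locally. -/
def IsOmegaSurface (L : ℝ × ℝ → Submodule ℝ LieSpace) (D : Set (ℝ × ℝ)) : Prop :=
  ∀ x ∈ D, ∃ W ⊆ D, x ∈ W ∧ IsOmegaPatch L W

/-! ### Dupin cyclides -/

/-- `L` is (part of) a Dupin cyclide on `W`: there is an orthogonal splitting of `ℝ^{4,2}` into two
`(2,1)`-planes such that one curvature sphere congruence of `L` takes values in the first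
and the other one in the second. (`P` is spanned by the orthonormal vectors `e 0`, `e 1`, `e 2`
with `(e 0, e 0) = (e 1, e 1) = 1`, `(e 2, e 2) = -1`; membership in its orthogonal
complement, which again has signature `(2,1)`, is written out.) -/
def IsDupinCyclide (L : ℝ × ℝ → Submodule ℝ LieSpace) (W : Set (ℝ × ℝ)) : Prop :=
  ∃ e : Fin 3 → LieSpace,
    (∀ i j, lieInner (e i) (e j) = if i = j then (if i = 2 then -1 else 1) else 0) ∧
    ∀ x ∈ W, ∃ k₁ k₂ : LieSpace, IsCurvatureSphere L x k₁ ∧ IsCurvatureSphere L x k₂ ∧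
      k₁ ∈ Submodule.span ℝ (Set.range e) ∧ ∀ i, lieInner k₂ (e i) = 0

/-! ### Euclidean subgeometries -/

/-- Point sphere complex `p` and space form vector `q` of a Euclidean subgeometry:
`p` is unit timelike, and `q ≠ 0` is lightlike and orthogonal to `p`. -/
def IsEuclideanSubgeometry (p q : LieSpace) : Prop :=
  lieInner p p = -1 ∧ lieInner p q = 0 ∧ lieInner q q = 0 ∧ q ≠ 0

/-- A Cartesian frame of the Euclidean space `{x | (x,x) = 0, (x,p) = 0, (x,q) = -1}`:
a point `o` of it as origin and an orthonormal basis `e` of the tangent space at `o`. -/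
def IsCartesianFrame (p q o : LieSpace) (e : Fin 3 → LieSpace) : Prop :=
  lieInner o o = 0 ∧ lieInner o p = 0 ∧ lieInner o q = -1 ∧
    (∀ i j, lieInner (e i) (e j) = if i = j then 1 else 0) ∧
    ∀ i, lieInner (e i) p = 0 ∧ lieInner (e i) q = 0 ∧ lieInner (e i) o = 0

/-- The point of the Euclidean space `{x | (x,x) = 0, (x,p) = 0, (x,q) = -1}` with Cartesian
coordinates `x`. -/
def euclideanPoint (q o : LieSpace) (e : Fin 3 → LieSpace) (x : EuclideanSpace ℝ (Fin 3)) :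
    LieSpace :=
  o + ∑ i, x i • e i + (‖x‖ ^ 2 / 2) • q

/-- The element of `{t | (t,t) = 0, (t,p) = -1, (t,q) = 0}` representing the oriented plane with
unit normal `n` through the point with Cartesian coordinates `x`. -/
def euclideanPlane (p q : LieSpace) (e : Fin 3 → LieSpace) (x n : EuclideanSpace ℝ (Fin 3)) :
    LieSpace :=
  p + ∑ i, n i • e i + (inner ℝ n x) • q

/-- The contact element at the point `x` with unit normal `n`. The Legendre lift of a surface `f`
of Euclidean space with Gauss map `n` is `contactElement p q o e (f ·) (n ·)`. -/
def contactElement (p q o : LieSpace) (e : Fin 3 → LieSpace) (x n : EuclideanSpace ℝ (Fin 3)) :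
    Submodule ℝ LieSpace :=
  Submodule.span ℝ {euclideanPoint q o e x, euclideanPlane p q e x n}

/-- In the Euclidean subgeometry of `(p, q)`, `L` is on `W` the Legendre lift of a cone: in
Cartesian coordinates with the vertex as origin, the surface is `exp θ • c t`, with unit
normal `n t` constant along the rulings. -/
def IsCone (p q : LieSpace) (L : ℝ × ℝ → Submodule ℝ LieSpace) (W : Set (ℝ × ℝ)) : Prop :=
  ∃ (o : LieSpace) (e : Fin 3 → LieSpace), IsCartesianFrame p q o e ∧
    ∃ (κ : OpenPartialHomeomorph (ℝ × ℝ) (ℝ × ℝ)) (I J : Set ℝ), IsCoordinateRectangle κ W I J ∧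
      ∃ c n : ℝ → EuclideanSpace ℝ (Fin 3),
        ContDiffOn ℝ ∞ c I ∧ ContDiffOn ℝ ∞ n I ∧ (∀ t ∈ I, c t ≠ 0 ∧ ‖n t‖ = 1) ∧
        ∀ t ∈ I, ∀ θ ∈ J, L (κ.symm (t, θ)) = contactElement p q o e (Real.exp θ • c t) (n t)

/-- In the Euclidean subgeometry of `(p, q)`, `L` is on `W` the Legendre lift of a cylinder: in
suitable Cartesian coordinates, the surface is `(x t, y t, θ)`, with unit normal
`(a t, b t, 0)` constant along the rulings. -/
def IsCylinder (p q : LieSpace) (L : ℝ × ℝ → Submodule ℝ LieSpace) (W : Set (ℝ × ℝ)) : Prop :=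
  ∃ (o : LieSpace) (e : Fin 3 → LieSpace), IsCartesianFrame p q o e ∧
    ∃ (κ : OpenPartialHomeomorph (ℝ × ℝ) (ℝ × ℝ)) (I J : Set ℝ), IsCoordinateRectangle κ W I J ∧
      ∃ x y a b : ℝ → ℝ,
        ContDiffOn ℝ ∞ x I ∧ ContDiffOn ℝ ∞ y I ∧ ContDiffOn ℝ ∞ a I ∧ ContDiffOn ℝ ∞ b I ∧
        (∀ t ∈ I, a t ^ 2 + b t ^ 2 = 1) ∧
        ∀ t ∈ I, ∀ θ ∈ J, L (κ.symm (t, θ)) =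
          contactElement p q o e !₂[x t, y t, θ] !₂[a t, b t, 0]

/-- In the Euclidean subgeometry of `(p, q)`, `L` is on `W` the Legendre lift of a surface of
revolution: in Cartesian coordinates with the third axis as axis of revolution, the surface is
`(cos θ * r t, sin θ * r t, h t)`, with unit normal `(cos θ * a t, sin θ * a t, b t)`. -/
def IsSurfaceOfRevolution (p q : LieSpace) (L : ℝ × ℝ → Submodule ℝ LieSpace)
    (W : Set (ℝ × ℝ)) : Prop :=
  ∃ (o : LieSpace) (e : Fin 3 → LieSpace), IsCartesianFrame p q o e ∧
    ∃ (κ : OpenPartialHomeomorph (ℝ × ℝ) (ℝ × ℝ)) (I J : Set ℝ), IsCoordinateRectangle κ W I J ∧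
      ∃ r h a b : ℝ → ℝ,
        ContDiffOn ℝ ∞ r I ∧ ContDiffOn ℝ ∞ h I ∧ ContDiffOn ℝ ∞ a I ∧ ContDiffOn ℝ ∞ b I ∧
        (∀ t ∈ I, a t ^ 2 + b t ^ 2 = 1) ∧
        ∀ t ∈ I, ∀ θ ∈ J, L (κ.symm (t, θ)) =
          contactElement p q o e !₂[Real.cos θ * r t, Real.sin θ * r t, h t]
            !₂[Real.cos θ * a t, Real.sin θ * a t, b t]

/-- On `W`, `L` is a Dupin cyclide or, in a suitable Euclidean subgeometry, a cone, a cylinder or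
a surface of revolution. -/
def IsDupinOrConeCylinderRevolution (L : ℝ × ℝ → Submodule ℝ LieSpace)
    (W : Set (ℝ × ℝ)) : Prop :=
  IsDupinCyclide L W ∨ ∃ p q : LieSpace, IsEuclideanSubgeometry p q ∧
    (IsCone p q L W ∨ IsCylinder p q L W ∨ IsSurfaceOfRevolution p q L W)

end

/-!
# Channel Ω-surfaces

Why a channel Ω-surface is a Dupin cyclide, a cone, a cylinder or a surface of revolution.

The enveloped sphere congruence that depends on one parameter is constant in some direction, so it is
one of the two curvature sphere congruences. By harmonic separation, the two isothermic congruences are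
`m = Y + Z` and `m' = G (Y - Z)`, where `Y` and `Z` are (complex) lifts of the two curvature sphere
congruences, that of `Y` being the channel one, and `G` is a smooth function
(`exists_curvatureFrame`). The derivatives of `Y` and `Z` are orthogonal to each other, so the Moutard
equation `m_uv = c m` makes the coordinate directions conjugate, hence curvature directions, say
`Y_u = ρ Y` and `Z_v = α Y + β Z`. Comparing components in the Moutard equation gives `ρ = β = 0` and
`c = 0`: `Y` depends on `v` only, `Z_v = α Y`, and `Z_uv = 0`
(`CurvatureFrame.eq_zero_of_moutard`). The same holds for `G Y` and `-G Z`, which is only possible if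
`G` is constant (`CurvatureFrame.fderiv_eq_zero_of_directions`). Then constant multiples of `Y` and
`Z` are real, both when `m` and `m'` are real and when they are complex conjugate
(`exists_const_smul_real`). The result is the normal form `ChannelNormalForm`: in curvature line
coordinates the curvature spheres are `K v` and `A u + B v`, where `B' = α K`.

The rest concerns curves in `ℝ^{4,2}`. If `α` vanishes identically, `K` and `A + B` take values in
two complementary orthogonal `(2,1)`-planes, and the surface is a Dupin cyclide
(`ChannelNormalForm.exists_dupin`). Otherwise `K` and its first three derivatives are linearly
independent at some point, so that the vectors `A' u`, being orthogonal to all of them, lie in a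
fixed plane (`ChannelNormalForm.deriv_A_mem_span`). This plane contains the spacelike vectors `A' u`
and thus has signature `(1,1)`, is degenerate, or is positive definite. In the first two cases a
null line of the plane is taken as the point at infinity, and the surface is a cone or a cylinder. In
the third case, the point at infinity is a null line in the orthogonal complement of the plane that
is none of the curvature spheres `K v`, and the surface is a surface of revolution
(`ChannelNormalForm.classification`).
-/

open scoped ContDiff

noncomputable section

/-! ### Linear algebra of the Lie sphere space -/

lemma lieInner_comm (x y : LieSpace) : lieInner x y = lieInner y x := by
  simp only [lieInner]; ring

lemma lieInner_add_left (x y z : LieSpace) :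
    lieInner (x + y) z = lieInner x z + lieInner y z := by
  simp only [lieInner, Pi.add_apply]; ring

lemma lieInner_add_right (x y z : LieSpace) :
    lieInner x (y + z) = lieInner x y + lieInner x z := by
  simp only [lieInner, Pi.add_apply]; ring

lemma lieInner_smul_left (a : ℝ) (x y : LieSpace) : lieInner (a • x) y = a * lieInner x y := by
  simp only [lieInner, Pi.smul_apply, smul_eq_mul]; ring

lemma lieInner_smul_right (a : ℝ) (x y : LieSpace) : lieInner x (a • y) = a * lieInner x y := by
  simp only [lieInner, Pi.smul_apply, smul_eq_mul]; ring

lemma lieInner_sub_left (x y z : LieSpace) :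
    lieInner (x - y) z = lieInner x z - lieInner y z := by
  simp only [lieInner, Pi.sub_apply]; ring

lemma lieInner_sub_right (x y z : LieSpace) :
    lieInner x (y - z) = lieInner x y - lieInner x z := by
  simp only [lieInner, Pi.sub_apply]; ring

lemma lieInner_neg_left (x y : LieSpace) : lieInner (-x) y = -lieInner x y := by
  simp only [lieInner, Pi.neg_apply]; ring

lemma lieInner_neg_right (x y : LieSpace) : lieInner x (-y) = -lieInner x y := by
  simp only [lieInner, Pi.neg_apply]; ring

lemma lieInner_zero_left (x : LieSpace) : lieInner 0 x = 0 := by simp [lieInner]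

lemma lieInner_zero_right (x : LieSpace) : lieInner x 0 = 0 := by simp [lieInner]

/-- The inner product of `ℝ^{4,2}` as a bilinear map. -/
def lieForm : LieSpace →ₗ[ℝ] LieSpace →ₗ[ℝ] ℝ :=
  LinearMap.mk₂ ℝ lieInner lieInner_add_left lieInner_smul_left lieInner_add_right
    lieInner_smul_right

lemma lieForm_apply (x y : LieSpace) : lieForm x y = lieInner x y := rfl

lemma lieInner_sum_left {ι : Type*} (s : Finset ι) (f : ι → LieSpace) (y : LieSpace) :
    lieInner (∑ i ∈ s, f i) y = ∑ i ∈ s, lieInner (f i) y := by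
  simp only [← lieForm_apply, map_sum, LinearMap.sum_apply]

lemma lieInner_sum_right {ι : Type*} (s : Finset ι) (x : LieSpace) (f : ι → LieSpace) :
    lieInner x (∑ i ∈ s, f i) = ∑ i ∈ s, lieInner x (f i) := by
  simp only [← lieForm_apply, map_sum]

lemma eq_zero_of_lieInner_eq_zero {z : LieSpace} (h : ∀ y, lieInner z y = 0) : z = 0 := by
  ext i
  have := h (Pi.single i 1)
  fin_cases i <;> simpa [lieInner, Pi.single_apply] using this

/-- The signs of an orthonormal basis of `ℝ^{4,2}`, the spacelike vectors listed first. -/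
def lieSign : Fin 6 → ℝ := ![1, 1, 1, 1, -1, -1]

lemma lieSign_mul_self (i : Fin 6) : lieSign i * lieSign i = 1 := by
  fin_cases i <;> simp [lieSign]

lemma lieSign_eq_or (i : Fin 6) : lieSign i = 1 ∨ lieSign i = -1 := by
  fin_cases i <;> simp [lieSign]

/-- The vectors `f i`, `i ∈ S`, form part of an orthonormal basis of `ℝ^{4,2}`, with the signs
prescribed by `lieSign`. -/
def IsLieOrthonormal (f : Fin 6 → LieSpace) (S : Finset (Fin 6)) : Prop :=
  ∀ i ∈ S, ∀ j ∈ S, lieInner (f i) (f j) = if i = j then lieSign i else 0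

/-- The standard orthonormal basis of `ℝ^{4,2}`, reordered to match `lieSign`. -/
def lieStd (i : Fin 6) : LieSpace := Pi.single (![1, 2, 3, 4, 0, 5] i) 1

lemma isLieOrthonormal_lieStd : IsLieOrthonormal lieStd Finset.univ := by
  intro i _ j _
  fin_cases i <;> fin_cases j <;> simp [lieStd, lieInner, lieSign]

lemma IsLieOrthonormal.linearIndependent {f : Fin 6 → LieSpace}
    (hf : IsLieOrthonormal f Finset.univ) : LinearIndependent ℝ f := by
  rw [Fintype.linearIndependent_iff]
  intro g hg i
  have h := congrArg (fun v => lieInner v (f i)) hg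
  simp only [lieInner_sum_left, lieInner_smul_left, lieInner_zero_left] at h
  rw [Finset.sum_eq_single i (fun j _ hj => by
    rw [hf j (Finset.mem_univ _) i (Finset.mem_univ _), if_neg hj, mul_zero]) (by simp)] at h
  rw [hf i (Finset.mem_univ _) i (Finset.mem_univ _), if_pos rfl] at h
  rcases mul_eq_zero.1 h with h | h
  · exact h
  · rcases lieSign_eq_or i with h' | h' <;> norm_num [h'] at h

lemma IsLieOrthonormal.eq_zero {f : Fin 6 → LieSpace} (hf : IsLieOrthonormal f Finset.univ)
    {z : LieSpace} (h : ∀ i, lieInner z (f i) = 0) : z = 0 := by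
  have htop : Submodule.span ℝ (Set.range f) = ⊤ :=
    hf.linearIndependent.span_eq_top_of_card_eq_finrank (by simp)
  refine eq_zero_of_lieInner_eq_zero fun y => ?_
  have hy : y ∈ Submodule.span ℝ (Set.range f) := htop ▸ Submodule.mem_top
  have hle : Submodule.span ℝ (Set.range f) ≤ LinearMap.ker (lieForm z) := by
    rw [Submodule.span_le]
    rintro _ ⟨i, rfl⟩
    exact h i
  exact hle hy

lemma IsLieOrthonormal.expand {f : Fin 6 → LieSpace} (hf : IsLieOrthonormal f Finset.univ)
    (x : LieSpace) : x = ∑ i, (lieSign i * lieInner x (f i)) • f i := by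
  rw [← sub_eq_zero]
  refine hf.eq_zero fun i => ?_
  rw [lieInner_sub_left, lieInner_sum_left, Finset.sum_eq_single i (fun j _ hj => by
    rw [lieInner_smul_left, hf j (Finset.mem_univ _) i (Finset.mem_univ _), if_neg hj, mul_zero])
    (by simp), lieInner_smul_left, hf i (Finset.mem_univ _) i (Finset.mem_univ _), if_pos rfl]
  linear_combination (-lieInner x (f i)) * lieSign_mul_self i

/-- Among the vectors of the standard basis with the sign of `f i` there are more than there are
vectors of this sign in the given part of the basis, so that some combination of them is
orthogonal to the latter; removing its components along the vectors of the opposite sign only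
increases the absolute value of its square norm. -/
lemma IsLieOrthonormal.exists_next {f : Fin 6 → LieSpace} {S : Finset (Fin 6)}
    (hf : IsLieOrthonormal f S) {i : Fin 6} (hi : i ∉ S) :
    ∃ z, (∀ j ∈ S, lieInner z (f j) = 0) ∧ lieInner z z = lieSign i := by
  classical
  set ε := lieSign i with hε
  have hεε : ε * ε = 1 := lieSign_mul_self i
  let emb : ({j : Fin 6 // lieSign j = ε} → ℝ) →ₗ[ℝ] LieSpace :=
    Fintype.linearCombination ℝ (fun j => lieStd j.1)
  let φ : ({j : Fin 6 // lieSign j = ε} → ℝ) →ₗ[ℝ] ({j : Fin 6 // j ∈ S ∧ lieSign j = ε} → ℝ) :=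
    LinearMap.pi fun j => (lieForm.flip (f j.1)).comp emb
  have hcard : Fintype.card {j : Fin 6 // j ∈ S ∧ lieSign j = ε} <
      Fintype.card {j : Fin 6 // lieSign j = ε} := by
    rw [Fintype.card_subtype, Fintype.card_subtype]
    refine Finset.card_lt_card ⟨fun j hj => ?_, fun h => ?_⟩
    · simp only [Finset.mem_filter, Finset.mem_univ, true_and] at hj ⊢
      exact hj.2
    · have : i ∈ Finset.univ.filter (fun j : Fin 6 => j ∈ S ∧ lieSign j = ε) := h (by simp [hε])
      simp only [Finset.mem_filter, Finset.mem_univ, true_and] at this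
      exact hi this.1
  have hker : LinearMap.ker φ ≠ ⊥ := LinearMap.ker_ne_bot_of_finrank_lt (by simpa using hcard)
  obtain ⟨x, hx, hx0⟩ := Submodule.exists_mem_ne_zero_of_ne_bot hker
  set z := emb x with hz
  have hzS : ∀ j ∈ S, lieSign j = ε → lieInner z (f j) = 0 := fun j hj hjε =>
    congrFun (LinearMap.mem_ker.1 hx) ⟨j, hj, hjε⟩
  have hzz : lieInner z z = ε * ∑ j, x j ^ 2 := by
    have h1 : z = ∑ j, x j • lieStd j.1 := Fintype.linearCombination_apply ℝ _ x
    have h2 : ∀ j : {j : Fin 6 // lieSign j = ε}, lieInner z (lieStd j.1) = ε * x j := by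
      intro j
      rw [h1, lieInner_sum_left, Finset.sum_eq_single j]
      · rw [lieInner_smul_left, isLieOrthonormal_lieStd _ (Finset.mem_univ _) _ (Finset.mem_univ _),
          if_pos rfl, j.2, mul_comm]
      · intro k _ hk
        rw [lieInner_smul_left, isLieOrthonormal_lieStd _ (Finset.mem_univ _) _ (Finset.mem_univ _),
          if_neg (fun h => hk (Subtype.ext h)), mul_zero]
      · simp
    conv_lhs => rw [h1, lieInner_sum_left]
    rw [Finset.mul_sum]
    refine Finset.sum_congr rfl fun j _ => ?_
    rw [lieInner_smul_left, lieInner_comm, ← h1, h2]; ring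
  have hpos : 0 < ∑ j, x j ^ 2 := by
    obtain ⟨j, hj⟩ := Function.ne_iff.1 hx0
    exact Finset.sum_pos' (fun j _ => sq_nonneg _) ⟨j, Finset.mem_univ _, by
      have : x j ≠ 0 := hj
      positivity⟩
  set w := z - ∑ j ∈ S, (lieSign j * lieInner z (f j)) • f j with hw
  have hwS : ∀ j ∈ S, lieInner w (f j) = 0 := by
    intro j hj
    rw [hw, lieInner_sub_left, lieInner_sum_left, Finset.sum_eq_single j (fun k hk hkj => by
      rw [lieInner_smul_left, hf k hk j hj, if_neg hkj, mul_zero]) (fun h => (h hj).elim),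
      lieInner_smul_left, hf j hj j hj, if_pos rfl]
    linear_combination (-lieInner z (f j)) * lieSign_mul_self j
  have hww : lieInner w w = ε * (∑ j, x j ^ 2 + ∑ j ∈ S, lieInner z (f j) ^ 2) := by
    have h1 : lieInner w w = lieInner z w := by
      have h2 : lieInner (∑ j ∈ S, (lieSign j * lieInner z (f j)) • f j) w = 0 := by
        rw [lieInner_sum_left]
        exact Finset.sum_eq_zero fun j hj => by
          rw [lieInner_smul_left, lieInner_comm (f j) w, hwS j hj, mul_zero]
      rw [← sub_eq_zero, ← lieInner_sub_left, hw, sub_sub_cancel_left, lieInner_neg_left, ← hw, h2,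
        neg_zero]
    rw [h1, hw, lieInner_sub_right, hzz, lieInner_sum_right, mul_add, sub_eq_add_neg,
      ← Finset.sum_neg_distrib, Finset.mul_sum (s := S)]
    congr 1
    refine Finset.sum_congr rfl fun j hj => ?_
    rw [lieInner_smul_right]
    by_cases h : lieSign j = ε
    · rw [hzS j hj h]; ring
    · have : lieSign j = -ε := by
        rcases lieSign_eq_or j with h1 | h1 <;> rcases lieSign_eq_or i with h2 | h2 <;>
          rw [← hε] at h2 <;> first | exact absurd (h1.trans h2.symm) h | linarith
      rw [this]; ring
  set N := ∑ j, x j ^ 2 + ∑ j ∈ S, lieInner z (f j) ^ 2 with hN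
  have hNpos : 0 < N := add_pos_of_pos_of_nonneg hpos (Finset.sum_nonneg fun j _ => sq_nonneg _)
  refine ⟨(1 / Real.sqrt N) • w, fun j hj => by rw [lieInner_smul_left, hwS j hj, mul_zero], ?_⟩
  rw [lieInner_smul_left, lieInner_smul_right, hww]
  have hs : Real.sqrt N * Real.sqrt N = N := Real.mul_self_sqrt hNpos.le
  have hs0 : Real.sqrt N ≠ 0 := (Real.sqrt_pos.2 hNpos).ne'
  field_simp
  rw [sq, hs, mul_comm]

/-- Every part of an orthonormal basis of `ℝ^{4,2}` extends to an orthonormal basis. -/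
lemma IsLieOrthonormal.exists_extension {f : Fin 6 → LieSpace} {S : Finset (Fin 6)}
    (hf : IsLieOrthonormal f S) :
    ∃ F, (∀ i ∈ S, F i = f i) ∧ IsLieOrthonormal F Finset.univ := by
  classical
  induction hn : Sᶜ.card generalizing S f with
  | zero =>
    rw [Finset.card_eq_zero, Finset.compl_eq_empty_iff] at hn
    exact ⟨f, fun _ _ => rfl, hn ▸ hf⟩
  | succ n ih =>
    obtain ⟨i, hi⟩ : Sᶜ.Nonempty := Finset.card_pos.1 (by omega)
    rw [Finset.mem_compl] at hi
    obtain ⟨z, hz, hzz⟩ := hf.exists_next hi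
    have hne : ∀ j ∈ S, j ≠ i := fun j hj h => hi (h ▸ hj)
    have hg : IsLieOrthonormal (Function.update f i z) (insert i S) := by
      intro j hj k hk
      rcases Finset.mem_insert.1 hj with hj | hj <;> rcases Finset.mem_insert.1 hk with hk | hk
      · simp [hj, hk, hzz]
      · simp [hj, Function.update_of_ne (hne k hk), hz k hk, (hne k hk).symm]
      · simp [hk, lieInner_comm (f j), hz j hj, hne j hj]
      · rw [Function.update_of_ne (hne k hk), Function.update_of_ne (hne j hj), hf j hj k hk]
    obtain ⟨F, hF, hF'⟩ := ih hg (by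
      rw [Finset.compl_insert, Finset.card_erase_of_mem (Finset.mem_compl.2 hi)]; omega)
    refine ⟨F, fun j hj => ?_, hF'⟩
    rw [hF j (Finset.mem_insert_of_mem hj), Function.update_of_ne (hne j hj)]

/-- A null vector without timelike coordinates vanishes. -/
lemma eq_zero_of_null_of_timelike_eq_zero {x : LieSpace} (h : lieInner x x = 0) (h0 : x 0 = 0)
    (h5 : x 5 = 0) : x = 0 := by
  simp only [lieInner, h0, h5] at h
  have h1 : x 1 = 0 := by nlinarith [sq_nonneg (x 1), sq_nonneg (x 2), sq_nonneg (x 3), sq_nonneg (x 4)]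
  have h2 : x 2 = 0 := by nlinarith [sq_nonneg (x 1), sq_nonneg (x 2), sq_nonneg (x 3), sq_nonneg (x 4)]
  have h3 : x 3 = 0 := by nlinarith [sq_nonneg (x 1), sq_nonneg (x 2), sq_nonneg (x 3), sq_nonneg (x 4)]
  have h4 : x 4 = 0 := by nlinarith [sq_nonneg (x 1), sq_nonneg (x 2), sq_nonneg (x 3), sq_nonneg (x 4)]
  ext i
  fin_cases i <;> assumption

/-- The inner product is positive definite on `Λ^⊥ / Λ` for a null plane `Λ = ⟨a, b⟩`: a vector of
`Λ^⊥` differs by an element of `Λ` from one without timelike coordinates. -/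
lemma nonneg_of_orthogonal_null_plane {a b w : LieSpace} (hab : LinearIndependent ℝ ![a, b])
    (haa : lieInner a a = 0) (hab0 : lieInner a b = 0) (hbb : lieInner b b = 0)
    (hwa : lieInner w a = 0) (hwb : lieInner w b = 0) :
    0 ≤ lieInner w w ∧ (lieInner w w = 0 → w ∈ Submodule.span ℝ {a, b}) := by
  have hdet : a 0 * b 5 - a 5 * b 0 ≠ 0 := by
    intro hd
    rw [LinearIndependent.pair_iff] at hab
    have key : ∀ s t : ℝ, s * a 0 + t * b 0 = 0 → s * a 5 + t * b 5 = 0 → s = 0 ∧ t = 0 := by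
      intro s t h0 h5
      refine hab s t (eq_zero_of_null_of_timelike_eq_zero ?_ (by simpa using h0) (by simpa using h5))
      simp only [lieInner_add_left, lieInner_add_right, lieInner_smul_left, lieInner_smul_right, haa,
        hab0, hbb, lieInner_comm b a]
      ring
    have h1 := key (b 5) (-a 5) (by linear_combination hd) (by ring)
    have h2 := key (b 0) (-a 0) (by ring) (by linear_combination -hd)
    have := key 1 0 (by linarith [h2.2]) (by linarith [h1.2])
    exact one_ne_zero this.1
  set d := a 0 * b 5 - a 5 * b 0 with hd
  set s := (w 0 * b 5 - w 5 * b 0) / d with hs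
  set t := (a 0 * w 5 - a 5 * w 0) / d with ht
  set r := w - (s • a + t • b) with hr
  have hr0 : r 0 = 0 := by
    simp only [hr, hs, ht, Pi.sub_apply, Pi.add_apply, Pi.smul_apply, smul_eq_mul]
    field_simp
    rw [hd]; ring
  have hr5 : r 5 = 0 := by
    simp only [hr, hs, ht, Pi.sub_apply, Pi.add_apply, Pi.smul_apply, smul_eq_mul]
    field_simp
    rw [hd]; ring
  have hrr : lieInner r r = lieInner w w := by
    simp only [hr, lieInner_sub_left, lieInner_sub_right, lieInner_add_left, lieInner_add_right,
      lieInner_smul_left, lieInner_smul_right, haa, hab0, hbb, lieInner_comm b a,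
      lieInner_comm a w, lieInner_comm b w, hwa, hwb]
    ring
  refine ⟨?_, fun h => ?_⟩
  · rw [← hrr]
    simp only [lieInner, hr0, hr5]
    nlinarith [sq_nonneg (r 1), sq_nonneg (r 2), sq_nonneg (r 3), sq_nonneg (r 4)]
  · have : r = 0 := eq_zero_of_null_of_timelike_eq_zero (hrr.trans h) hr0 hr5
    rw [hr, sub_eq_zero] at this
    rw [this]
    exact Submodule.mem_span_pair.2 ⟨s, t, rfl⟩

/-! ### Euclidean subgeometries and Cartesian frames -/

/-- The orthonormal basis of `ℝ^{4,2}` determined by a Cartesian frame. -/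
lemma IsCartesianFrame.isLieOrthonormal {p q o : LieSpace} {e : Fin 3 → LieSpace}
    (hpq : IsEuclideanSubgeometry p q) (h : IsCartesianFrame p q o e) :
    IsLieOrthonormal ![e 0, e 1, e 2, o - (1 / 2 : ℝ) • q, o + (1 / 2 : ℝ) • q, p] Finset.univ := by
  obtain ⟨hpp, hpq', hqq, -⟩ := hpq
  obtain ⟨hoo, hop, hoq, hee, he⟩ := h
  have h1 := fun i => (he i).1
  have h2 := fun i => (he i).2.1
  have h3 := fun i => (he i).2.2
  have h1' := fun i => (lieInner_comm p (e i)).trans (h1 i)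
  have h2' := fun i => (lieInner_comm q (e i)).trans (h2 i)
  have h3' := fun i => (lieInner_comm o (e i)).trans (h3 i)
  have hpo := (lieInner_comm p o).trans hop
  have hqo := (lieInner_comm q o).trans hoq
  have hqp := (lieInner_comm q p).trans hpq'
  intro i _ j _
  fin_cases i <;> fin_cases j <;>
    simp [lieSign, hee, h1, h2, h3, h1', h2', h3', hpp, hpq', hqq, hqp, hoo, hop, hoq, hpo, hqo,
      lieInner_add_left, lieInner_sub_left, lieInner_smul_left, lieInner_add_right,
      lieInner_sub_right, lieInner_smul_right] <;> norm_num

lemma IsCartesianFrame.expand {p q o : LieSpace} {e : Fin 3 → LieSpace}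
    (hpq : IsEuclideanSubgeometry p q) (h : IsCartesianFrame p q o e) (x : LieSpace) :
    x = (-lieInner x p) • p + (-lieInner x q) • o + (-lieInner x o) • q +
      ∑ i, lieInner x (e i) • e i := by
  have := (h.isLieOrthonormal hpq).expand x
  conv_lhs => rw [this]
  ext k
  simp [Fin.sum_univ_succ, lieSign, lieInner_add_right, lieInner_sub_right, lieInner_smul_right]
  ring

/-- The inner product in terms of a Cartesian frame. -/
lemma IsCartesianFrame.lieInner_eq {p q o : LieSpace} {e : Fin 3 → LieSpace}
    (hpq : IsEuclideanSubgeometry p q) (h : IsCartesianFrame p q o e) (x y : LieSpace) :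
    lieInner x y = -(lieInner x p * lieInner y p) - lieInner x q * lieInner y o -
      lieInner x o * lieInner y q + ∑ i, lieInner x (e i) * lieInner y (e i) := by
  conv_lhs => rw [h.expand hpq x]
  simp only [lieInner_add_left, lieInner_smul_left, lieInner_sum_left]
  simp only [lieInner_comm _ y]
  ring

/-- A null plane is the contact element of the point and the oriented plane represented by
the vectors `F` and `T` that span it, provided these are normalised suitably. -/
lemma IsCartesianFrame.span_eq_contactElement {p q o : LieSpace} {e : Fin 3 → LieSpace}
    (hpq : IsEuclideanSubgeometry p q) (h : IsCartesianFrame p q o e) {F T : LieSpace}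
    (hFF : lieInner F F = 0) (hTT : lieInner T T = 0) (hFT : lieInner F T = 0)
    (hFp : lieInner F p = 0) (hFq : lieInner F q = -1) (hTq : lieInner T q = 0)
    (hTp : lieInner T p = -1) (x n : EuclideanSpace ℝ (Fin 3))
    (hx : ∀ i, x i = lieInner F (e i)) (hn : ∀ i, n i = lieInner T (e i)) :
    ‖n‖ = 1 ∧ Submodule.span ℝ {F, T} = contactElement p q o e x n := by
  have e1 := h.lieInner_eq hpq F F
  have e2 := h.lieInner_eq hpq T T
  have e3 := h.lieInner_eq hpq F T
  simp only [hFF, hTT, hFT, hFp, hFq, hTq, hTp, ← hx, ← hn] at e1 e2 e3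
  have hnx : ‖x‖ ^ 2 = ∑ i, x i * x i := by
    rw [EuclideanSpace.norm_sq_eq]; simp [sq]
  have hnn : ‖n‖ ^ 2 = ∑ i, n i * n i := by
    rw [EuclideanSpace.norm_sq_eq]; simp [sq]
  have hin : inner ℝ n x = ∑ i, x i * n i := by
    simp [PiLp.inner_apply]
  refine ⟨?_, ?_⟩
  · have : ‖n‖ ^ 2 = 1 := by rw [hnn]; linarith
    nlinarith [norm_nonneg n]
  · have hF : F = euclideanPoint q o e x := by
      rw [euclideanPoint]
      conv_lhs => rw [h.expand hpq F]
      have hFo : -lieInner F o = ‖x‖ ^ 2 / 2 := by rw [hnx]; linarith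
      rw [hFo, hFp, hFq]
      simp only [← hx]
      simp only [neg_zero, zero_smul, zero_add, neg_neg, one_smul]
      abel
    have hT : T = euclideanPlane p q e x n := by
      rw [euclideanPlane]
      conv_lhs => rw [h.expand hpq T]
      have hTo : -lieInner T o = inner ℝ n x := by rw [hin]; linarith
      rw [hTo, hTp, hTq]
      simp only [← hn]
      simp only [neg_zero, zero_smul, neg_neg, one_smul]
      abel
    rw [contactElement, ← hF, ← hT]

/-! ### Calculus on intervals and coordinate rectangles -/

/-- A unit vector field in the plane along an interval has a smooth angle function: the
primitive of its angular velocity. -/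
lemma exists_smooth_angle {I : Set ℝ} (hI : IsOpen I) (hIc : I.OrdConnected) {x y : ℝ → ℝ}
    (hx : ContDiffOn ℝ ∞ x I) (hy : ContDiffOn ℝ ∞ y I) (hxy : ∀ u ∈ I, x u ^ 2 + y u ^ 2 = 1) :
    ∃ θ : ℝ → ℝ, ContDiffOn ℝ ∞ θ I ∧ ∀ u ∈ I, x u = Real.cos (θ u) ∧ y u = Real.sin (θ u) := by
  rcases I.eq_empty_or_nonempty with rfl | ⟨u₀, hu₀⟩
  · exact ⟨fun _ => 0, contDiffOn_const, by simp⟩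
  have hx' : ContDiffOn ℝ ∞ (deriv x) I := hx.deriv_of_isOpen hI (by simp)
  have hy' : ContDiffOn ℝ ∞ (deriv y) I := hy.deriv_of_isOpen hI (by simp)
  set η : ℝ → ℝ := fun u => x u * deriv y u - y u * deriv x u with hη
  have hηs : ContDiffOn ℝ ∞ η I := (hx.mul hy').sub (hy.mul hx')
  have hxd : ∀ u ∈ I, HasDerivAt x (deriv x u) u := fun u hu =>
    ((hx.contDiffAt (hI.mem_nhds hu)).differentiableAt (by simp)).hasDerivAt
  have hyd : ∀ u ∈ I, HasDerivAt y (deriv y u) u := fun u hu =>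
    ((hy.contDiffAt (hI.mem_nhds hu)).differentiableAt (by simp)).hasDerivAt
  set z : ℂ := ⟨x u₀, y u₀⟩ with hz
  have hz1 : ‖z‖ = 1 := by
    have h : ‖z‖ ^ 2 = 1 := by
      rw [← Complex.normSq_eq_norm_sq, Complex.normSq_apply, ← hxy u₀ hu₀]; simp [hz]; ring
    nlinarith [norm_nonneg z]
  have hz0 : z ≠ 0 := fun h => by simp [h] at hz1
  set θ : ℝ → ℝ := fun u => Complex.arg z + ∫ t in u₀..u, η t with hθ
  have hθd : ∀ u ∈ I, HasDerivAt θ (η u) u := by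
    intro u hu
    have hsub : Set.uIcc u₀ u ⊆ I := hIc.uIcc_subset hu₀ hu
    have h := intervalIntegral.integral_hasDerivAt_right (a := u₀) (b := u) (f := η)
      ((hηs.continuousOn.mono hsub).intervalIntegrable)
      (hηs.continuousOn.stronglyMeasurableAtFilter hI u hu)
      (hηs.continuousOn.continuousAt (hI.mem_nhds hu))
    exact h.const_add _
  have hθs : ContDiffOn ℝ ∞ θ I := by
    rw [contDiffOn_infty_iff_deriv_of_isOpen hI]
    exact ⟨fun u hu => (hθd u hu).differentiableAt.differentiableWithinAt,
      hηs.congr fun u hu => (hθd u hu).deriv⟩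
  refine ⟨θ, hθs, ?_⟩
  have hgd : ∀ u ∈ I, HasDerivAt (fun u => x u * Real.cos (θ u) + y u * Real.sin (θ u)) 0 u := by
    intro u hu
    have h1 : x u * deriv x u + y u * deriv y u = 0 := by
      have h2 : HasDerivAt (fun u => x u ^ 2 + y u ^ 2)
          (2 * x u * deriv x u + 2 * y u * deriv y u) u := by
        exact (((hxd u hu).pow 2).add ((hyd u hu).pow 2)).congr_deriv (by norm_num)
      have h3 : HasDerivAt (fun u => x u ^ 2 + y u ^ 2) 0 u :=
        (hasDerivAt_const u (1 : ℝ)).congr_of_eventuallyEq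
          (by filter_upwards [hI.mem_nhds hu] with v hv using hxy v hv)
      linarith [h2.unique h3]
    have hxη : deriv x u = -(y u * η u) := by
      simp only [hη]; linear_combination (-deriv x u) * hxy u hu + x u * h1
    have hyη : deriv y u = x u * η u := by
      simp only [hη]; linear_combination (-deriv y u) * hxy u hu + y u * h1
    have h4 := ((hxd u hu).mul (hθd u hu).cos).add ((hyd u hu).mul (hθd u hu).sin)
    exact h4.congr_deriv (by rw [hxη, hyη]; ring)
  have hconst : ∀ u ∈ I, x u * Real.cos (θ u) + y u * Real.sin (θ u) = 1 := by
    intro u hu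
    have h := hI.is_const_of_deriv_eq_zero hIc.isPreconnected
      (fun v hv => (hgd v hv).differentiableAt.differentiableWithinAt)
      (fun v hv => (hgd v hv).deriv) hu hu₀
    rw [h]
    have h0 : θ u₀ = Complex.arg z := by simp [hθ]
    rw [h0, Complex.cos_arg hz0, Complex.sin_arg, hz1]
    simp only [hz, div_one]
    rw [← hxy u₀ hu₀]; ring
  intro u hu
  have h1 : (x u - Real.cos (θ u)) ^ 2 + (y u - Real.sin (θ u)) ^ 2 = 0 := by
    linear_combination hxy u hu - 2 * hconst u hu + Real.sin_sq_add_cos_sq (θ u)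
  constructor <;> nlinarith [sq_nonneg (x u - Real.cos (θ u)), sq_nonneg (y u - Real.sin (θ u))]

/-- A function on an interval with nowhere vanishing derivative is injective. -/
lemma injOn_of_deriv_ne_zero {I : Set ℝ} (hIc : I.OrdConnected) {θ : ℝ → ℝ}
    (hθ : ContDiffOn ℝ ∞ θ I) (hθ' : ∀ u ∈ I, deriv θ u ≠ 0) : Set.InjOn θ I := by
  intro a ha b hb hab
  by_contra hne
  wlog hlt : a < b generalizing a b
  · exact this hb ha hab.symm (Ne.symm hne) (lt_of_le_of_ne (not_lt.1 hlt) (Ne.symm hne))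
  have hsub : Set.Icc a b ⊆ I := hIc.out ha hb
  obtain ⟨c, hc, hc'⟩ := exists_deriv_eq_zero hlt (hθ.continuousOn.mono hsub) hab
  exact hθ' c (hsub (Set.Ioo_subset_Icc_self hc)) hc'

/-- A smooth function on an open interval with nowhere vanishing derivative is a diffeomorphism
onto an open interval. -/
lemma exists_openPartialHomeomorph_of_deriv_ne_zero {I : Set ℝ} (hI : IsOpen I)
    (hIc : I.OrdConnected) {θ : ℝ → ℝ} (hθ : ContDiffOn ℝ ∞ θ I)
    (hθ' : ∀ u ∈ I, deriv θ u ≠ 0) :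
    ∃ e : OpenPartialHomeomorph ℝ ℝ, e.source = I ∧ (∀ u, e u = θ u) ∧ e.target.OrdConnected ∧
      ContDiffOn ℝ ∞ e.symm e.target := by
  have hd : ∀ u ∈ I, HasStrictDerivAt θ (deriv θ u) u := fun u hu =>
    (hθ.contDiffAt (hI.mem_nhds hu)).hasStrictDerivAt (by simp)
  have hinj := injOn_of_deriv_ne_zero hIc hθ hθ'
  have hopen : IsOpenMap (I.domRestrict θ) := by
    rw [IsOpenMap.eq_1]
    intro U hU
    obtain ⟨V, hV, rfl⟩ := isOpen_induced_iff.1 hU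
    rw [isOpen_iff_mem_nhds]
    rintro _ ⟨⟨u, hu⟩, huV, rfl⟩
    have h := (hd u hu).map_nhds_eq (hθ' u hu)
    change _ ∈ nhds (θ u)
    rw [← h, Filter.mem_map]
    filter_upwards [hI.mem_nhds hu, hV.mem_nhds huV] with w hw hwV
    exact ⟨⟨w, hw⟩, hwV, rfl⟩
  let e := OpenPartialHomeomorph.ofContinuousOpenRestrict (hinj.toPartialEquiv θ I)
    hθ.continuousOn hopen hI
  have hes : e.source = I := rfl
  have het : e.target = θ '' I := rfl
  refine ⟨e, hes, fun _ => rfl, ?_, ?_⟩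
  · rw [het]
    exact (hIc.isPreconnected.image θ hθ.continuousOn).ordConnected
  · intro w hw
    have hu : e.symm w ∈ I := e.map_target hw
    exact (e.contDiffAt_symm_deriv (hθ' _ hu) hw (hd _ hu).hasDerivAt
      (hθ.contDiffAt (hI.mem_nhds hu))).contDiffWithinAt

/-- In a coordinate rectangle, the first coordinate may be replaced by a function of it with
nowhere vanishing derivative; the coordinates are interchanged at the same time. -/
lemma IsCoordinateRectangle.exists_reparam {κ : OpenPartialHomeomorph (ℝ × ℝ) (ℝ × ℝ)}
    {W : Set (ℝ × ℝ)} {I J : Set ℝ} (h : IsCoordinateRectangle κ W I J) {θ : ℝ → ℝ}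
    (hθ : ContDiffOn ℝ ∞ θ I) (hθ' : ∀ u ∈ I, deriv θ u ≠ 0) :
    ∃ (κ' : OpenPartialHomeomorph (ℝ × ℝ) (ℝ × ℝ)) (J' : Set ℝ), IsCoordinateRectangle κ' W J J' ∧
      ∀ t ∈ J, ∀ s ∈ J', ∃ u ∈ I, θ u = s ∧ κ'.symm (t, s) = κ.symm (u, t) := by
  obtain ⟨hsrc, htgt, hI, hIc, hJ, hJc, hκ, hκs⟩ := h
  obtain ⟨e, hes, heθ, het, hesymm⟩ := exists_openPartialHomeomorph_of_deriv_ne_zero hI hIc hθ hθ'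
  let g : OpenPartialHomeomorph (ℝ × ℝ) (ℝ × ℝ) :=
    (e.prod (OpenPartialHomeomorph.ofSet J hJ)).trans
      (Homeomorph.prodComm ℝ ℝ).toOpenPartialHomeomorph
  have hgs : g.source = I ×ˢ J := by
    ext ⟨a, b⟩; simp [g, hes]
  have hgt : g.target = J ×ˢ e.target := by
    ext ⟨a, b⟩; simp [g]
  have hg : ∀ w, g w = (w.2, θ w.1) := fun w => by simp [g, heθ]
  have hgsymm : ∀ w, g.symm w = (e.symm w.2, w.1) := fun w => by simp [g]
  have h1 : (κ.trans g).source = W := by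
    rw [OpenPartialHomeomorph.trans_source, hgs, ← htgt, ← hsrc]
    exact Set.inter_eq_left.2 fun w hw => κ.map_source hw
  have h2 : (κ.trans g).target = J ×ˢ e.target := by
    rw [OpenPartialHomeomorph.trans_target, htgt, ← hgs, hgt]
    exact Set.inter_eq_left.2 fun w hw => g.map_target (hgt ▸ hw)
  refine ⟨κ.trans g, e.target, ⟨h1, h2, hJ, hJc, e.open_target, het, ?_, ?_⟩, ?_⟩
  · rw [h1]
    have hκ' : ContDiffOn ℝ ∞ κ W := hsrc ▸ hκ
    have hm : ∀ w ∈ W, κ w ∈ I ×ˢ J := fun w hw => htgt ▸ κ.map_source (hsrc ▸ hw)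
    have : ContDiffOn ℝ ∞ (fun w => ((κ w).2, θ (κ w).1)) W :=
      hκ'.snd.prodMk (hθ.comp hκ'.fst fun w hw => (hm w hw).1)
    exact this.congr fun w _ => by simp [hg]
  · rw [h2]
    have : ContDiffOn ℝ ∞ (fun w : ℝ × ℝ => κ.symm (e.symm w.2, w.1)) (J ×ˢ e.target) := by
      refine hκs.comp ?_ ?_
      · exact (hesymm.comp contDiffOn_snd fun w hw => hw.2).prodMk contDiffOn_fst
      · intro w hw
        rw [htgt]
        exact ⟨hes ▸ e.map_target hw.2, hw.1⟩
    exact this.congr fun w _ => by simp [hgsymm]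
  · intro t _ s hs
    refine ⟨e.symm s, hes ▸ e.map_target hs, ?_, by simp [hgsymm]⟩
    rw [← heθ, e.right_inv hs]

/-- The coordinates of a coordinate rectangle may be interchanged. -/
lemma IsCoordinateRectangle.swap {κ : OpenPartialHomeomorph (ℝ × ℝ) (ℝ × ℝ)}
    {W : Set (ℝ × ℝ)} {I J : Set ℝ} (h : IsCoordinateRectangle κ W I J) :
    ∃ κ' : OpenPartialHomeomorph (ℝ × ℝ) (ℝ × ℝ), IsCoordinateRectangle κ' W J I ∧
      ∀ w, κ'.symm w = κ.symm w.swap := by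
  obtain ⟨hsrc, htgt, hI, hIc, hJ, hJc, hκ, hκs⟩ := h
  refine ⟨κ.trans (Homeomorph.prodComm ℝ ℝ).toOpenPartialHomeomorph,
    ⟨by simpa using hsrc, ?_, hJ, hJc, hI, hIc, ?_, ?_⟩, fun w => rfl⟩
  · ext ⟨a, b⟩; simp [htgt, and_comm]
  · refine ContDiffOn.congr (f := fun w => ((κ w).2, (κ w).1)) ?_ fun w _ => rfl
    exact (hκ.snd.prodMk hκ.fst).mono (by simp)
  · refine ContDiffOn.congr (f := fun w : ℝ × ℝ => κ.symm (w.2, w.1)) ?_ fun w _ => rfl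
    exact hκs.comp (contDiffOn_snd.prodMk contDiffOn_fst) fun w hw =>
      show w.swap ∈ κ.target by simpa using hw

/-! ### Curves in the Lie sphere space -/

lemma HasDerivAt.lieInner {f g : ℝ → LieSpace} {f' g' : LieSpace} {t : ℝ}
    (hf : HasDerivAt f f' t) (hg : HasDerivAt g g' t) :
    HasDerivAt (fun s => lieInner (f s) (g s)) (lieInner f' (g t) + lieInner (f t) g') t := by
  rw [hasDerivAt_pi] at hf hg
  have h := ((((((hf 0).mul (hg 0)).neg.add ((hf 1).mul (hg 1))).add ((hf 2).mul (hg 2))).add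
    ((hf 3).mul (hg 3))).add ((hf 4).mul (hg 4))).sub ((hf 5).mul (hg 5))
  exact h.congr_deriv (by simp only [_root_.lieInner]; ring)

lemma ContDiffOn.lieInner {E : Type*} [NormedAddCommGroup E] [NormedSpace ℝ E]
    {f g : E → LieSpace} {S : Set E} (hf : ContDiffOn ℝ ∞ f S) (hg : ContDiffOn ℝ ∞ g S) :
    ContDiffOn ℝ ∞ (fun s => lieInner (f s) (g s)) S := by
  rw [contDiffOn_pi] at hf hg
  exact ((((((hf 0).mul (hg 0)).neg.add ((hf 1).mul (hg 1))).add ((hf 2).mul (hg 2))).add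
    ((hf 3).mul (hg 3))).add ((hf 4).mul (hg 4))).sub ((hf 5).mul (hg 5))

lemma hasDerivAt_of_contDiffOn {F : Type*} [NormedAddCommGroup F] [NormedSpace ℝ F] {f : ℝ → F}
    {S : Set ℝ} (hS : IsOpen S) (hf : ContDiffOn ℝ ∞ f S) {t : ℝ} (ht : t ∈ S) :
    HasDerivAt f (deriv f t) t :=
  ((hf.contDiffAt (hS.mem_nhds ht)).differentiableAt (by simp)).hasDerivAt

lemma contDiffOn_deriv {F : Type*} [NormedAddCommGroup F] [NormedSpace ℝ F] {f : ℝ → F}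
    {S : Set ℝ} (hS : IsOpen S) (hf : ContDiffOn ℝ ∞ f S) : ContDiffOn ℝ ∞ (deriv f) S :=
  hf.deriv_of_isOpen hS (by simp)

/-- Differentiation of an identity `(f, g) = c` along an open set of parameters. -/
lemma lieInner_deriv_of_const {S : Set ℝ} (hS : IsOpen S) {f g : ℝ → LieSpace}
    (hf : ContDiffOn ℝ ∞ f S) (hg : ContDiffOn ℝ ∞ g S) {c : ℝ}
    (h : ∀ t ∈ S, lieInner (f t) (g t) = c) {t : ℝ} (ht : t ∈ S) :
    lieInner (deriv f t) (g t) + lieInner (f t) (deriv g t) = 0 := by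
  have h1 := (hasDerivAt_of_contDiffOn hS hf ht).lieInner (hasDerivAt_of_contDiffOn hS hg ht)
  have h2 : HasDerivAt (fun s => lieInner (f s) (g s)) 0 t :=
    (hasDerivAt_const t c).congr_of_eventuallyEq
      (by filter_upwards [hS.mem_nhds ht] with s hs using h s hs)
  exact h1.unique h2

/-- An identity `(f, w) = c` along an open set of parameters is inherited by the derivative. -/
lemma lieInner_deriv_left {S : Set ℝ} (hS : IsOpen S) {f : ℝ → LieSpace}
    (hf : ContDiffOn ℝ ∞ f S) {w : LieSpace} {c : ℝ} (h : ∀ t ∈ S, lieInner (f t) w = c) {t : ℝ}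
    (ht : t ∈ S) : lieInner (deriv f t) w = 0 := by
  have := lieInner_deriv_of_const hS hf (contDiffOn_const (c := w)) h ht
  simpa [lieInner_zero_right] using this

lemma lieInner_const_of_deriv {S : Set ℝ} (hS : IsOpen S) (hSc : S.OrdConnected)
    {f : ℝ → LieSpace} (hf : ContDiffOn ℝ ∞ f S) {w : LieSpace}
    (h : ∀ t ∈ S, lieInner (deriv f t) w = 0) {s t : ℝ} (hs : s ∈ S) (ht : t ∈ S) :
    lieInner (f s) w = lieInner (f t) w := by
  have hd : ∀ t ∈ S, HasDerivAt (fun s => lieInner (f s) w) 0 t := fun t ht => by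
    have := (hasDerivAt_of_contDiffOn hS hf ht).lieInner (hasDerivAt_const t w)
    rwa [h t ht, lieInner_zero_right, add_zero] at this
  exact hS.is_const_of_deriv_eq_zero hSc.isPreconnected
    (fun t ht => (hd t ht).differentiableAt.differentiableWithinAt)
    (fun t ht => (hd t ht).deriv) hs ht

/-! ### The normal form of a channel Ω-surface -/

/-- The normal form of a channel Ω-surface in curvature line coordinates `(u, v)`: the contact
elements are spanned by the curvature spheres `K v` and `A u + B v`, and `B' = α K`. -/
structure ChannelNormalForm (I J : Set ℝ) (A B K : ℝ → LieSpace) (α : ℝ → ℝ) : Prop where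
  openI : IsOpen I
  openJ : IsOpen J
  connI : I.OrdConnected
  connJ : J.OrdConnected
  smoothA : ContDiffOn ℝ ∞ A I
  smoothB : ContDiffOn ℝ ∞ B J
  smoothK : ContDiffOn ℝ ∞ K J
  null_K : ∀ v ∈ J, lieInner (K v) (K v) = 0
  orth : ∀ u ∈ I, ∀ v ∈ J, lieInner (K v) (A u + B v) = 0
  null_C : ∀ u ∈ I, ∀ v ∈ J, lieInner (A u + B v) (A u + B v) = 0
  indep : ∀ u ∈ I, ∀ v ∈ J, LinearIndependent ℝ ![K v, A u + B v]
  deriv_B : ∀ v ∈ J, deriv B v = α v • K v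
  pos_K : ∀ v ∈ J, 0 < lieInner (deriv K v) (deriv K v)
  pos_A : ∀ u ∈ I, 0 < lieInner (deriv A u) (deriv A u)

/-- The first derivatives of a curve of null vectors span a plane of signature `(2, 1)`. -/
lemma exists_signature_two_one {k k₁ k₂ : LieSpace} (h : lieInner k k = 0)
    (h1 : lieInner k k₁ = 0) (hpos : 0 < lieInner k₁ k₁)
    (h2 : lieInner k k₂ = -lieInner k₁ k₁) :
    ∃ e : Fin 3 → LieSpace,
      (∀ i j, lieInner (e i) (e j) = if i = j then (if i = 2 then -1 else 1) else 0) ∧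
      ∀ w, lieInner k w = 0 → lieInner k₁ w = 0 → lieInner k₂ w = 0 →
        ∀ i, lieInner (e i) w = 0 := by
  set n := lieInner k₁ k₁ with hn
  set r := Real.sqrt n with hr
  have hr0 : 0 < r := Real.sqrt_pos.2 hpos
  have hrr : r * r = n := Real.mul_self_sqrt hpos.le
  have h1' := (lieInner_comm k₁ k).trans h1
  have h2' := (lieInner_comm k₂ k).trans h2
  have h12 := lieInner_comm k₂ k₁
  -- `N` is the null vector of the plane that is orthogonal to `k₁` and satisfies `(N, k) = -n`.
  set N := k₂ - (lieInner k₁ k₂ / n) • k₁ +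
    ((lieInner k₂ k₂ - lieInner k₁ k₂ ^ 2 / n) / (2 * n)) • k with hN
  have hn0 : n ≠ 0 := hpos.ne'
  have hNN : lieInner N N = 0 := by
    simp only [hN, lieInner_add_left, lieInner_add_right, lieInner_sub_left, lieInner_sub_right,
      lieInner_smul_left, lieInner_smul_right, h, h1, h1', h2, h2', h12, ← hn]
    field_simp
    ring
  have hNk : lieInner N k = -n := by
    simp only [hN, lieInner_add_left, lieInner_sub_left, lieInner_smul_left, h, h1', h2']
    ring
  have hN1 : lieInner N k₁ = 0 := by
    simp only [hN, lieInner_add_left, lieInner_sub_left, lieInner_smul_left, h1, h12, ← hn]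
    field_simp
    ring
  have hkN := (lieInner_comm k N).trans hNk
  have h1N := (lieInner_comm k₁ N).trans hN1
  refine ⟨![(1 / r) • k₁, k - (1 / (2 * n)) • N, k + (1 / (2 * n)) • N], ?_, ?_⟩
  · intro i j
    fin_cases i <;> fin_cases j <;>
      simp [lieInner_add_left, lieInner_add_right, lieInner_sub_left, lieInner_sub_right,
        lieInner_smul_left, lieInner_smul_right, h, h1, h1', hNN, hNk, hN1, hkN, h1N, ← hn] <;>
      field_simp <;> norm_num
    nlinarith
  · intro w hw hw1 hw2 i
    have hNw : lieInner N w = 0 := by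
      simp [hN, lieInner_add_left, lieInner_sub_left, lieInner_smul_left, hw, hw1, hw2]
    fin_cases i <;>
      simp [lieInner_add_left, lieInner_sub_left, lieInner_smul_left, hw, hw1, hNw]

lemma span_pair_eq_of_det_ne_zero {V : Type*} [AddCommGroup V] [Module ℝ V] (a b : V)
    {s r s' r' : ℝ} (h : s * r' - s' * r ≠ 0) :
    Submodule.span ℝ {s • a + r • b, s' • a + r' • b} = Submodule.span ℝ {a, b} := by
  apply le_antisymm <;> rw [Submodule.span_le]
  · rintro x (rfl | rfl)
    · exact Submodule.mem_span_pair.2 ⟨s, r, rfl⟩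
    · exact Submodule.mem_span_pair.2 ⟨s', r', rfl⟩
  · obtain ⟨d, hd⟩ : ∃ d, d = s * r' - s' * r := ⟨_, rfl⟩
    rw [← hd] at h
    rintro x (rfl | rfl)
    · refine Submodule.mem_span_pair.2 ⟨r' / d, -r / d, ?_⟩
      match_scalars <;> field_simp <;> first | linear_combination -hd | ring
    · refine Submodule.mem_span_pair.2 ⟨-s' / d, s / d, ?_⟩
      match_scalars <;> field_simp <;> first | linear_combination -hd | ring

/-- The only null vectors orthogonal to the point sphere complex and the space form vector are
the multiples of the latter. -/
lemma IsCartesianFrame.eq_smul_of_null {p q o : LieSpace} {e : Fin 3 → LieSpace}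
    (hpq : IsEuclideanSubgeometry p q) (h : IsCartesianFrame p q o e) {x : LieSpace}
    (hx : lieInner x x = 0) (hp : lieInner x p = 0) (hq : lieInner x q = 0) :
    x = (-lieInner x o) • q := by
  have h1 := h.lieInner_eq hpq x x
  rw [hx, hp, hq] at h1
  have h2 : ∑ i, lieInner x (e i) * lieInner x (e i) = 0 := by linarith
  rw [Finset.sum_eq_zero_iff_of_nonneg (fun i _ => mul_self_nonneg _)] at h2
  have h3 : ∀ i, lieInner x (e i) = 0 := fun i => mul_self_eq_zero.1 (h2 i (Finset.mem_univ _))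
  conv_lhs => rw [h.expand hpq x]
  simp [hp, hq, h3]

/-- The contact element spanned by a plane `k` of the Euclidean geometry, i.e. a null vector
orthogonal to `q`, and a further null vector `c`. -/
lemma IsCartesianFrame.span_eq_contactElement_of_plane {p q o : LieSpace} {e : Fin 3 → LieSpace}
    (hpq : IsEuclideanSubgeometry p q) (h : IsCartesianFrame p q o e) {k c : LieSpace}
    (hkk : lieInner k k = 0) (hkc : lieInner k c = 0) (hcc : lieInner c c = 0)
    (hkq : lieInner k q = 0) (hkp : lieInner k p ≠ 0) (hcq : lieInner c q ≠ 0)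
    (x n : EuclideanSpace ℝ (Fin 3))
    (hx : ∀ i, x i = -(1 / lieInner c q) *
      (lieInner c (e i) - lieInner c p / lieInner k p * lieInner k (e i)))
    (hn : ∀ i, n i = -(1 / lieInner k p) * lieInner k (e i)) :
    ‖n‖ = 1 ∧ Submodule.span ℝ {k, c} = contactElement p q o e x n := by
  have hck := (lieInner_comm c k).trans hkc
  have key := h.span_eq_contactElement hpq
    (F := (lieInner c p / (lieInner k p * lieInner c q)) • k + (-(1 / lieInner c q)) • c)
    (T := (-(1 / lieInner k p)) • k + (0 : ℝ) • c)
    (by simp only [lieInner_add_left, lieInner_add_right, lieInner_smul_left, lieInner_smul_right,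
      hkk, hkc, hck, hcc]; ring)
    (by simp only [lieInner_add_left, lieInner_add_right, lieInner_smul_left, lieInner_smul_right,
      hkk, hkc, hck, hcc]; ring)
    (by simp only [lieInner_add_left, lieInner_add_right, lieInner_smul_left, lieInner_smul_right,
      hkk, hkc, hck, hcc]; ring)
    (by simp only [lieInner_add_left, lieInner_smul_left]; field_simp; ring)
    (by simp only [lieInner_add_left, lieInner_smul_left, hkq]; field_simp; ring)
    (by simp only [lieInner_add_left, lieInner_smul_left, hkq]; ring)
    (by simp only [lieInner_add_left, lieInner_smul_left]; field_simp; ring) x n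
    (fun i => by rw [hx]; simp only [lieInner_add_left, lieInner_smul_left]; field_simp; ring)
    (fun i => by rw [hn]; simp only [lieInner_add_left, lieInner_smul_left]; ring)
  refine ⟨key.1, ?_⟩
  rw [← key.2, span_pair_eq_of_det_ne_zero]
  simp [hkp, hcq]

/-! ### Scalar products of the derivatives in the normal form

In the names of the following lemmas, `C` stands for the curvature sphere `A u + B v`, and `K1`, `K2`,
`K3`, `A1`, `A2` for the derivatives of `K` and `A` of the respective order. -/

namespace ChannelNormalForm

variable {I J : Set ℝ} {A B K : ℝ → LieSpace} {α : ℝ → ℝ}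

lemma smoothC (h : ChannelNormalForm I J A B K α) (u : ℝ) :
    ContDiffOn ℝ ∞ (fun v => A u + B v) J := contDiffOn_const.add h.smoothB

lemma smoothC' (h : ChannelNormalForm I J A B K α) (v : ℝ) :
    ContDiffOn ℝ ∞ (fun u => A u + B v) I := h.smoothA.add contDiffOn_const

lemma deriv_C (h : ChannelNormalForm I J A B K α) (u : ℝ) {v : ℝ} (hv : v ∈ J) :
    deriv (fun v => A u + B v) v = α v • K v := by
  rw [deriv_const_add, h.deriv_B v hv]

lemma deriv_C' (u v : ℝ) :
    deriv (fun u => A u + B v) u = deriv A u := deriv_add_const _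

lemma K_A1 (h : ChannelNormalForm I J A B K α) {u v : ℝ} (hu : u ∈ I) (hv : v ∈ J) :
    lieInner (K v) (deriv A u) = 0 := by
  have := lieInner_deriv_left h.openI (h.smoothC' v)
    (fun u hu => (lieInner_comm _ _).trans (h.orth u hu v hv)) hu
  rwa [deriv_C', lieInner_comm] at this

lemma K_A2 (h : ChannelNormalForm I J A B K α) {u v : ℝ} (hu : u ∈ I) (hv : v ∈ J) :
    lieInner (K v) (deriv (deriv A) u) = 0 := by
  rw [lieInner_comm]
  exact lieInner_deriv_left h.openI (contDiffOn_deriv h.openI h.smoothA)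
    (fun u hu => (lieInner_comm _ _).trans (h.K_A1 hu hv)) hu

lemma C_A1 (h : ChannelNormalForm I J A B K α) {u v : ℝ} (hu : u ∈ I) (hv : v ∈ J) :
    lieInner (A u + B v) (deriv A u) = 0 := by
  have := lieInner_deriv_of_const h.openI (h.smoothC' v) (h.smoothC' v)
    (fun u hu => h.null_C u hu v hv) hu
  rw [deriv_C', lieInner_comm (deriv A u)] at this
  linarith

lemma C_A2 (h : ChannelNormalForm I J A B K α) {u v : ℝ} (hu : u ∈ I) (hv : v ∈ J) :
    lieInner (A u + B v) (deriv (deriv A) u) = -lieInner (deriv A u) (deriv A u) := by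
  have := lieInner_deriv_of_const h.openI (h.smoothC' v) (contDiffOn_deriv h.openI h.smoothA)
    (fun u hu => h.C_A1 hu hv) hu
  rw [deriv_C'] at this
  linarith

lemma K_K1 (h : ChannelNormalForm I J A B K α) {v : ℝ} (hv : v ∈ J) :
    lieInner (K v) (deriv K v) = 0 := by
  have := lieInner_deriv_of_const h.openJ h.smoothK h.smoothK h.null_K hv
  rw [lieInner_comm (deriv K v)] at this
  linarith

lemma K_K2 (h : ChannelNormalForm I J A B K α) {v : ℝ} (hv : v ∈ J) :
    lieInner (K v) (deriv (deriv K) v) = -lieInner (deriv K v) (deriv K v) := by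
  have := lieInner_deriv_of_const h.openJ h.smoothK (contDiffOn_deriv h.openJ h.smoothK)
    (fun v hv => h.K_K1 hv) hv
  linarith

lemma K1_C (h : ChannelNormalForm I J A B K α) {u v : ℝ} (hu : u ∈ I) (hv : v ∈ J) :
    lieInner (deriv K v) (A u + B v) = 0 := by
  have := lieInner_deriv_of_const h.openJ h.smoothK (h.smoothC u) (fun v hv => h.orth u hu v hv) hv
  rwa [h.deriv_C u hv, lieInner_smul_right, h.null_K v hv, mul_zero, add_zero] at this

lemma K2_C (h : ChannelNormalForm I J A B K α) {u v : ℝ} (hu : u ∈ I) (hv : v ∈ J) :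
    lieInner (deriv (deriv K) v) (A u + B v) = 0 := by
  have := lieInner_deriv_of_const h.openJ (contDiffOn_deriv h.openJ h.smoothK) (h.smoothC u)
    (fun v hv => h.K1_C hu hv) hv
  rwa [h.deriv_C u hv, lieInner_smul_right, lieInner_comm (deriv K v), h.K_K1 hv, mul_zero,
    add_zero] at this

lemma K3_C (h : ChannelNormalForm I J A B K α) {u v : ℝ} (hu : u ∈ I) (hv : v ∈ J) :
    lieInner (deriv (deriv (deriv K)) v) (A u + B v) =
      α v * lieInner (deriv K v) (deriv K v) := by
  have := lieInner_deriv_of_const h.openJ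
    (contDiffOn_deriv h.openJ (contDiffOn_deriv h.openJ h.smoothK)) (h.smoothC u)
    (fun v hv => h.K2_C hu hv) hv
  rw [h.deriv_C u hv, lieInner_smul_right, lieInner_comm (deriv (deriv K) v), h.K_K2 hv] at this
  linarith

lemma K_ne_zero (h : ChannelNormalForm I J A B K α) {u v : ℝ} (hu : u ∈ I) (hv : v ∈ J) :
    K v ≠ 0 := (h.indep u hu v hv).ne_zero 0

/-- If `B` is constant, the curvature spheres `K v` lie in the span of the first derivatives of
`K` at one point, and the curvature spheres `A u + B v` are orthogonal to it. -/
lemma exists_dupin (h : ChannelNormalForm I J A B K α) (hI : I.Nonempty) (hJ : J.Nonempty)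
    (hα : ∀ v ∈ J, α v = 0) :
    ∃ e : Fin 3 → LieSpace,
      (∀ i j, lieInner (e i) (e j) = if i = j then (if i = 2 then -1 else 1) else 0) ∧
      (∀ v ∈ J, K v ∈ Submodule.span ℝ (Set.range e)) ∧
      ∀ u ∈ I, ∀ v ∈ J, ∀ i, lieInner (A u + B v) (e i) = 0 := by
  obtain ⟨u₀, hu₀⟩ := hI
  obtain ⟨v₀, hv₀⟩ := hJ
  have hB : ∀ v ∈ J, B v = B v₀ := fun v hv =>
    h.openJ.is_const_of_deriv_eq_zero h.connJ.isPreconnected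
      (h.smoothB.differentiableOn (by simp))
      (fun w hw => by simp [h.deriv_B w hw, hα w hw]) hv hv₀
  obtain ⟨e, he, heK⟩ := exists_signature_two_one (h.null_K v₀ hv₀) (h.K_K1 hv₀) (h.pos_K v₀ hv₀)
    (h.K_K2 hv₀)
  obtain ⟨f, hf, hfA⟩ := exists_signature_two_one (h.null_C u₀ hu₀ v₀ hv₀) (h.C_A1 hu₀ hv₀)
    (h.pos_A u₀ hu₀) (h.C_A2 hu₀ hv₀)
  have hS1 := contDiffOn_deriv h.openJ h.smoothK
  have hCe : ∀ u ∈ I, ∀ i, lieInner (e i) (A u + B v₀) = 0 := fun u hu =>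
    heK _ (h.orth u hu v₀ hv₀) (h.K1_C hu hv₀) (h.K2_C hu hv₀)
  have hA1e : ∀ i, lieInner (e i) (deriv A u₀) = 0 :=
    heK _ (h.K_A1 hu₀ hv₀) (lieInner_deriv_left h.openJ h.smoothK (fun v hv => h.K_A1 hu₀ hv) hv₀)
      (lieInner_deriv_left h.openJ hS1
        (fun v hv => lieInner_deriv_left h.openJ h.smoothK (fun v hv => h.K_A1 hu₀ hv) hv) hv₀)
  have hA2e : ∀ i, lieInner (e i) (deriv (deriv A) u₀) = 0 :=
    heK _ (h.K_A2 hu₀ hv₀) (lieInner_deriv_left h.openJ h.smoothK (fun v hv => h.K_A2 hu₀ hv) hv₀)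
      (lieInner_deriv_left h.openJ hS1
        (fun v hv => lieInner_deriv_left h.openJ h.smoothK (fun v hv => h.K_A2 hu₀ hv) hv) hv₀)
  have hfe : ∀ i j, lieInner (f i) (e j) = 0 := fun i j =>
    hfA _ ((lieInner_comm _ _).trans (hCe u₀ hu₀ j)) ((lieInner_comm _ _).trans (hA1e j))
      ((lieInner_comm _ _).trans (hA2e j)) i
  have hef : ∀ i j, lieInner (e i) (f j) = 0 := fun i j => (lieInner_comm _ _).trans (hfe j i)
  have hfK : ∀ v ∈ J, ∀ i, lieInner (K v) (f i) = 0 := fun v hv i => by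
    rw [lieInner_comm]
    refine hfA _ ?_ ?_ ?_ i
    · rw [lieInner_comm, ← hB v hv]; exact h.orth u₀ hu₀ v hv
    · rw [lieInner_comm]; exact h.K_A1 hu₀ hv
    · rw [lieInner_comm]; exact h.K_A2 hu₀ hv
  have hF : IsLieOrthonormal ![e 0, e 1, f 0, f 1, e 2, f 2] Finset.univ := by
    intro i _ j _
    fin_cases i <;> fin_cases j <;> simp [lieSign, he, hf, hef, hfe]
  refine ⟨e, he, fun v hv => ?_, fun u hu v hv i => ?_⟩
  · rw [hF.expand (K v)]
    refine Submodule.sum_mem _ fun i _ => ?_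
    have hmem : ∀ i, e i ∈ Submodule.span ℝ (Set.range e) := fun i =>
      Submodule.subset_span ⟨i, rfl⟩
    fin_cases i <;> simp [hfK v hv] <;> exact Submodule.smul_mem _ _ (hmem _)
  · rw [hB v hv, lieInner_comm]
    exact hCe u hu i

/-- Where `α v₀ ≠ 0`, the first three derivatives of `K` and `K` itself are linearly independent,
so that their orthogonal complement, which contains all `A' u`, is a plane. -/
lemma deriv_A_mem_span (h : ChannelNormalForm I J A B K α) {u₀ v₀ : ℝ} (hu₀ : u₀ ∈ I)
    (hv₀ : v₀ ∈ J) (hα : α v₀ ≠ 0) {u : ℝ} (hu : u ∈ I) :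
    deriv A u ∈ Submodule.span ℝ {deriv A u₀, deriv (deriv A) u₀} := by
  have hS1 := contDiffOn_deriv h.openJ h.smoothK
  have hS2 := contDiffOn_deriv h.openJ hS1
  set k : Fin 4 → LieSpace :=
    ![K v₀, deriv K v₀, deriv (deriv K) v₀, deriv (deriv (deriv K)) v₀] with hk
  have hn := (h.pos_K v₀ hv₀).ne'
  have hk_indep : LinearIndependent ℝ k := by
    rw [Fintype.linearIndependent_iff]
    intro c hc
    have hpair : ∀ w, c 0 * lieInner (K v₀) w + c 1 * lieInner (deriv K v₀) w +
        c 2 * lieInner (deriv (deriv K) v₀) w + c 3 * lieInner (deriv (deriv (deriv K)) v₀) w =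
          0 := by
      intro w
      have := congrArg (fun x => lieInner x w) hc
      simpa [Fin.sum_univ_four, hk, lieInner_add_left, lieInner_smul_left, lieInner_zero_left]
        using this
    have h3 : c 3 = 0 := by
      have := hpair (A u₀ + B v₀)
      rw [h.orth u₀ hu₀ v₀ hv₀, h.K1_C hu₀ hv₀, h.K2_C hu₀ hv₀, h.K3_C hu₀ hv₀] at this
      have h' : c 3 * (α v₀ * lieInner (deriv K v₀) (deriv K v₀)) = 0 := by linarith
      simpa [hα, hn] using h'
    have h2 : c 2 = 0 := by
      have := hpair (K v₀)
      rw [h3, h.null_K v₀ hv₀, lieInner_comm (deriv K v₀), h.K_K1 hv₀,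
        lieInner_comm (deriv (deriv K) v₀), h.K_K2 hv₀] at this
      have h' : c 2 * lieInner (deriv K v₀) (deriv K v₀) = 0 := by linarith
      simpa [hn] using h'
    have h1 : c 1 = 0 := by
      have := hpair (deriv K v₀)
      rw [h3, h2, h.K_K1 hv₀] at this
      have h' : c 1 * lieInner (deriv K v₀) (deriv K v₀) = 0 := by linarith
      simpa [hn] using h'
    have h0 : c 0 = 0 := by
      have := hpair (deriv (deriv K) v₀)
      rw [h3, h2, h1, h.K_K2 hv₀] at this
      have h' : c 0 * lieInner (deriv K v₀) (deriv K v₀) = 0 := by linarith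
      simpa [hn] using h'
    intro i
    fin_cases i <;> assumption
  have hperp : ∀ w, (∀ v ∈ J, lieInner (K v) w = 0) → ∀ i, lieInner (k i) w = 0 := by
    intro w hw
    have hw1 := fun v hv => lieInner_deriv_left h.openJ h.smoothK hw (t := v) hv
    have hw2 := fun v hv => lieInner_deriv_left h.openJ hS1 hw1 (t := v) hv
    have hw3 := fun v hv => lieInner_deriv_left h.openJ hS2 hw2 (t := v) hv
    intro i
    fin_cases i
    exacts [hw v₀ hv₀, hw1 v₀ hv₀, hw2 v₀ hv₀, hw3 v₀ hv₀]
  set R := Submodule.span ℝ (Set.range k) with hR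
  have hnd : LinearMap.BilinForm.Nondegenerate lieForm := by
    refine (LinearMap.IsRefl.nondegenerate_iff_separatingLeft (fun x y hxy => ?_)).2 fun x hx =>
      eq_zero_of_lieInner_eq_zero hx
    rw [lieForm_apply, lieInner_comm]; exact hxy
  have hdim := LinearMap.BilinForm.finrank_orthogonal hnd R
  rw [hR, finrank_span_eq_card hk_indep] at hdim
  simp only [Module.finrank_fintype_fun_eq_card, Fintype.card_fin] at hdim
  have hmem : ∀ w, (∀ v ∈ J, lieInner (K v) w = 0) →
      w ∈ LinearMap.BilinForm.orthogonal lieForm (Submodule.span ℝ (Set.range k)) := by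
    intro w hw
    rw [LinearMap.BilinForm.mem_orthogonal_iff]
    intro x hx
    have hle : Submodule.span ℝ (Set.range k) ≤ LinearMap.ker (lieForm.flip w) := by
      rw [Submodule.span_le]
      rintro _ ⟨i, rfl⟩
      exact hperp w hw i
    exact hle hx
  have hindep : LinearIndependent ℝ ![deriv A u₀, deriv (deriv A) u₀] := by
    rw [LinearIndependent.pair_iff]
    intro s t hst
    have hm := (h.pos_A u₀ hu₀).ne'
    have h1 := congrArg (lieInner (A u₀ + B v₀)) hst
    rw [lieInner_add_right, lieInner_smul_right, lieInner_smul_right, h.C_A1 hu₀ hv₀,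
      h.C_A2 hu₀ hv₀, lieInner_zero_right] at h1
    have ht : t = 0 := by
      have h' : t * lieInner (deriv A u₀) (deriv A u₀) = 0 := by linarith
      simpa [hm] using h'
    refine ⟨?_, ht⟩
    have h2 := congrArg (lieInner (deriv A u₀)) hst
    rw [ht, zero_smul, add_zero, lieInner_smul_right, lieInner_zero_right] at h2
    simpa [hm] using h2
  have hspan : Submodule.span ℝ {deriv A u₀, deriv (deriv A) u₀} =
      LinearMap.BilinForm.orthogonal lieForm (Submodule.span ℝ (Set.range k)) := by
    refine Submodule.eq_of_le_of_finrank_eq ?_ ?_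
    · rw [Submodule.span_le]
      rintro x (rfl | rfl)
      · exact hmem _ fun v hv => h.K_A1 hu₀ hv
      · exact hmem _ fun v hv => h.K_A2 hu₀ hv
    · have := finrank_span_eq_card hindep
      rw [Matrix.range_cons, Matrix.range_cons, Matrix.range_empty, Set.union_empty,
        Set.singleton_union] at this
      rw [this, hdim]; simp
  rw [hspan]
  exact hmem _ fun v hv => h.K_A1 hu hv

/-- The `w`-component of `A u + B v` does not depend on `v` if `w` is orthogonal to all `K v`. -/
lemma C_const_of_K (h : ChannelNormalForm I J A B K α) {w : LieSpace}
    (hw : ∀ v ∈ J, lieInner (K v) w = 0) (u : ℝ) {v v' : ℝ} (hv : v ∈ J) (hv' : v' ∈ J) :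
    lieInner (A u + B v) w = lieInner (A u + B v') w :=
  lieInner_const_of_deriv h.openJ h.connJ (h.smoothC u)
    (fun t ht => by rw [h.deriv_C u ht, lieInner_smul_left, hw t ht, mul_zero]) hv hv'

/-- The `w`-component of `A u + B v` does not depend on `u` if `w` is orthogonal to all `A' u`. -/
lemma C_const_of_A (h : ChannelNormalForm I J A B K α) {w : LieSpace}
    (hw : ∀ u ∈ I, lieInner (deriv A u) w = 0) {u u' : ℝ} (hu : u ∈ I) (hu' : u' ∈ I) (v : ℝ) :
    lieInner (A u + B v) w = lieInner (A u' + B v) w :=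
  lieInner_const_of_deriv h.openI h.connI (h.smoothC' v)
    (fun t ht => by rw [deriv_C', hw t ht]) hu hu'

end ChannelNormalForm

/-! ### Cones, cylinders and surfaces of revolution -/

lemma contDiffOn_lieInner_const {f : ℝ → LieSpace} {S : Set ℝ} (hf : ContDiffOn ℝ ∞ f S)
    (w : LieSpace) : ContDiffOn ℝ ∞ (fun t => lieInner (f t) w) S :=
  hf.lieInner contDiffOn_const

lemma contDiffOn_toLp {f : ℝ → Fin 3 → ℝ} {S : Set ℝ}
    (hf : ∀ i, ContDiffOn ℝ ∞ (fun t => f t i) S) :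
    ContDiffOn ℝ ∞ (fun t => WithLp.toLp 2 (f t)) S :=
  contDiffOn_euclidean.2 hf

/-- The lines spanned by a smooth curve in `ℝ³` do not fill any open set. -/
lemma exists_not_mem_lines {J : Set ℝ} (hJ : J.OrdConnected) {k : ℝ → Fin 3 → ℝ}
    (hk : ContDiffOn ℝ ∞ k J) :
    ∃ x : Fin 3 → ℝ, x 2 ^ 2 < x 0 ^ 2 + x 1 ^ 2 ∧ ∀ v ∈ J, ∀ s : ℝ, x ≠ s • k v := by
  have hφ : ContDiffOn ℝ 1 (fun z : ℝ × ℝ => z.2 • k z.1) (J ×ˢ Set.univ) :=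
    (contDiffOn_snd.smul (hk.comp contDiffOn_fst fun z hz => hz.1)).of_le (by simp)
  have hfin : Module.finrank ℝ (ℝ × ℝ) < Module.finrank ℝ (Fin 3 → ℝ) := by simp
  have hdense := hφ.dense_compl_image_of_dimH_lt_finrank (hJ.convex.prod convex_univ) subset_rfl
    (((dimH_mono (Set.subset_univ _)).trans_eq (Real.dimH_univ_eq_finrank _)).trans_lt
      (Nat.cast_lt.2 hfin))
  have hopen : IsOpen {x : Fin 3 → ℝ | x 2 ^ 2 < x 0 ^ 2 + x 1 ^ 2} :=
    isOpen_lt (by fun_prop) (by fun_prop)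
  obtain ⟨x, hx, hxk⟩ := hdense.inter_open_nonempty _ hopen ⟨![1, 0, 0], by simp⟩
  refine ⟨x, hx, fun v hv s hs => hxk ⟨(v, s), ⟨hv, Set.mem_univ _⟩, hs.symm⟩⟩

namespace ChannelNormalForm

variable {I J : Set ℝ} {A B K : ℝ → LieSpace} {α : ℝ → ℝ}
  {L : ℝ × ℝ → Submodule ℝ LieSpace} {W : Set (ℝ × ℝ)}
  {κ : OpenPartialHomeomorph (ℝ × ℝ) (ℝ × ℝ)}

lemma lieInner_deriv_A_eq_zero {e f w : LieSpace}
    (hA : ∀ u ∈ I, deriv A u ∈ Submodule.span ℝ {e, f}) (hwe : lieInner e w = 0)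
    (hwf : lieInner f w = 0) {u : ℝ} (hu : u ∈ I) : lieInner (deriv A u) w = 0 := by
  obtain ⟨a, b, hab⟩ := Submodule.mem_span_pair.1 (hA u hu)
  rw [← hab, lieInner_add_left, lieInner_smul_left, lieInner_smul_left, hwe, hwf]
  ring

lemma not_orthogonal (h : ChannelNormalForm I J A B K α) {e f : LieSpace}
    (hA : ∀ u ∈ I, deriv A u ∈ Submodule.span ℝ {e, f}) {u v : ℝ} (hu : u ∈ I) (hv : v ∈ J)
    (he : lieInner (A u + B v) e = 0) (hf : lieInner (A u + B v) f = 0) : False := by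
  have h1 := lieInner_deriv_left h.openI (contDiffOn_deriv h.openI h.smoothA)
    (fun t ht => lieInner_deriv_A_eq_zero hA ((lieInner_comm _ _).trans he)
      ((lieInner_comm _ _).trans hf) ht) hu
  rw [lieInner_comm, h.C_A2 hu hv] at h1
  linarith [h.pos_A u hu]

/-- If the curvature spheres `A u + B v` move parallel to a plane of signature `(1, 1)`, the
surface is a cone: the null lines of this plane are the point at infinity and the vertex. -/
lemma exists_isCone (h : ChannelNormalForm I J A B K α) (hκ : IsCoordinateRectangle κ W I J)
    (hL : ∀ u ∈ I, ∀ v ∈ J, L (κ.symm (u, v)) = Submodule.span ℝ {K v, A u + B v})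
    {u₀ v₀ : ℝ} (hu₀ : u₀ ∈ I) (hv₀ : v₀ ∈ J) {e f : LieSpace} (hee : lieInner e e = 1)
    (hff : lieInner f f = -1) (hef : lieInner e f = 0) (hKe : ∀ v ∈ J, lieInner (K v) e = 0)
    (hKf : ∀ v ∈ J, lieInner (K v) f = 0) (hA : ∀ u ∈ I, deriv A u ∈ Submodule.span ℝ {e, f}) :
    ∃ p q, IsEuclideanSubgeometry p q ∧ IsCone p q L W := by
  have hfe := (lieInner_comm f e).trans hef
  obtain ⟨F, hFS, hF⟩ := IsLieOrthonormal.exists_extension (f := ![e, 0, 0, 0, f, 0]) (S := {0, 4})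
    (by
      intro i hi j hj
      simp only [Finset.mem_insert, Finset.mem_singleton] at hi hj
      rcases hi with rfl | rfl <;> rcases hj with rfl | rfl <;> simp [lieSign, hee, hff, hef, hfe])
  have hF0 : F 0 = e := hFS 0 (by simp)
  have hF4 : F 4 = f := hFS 4 (by simp)
  have hFF : ∀ i j, lieInner (F i) (F j) = if i = j then lieSign i else 0 := fun i j =>
    hF i (Finset.mem_univ _) j (Finset.mem_univ _)
  set p := F 5 with hp
  set q := f + e with hq
  set o := (1 / 2 : ℝ) • (f - e) with ho
  set E : Fin 3 → LieSpace := ![F 1, F 2, F 3] with hE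
  have hpp : lieInner p p = -1 := by simp [hp, hFF, lieSign]
  have hep : lieInner e p = 0 := by rw [← hF0, hp, hFF]; simp
  have hfp : lieInner f p = 0 := by rw [← hF4, hp, hFF]; simp
  have hpe := (lieInner_comm p e).trans hep
  have hpf := (lieInner_comm p f).trans hfp
  have hEe : ∀ i, lieInner (E i) e = 0 := by
    intro i; rw [← hF0]; fin_cases i <;> simp [hE, hFF]
  have hEf : ∀ i, lieInner (E i) f = 0 := by
    intro i; rw [← hF4]; fin_cases i <;> simp [hE, hFF]
  have hEp : ∀ i, lieInner (E i) p = 0 := by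
    intro i; fin_cases i <;> simp [hE, hp, hFF]
  have hoq : lieInner o q = -1 := by
    simp only [ho, hq, lieInner_smul_left, lieInner_sub_left, lieInner_add_right, hee, hff, hef, hfe]
    norm_num
  have hpq : IsEuclideanSubgeometry p q := by
    refine ⟨hpp, ?_, ?_, ?_⟩
    · simp [hq, lieInner_add_right, hpe, hpf]
    · simp [hq, lieInner_add_right, lieInner_add_left, hee, hff, hef, hfe]
    · intro h0
      rw [h0, lieInner_zero_right] at hoq
      norm_num at hoq
  have hfr : IsCartesianFrame p q o E := by
    refine ⟨?_, ?_, hoq, ?_, fun i => ⟨hEp i, ?_, ?_⟩⟩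
    · simp [ho, lieInner_smul_left, lieInner_smul_right, lieInner_sub_left, lieInner_sub_right, hee,
        hff, hef, hfe]
    · simp [ho, lieInner_smul_left, lieInner_sub_left, hep, hfp]
    · intro i j
      fin_cases i <;> fin_cases j <;> simp [hE, hFF, lieSign]
    · simp [hq, lieInner_add_right, hEe, hEf]
    · simp [ho, lieInner_smul_right, lieInner_sub_right, hEe, hEf]
  have hKq : ∀ v ∈ J, lieInner (K v) q = 0 := fun v hv => by
    simp [hq, lieInner_add_right, hKe v hv, hKf v hv]
  have hKo : ∀ v ∈ J, lieInner (K v) o = 0 := fun v hv => by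
    simp [ho, lieInner_smul_right, lieInner_sub_right, hKe v hv, hKf v hv]
  have hKp : ∀ v ∈ J, lieInner (K v) p ≠ 0 := by
    intro v hv h0
    have := hfr.eq_smul_of_null hpq (h.null_K v hv) h0 (hKq v hv)
    rw [hKo v hv, neg_zero, zero_smul] at this
    exact h.K_ne_zero hu₀ hv this
  -- `A + B` is orthogonal to the spacelike vector `A'`, so it has components along both null lines.
  have hCq : ∀ u ∈ I, ∀ v ∈ J, lieInner (A u + B v) q ≠ 0 ∧ lieInner (A u + B v) o ≠ 0 ∧
      lieInner (deriv A u) q ≠ 0 := by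
    intro u hu v hv
    obtain ⟨a, b, hab⟩ := Submodule.mem_span_pair.1 (hA u hu)
    have h1 := h.C_A1 hu hv
    have h2 := h.pos_A u hu
    rw [← hab] at h1 h2
    simp only [lieInner_add_left (a • e), lieInner_add_right, lieInner_smul_left,
      lieInner_smul_right, hee, hff, hef, hfe] at h1 h2
    have h3 : 0 < (a - b) * (a + b) := by linarith
    have hm : a - b ≠ 0 := left_ne_zero_of_mul h3.ne'
    have hp : a + b ≠ 0 := right_ne_zero_of_mul h3.ne'
    refine ⟨fun h0 => ?_, fun h0 => ?_, ?_⟩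
    · rw [hq, lieInner_add_right] at h0
      have h4 : (a - b) * lieInner (A u + B v) e = 0 := by linear_combination h1 - b * h0
      have h5 := (mul_eq_zero.1 h4).resolve_left hm
      exact h.not_orthogonal hA hu hv h5 (by linarith)
    · rw [ho, lieInner_smul_right, lieInner_sub_right] at h0
      have h4 : (a + b) * lieInner (A u + B v) e = 0 := by linear_combination h1 - 2 * b * h0
      have h5 := (mul_eq_zero.1 h4).resolve_left hp
      exact h.not_orthogonal hA hu hv h5 (by linarith)
    · rw [← hab, hq]
      simp only [lieInner_add_left, lieInner_add_right, lieInner_smul_left, hee, hff, hef, hfe]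
      intro h0
      exact hm (by linarith)
  have hAE : ∀ u ∈ I, ∀ i, lieInner (deriv A u) (E i) = 0 := fun u hu i =>
    lieInner_deriv_A_eq_zero hA ((lieInner_comm _ _).trans (hEe i))
      ((lieInner_comm _ _).trans (hEf i)) hu
  have hAp : ∀ u ∈ I, lieInner (deriv A u) p = 0 := fun u hu =>
    lieInner_deriv_A_eq_zero hA hep hfp hu
  set x : ℝ → ℝ := fun u => -lieInner (A u + B v₀) q with hx
  have hxs : ContDiffOn ℝ ∞ x I := (contDiffOn_lieInner_const (h.smoothC' v₀) q).neg
  have hx0 : ∀ u ∈ I, x u ≠ 0 := fun u hu => neg_ne_zero.2 (hCq u hu v₀ hv₀).1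
  obtain ⟨ς, hς, hςx⟩ : ∃ ς : ℝ, ς * ς = 1 ∧ ∀ u ∈ I, x u = ς * |x u| := by
    rcases h.connI.isPreconnected.eq_or_eq_neg_of_sq_eq hxs.continuousOn hxs.continuousOn.abs
      (fun u _ => by simp) (fun {u} hu => abs_ne_zero.2 (hx0 u hu)) with h1 | h1
    · exact ⟨1, by norm_num, fun u hu => by rw [one_mul]; exact h1 hu⟩
    · exact ⟨-1, by norm_num, fun u hu => by rw [neg_one_mul]; exact h1 hu⟩
  have hς0 : ς ≠ 0 := fun h0 => by simp [h0] at hς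
  set θ : ℝ → ℝ := fun u => -Real.log (x u) with hθ
  have hθs : ContDiffOn ℝ ∞ θ I := (hxs.log hx0).neg
  have hθ' : ∀ u ∈ I, deriv θ u ≠ 0 := by
    intro u hu
    have h1 : HasDerivAt x (-(lieInner (deriv A u) q)) u := by
      have := ((hasDerivAt_of_contDiffOn h.openI (h.smoothC' v₀) hu).lieInner
        (hasDerivAt_const u q)).neg
      exact this.congr_deriv (by rw [deriv_C', lieInner_zero_right, add_zero])
    have h2 : HasDerivAt θ _ u := (h1.log (hx0 u hu)).neg
    rw [h2.deriv]
    exact neg_ne_zero.2 (div_ne_zero (neg_ne_zero.2 (hCq u hu v₀ hv₀).2.2) (hx0 u hu))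
  have hexp : ∀ u ∈ I, Real.exp (θ u) * ς = 1 / x u := by
    intro u hu
    have h1 := hςx u hu
    have h2 := abs_ne_zero.2 (hx0 u hu)
    rw [hθ]
    simp only
    rw [Real.exp_neg, Real.exp_log_eq_abs (hx0 u hu)]
    conv_rhs => rw [h1]
    field_simp
    linarith
  obtain ⟨κ', J', hκ', hsymm⟩ := hκ.exists_reparam hθs hθ'
  have hCp := contDiffOn_lieInner_const (h.smoothC u₀) p
  have hKps := contDiffOn_lieInner_const h.smoothK p
  set n : ℝ → EuclideanSpace ℝ (Fin 3) := fun t =>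
    WithLp.toLp 2 fun i => -(1 / lieInner (K t) p) * lieInner (K t) (E i) with hn
  set c : ℝ → EuclideanSpace ℝ (Fin 3) := fun t =>
    WithLp.toLp 2 fun i => ς * (lieInner (A u₀ + B t) (E i) -
      lieInner (A u₀ + B t) p / lieInner (K t) p * lieInner (K t) (E i)) with hc
  have hCE : ∀ u ∈ I, ∀ t i, lieInner (A u + B t) (E i) = lieInner (A u₀ + B t) (E i) :=
    fun u hu t i => h.C_const_of_A (fun u hu => hAE u hu i) hu hu₀ t
  have hCp' : ∀ u ∈ I, ∀ t, lieInner (A u + B t) p = lieInner (A u₀ + B t) p :=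
    fun u hu t => h.C_const_of_A hAp hu hu₀ t
  have hCq' : ∀ u, ∀ t ∈ J, lieInner (A u + B t) q = -x u := fun u t ht => by
    rw [hx, neg_neg]
    exact h.C_const_of_K hKq u ht hv₀
  have hcontact : ∀ u ∈ I, ∀ t ∈ J, ‖n t‖ = 1 ∧
      L (κ.symm (u, t)) = contactElement p q o E (Real.exp (θ u) • c t) (n t) := by
    intro u hu t ht
    rw [hL u hu t ht]
    refine hfr.span_eq_contactElement_of_plane hpq (h.null_K t ht) (h.orth u hu t ht)
      (h.null_C u hu t ht) (hKq t ht) (hKp t ht) (hCq u hu t ht).1 _ _ (fun i => ?_) (fun i => rfl)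
    rw [hCE u hu, hCp' u hu, hCq' u t ht, hc]
    simp only [PiLp.smul_apply, smul_eq_mul]
    rw [← mul_assoc, hexp u hu]
    field_simp
  refine ⟨p, q, hpq, o, E, hfr, κ', J, J', hκ', c, n, ?_, ?_, fun t ht => ⟨fun h0 => ?_, ?_⟩, ?_⟩
  · refine contDiffOn_toLp fun i => contDiffOn_const.mul ?_
    exact (contDiffOn_lieInner_const (h.smoothC u₀) (E i)).sub ((hCp.div hKps hKp).mul
      (contDiffOn_lieInner_const h.smoothK (E i)))
  · exact contDiffOn_toLp fun i => (contDiffOn_const.div hKps hKp).neg.mul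
      (contDiffOn_lieInner_const h.smoothK (E i))
  · -- The point with vanishing coordinates is the vertex, which is orthogonal to `o`.
    have h1 : ∀ i, lieInner (A u₀ + B t) (E i) =
        lieInner (A u₀ + B t) p / lieInner (K t) p * lieInner (K t) (E i) := fun i => by
      have h2 : ς * (lieInner (A u₀ + B t) (E i) -
        lieInner (A u₀ + B t) p / lieInner (K t) p * lieInner (K t) (E i)) = 0 := congrFun
          (congrArg WithLp.ofLp h0) i
      linarith [(mul_eq_zero.1 h2).resolve_left hς0]
    have h2 := hfr.lieInner_eq hpq (A u₀ + B t) (A u₀ + B t)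
    have h3 := hfr.lieInner_eq hpq (A u₀ + B t) (K t)
    rw [lieInner_comm _ (K t), h.orth u₀ hu₀ t ht, hKq t ht, hKo t ht] at h3
    rw [h.null_C u₀ hu₀ t ht] at h2
    have h4 : ∑ i, lieInner (A u₀ + B t) (E i) * lieInner (A u₀ + B t) (E i) =
        lieInner (A u₀ + B t) p / lieInner (K t) p *
          ∑ i, lieInner (A u₀ + B t) (E i) * lieInner (K t) (E i) := by
      rw [Finset.mul_sum]
      refine Finset.sum_congr rfl fun i _ => ?_
      conv_lhs => rw [h1 i]
      rw [h1 i]; ring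
    have h5 : ∑ i, lieInner (A u₀ + B t) (E i) * lieInner (K t) (E i) =
        lieInner (A u₀ + B t) p * lieInner (K t) p := by linarith
    rw [h4, h5] at h2
    have h6 := hKp t ht
    have h7 : lieInner (A u₀ + B t) p / lieInner (K t) p *
        (lieInner (A u₀ + B t) p * lieInner (K t) p) =
          lieInner (A u₀ + B t) p * lieInner (A u₀ + B t) p := by field_simp
    rw [h7] at h2
    have h8 := hCq u₀ hu₀ t ht
    exact mul_ne_zero h8.1 h8.2.1 (by linarith)
  · exact (hcontact u₀ hu₀ t ht).1
  · intro t ht s hs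
    obtain ⟨u, hu, rfl, hus⟩ := hsymm t ht s hs
    rw [hus]
    exact (hcontact u hu t ht).2

/-- If the curvature spheres `A u + B v` move parallel to a plane with degenerate inner product,
the surface is a cylinder: the null line of this plane is the point at infinity. -/
lemma exists_isCylinder (h : ChannelNormalForm I J A B K α) (hκ : IsCoordinateRectangle κ W I J)
    (hL : ∀ u ∈ I, ∀ v ∈ J, L (κ.symm (u, v)) = Submodule.span ℝ {K v, A u + B v})
    {u₀ v₀ : ℝ} (hu₀ : u₀ ∈ I) (hv₀ : v₀ ∈ J) {e q : LieSpace} (hee : lieInner e e = 1)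
    (hqq : lieInner q q = 0) (hq0 : q ≠ 0) (heq : lieInner e q = 0)
    (hKe : ∀ v ∈ J, lieInner (K v) e = 0) (hKq : ∀ v ∈ J, lieInner (K v) q = 0)
    (hA : ∀ u ∈ I, deriv A u ∈ Submodule.span ℝ {e, q}) :
    ∃ p q, IsEuclideanSubgeometry p q ∧ IsCylinder p q L W := by
  have hqe := (lieInner_comm q e).trans heq
  -- a null vector `o` orthogonal to `e` with `(o, q) = -1`
  obtain ⟨o, hoo, hoe, hoq⟩ : ∃ o, lieInner o o = 0 ∧ lieInner o e = 0 ∧ lieInner o q = -1 := by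
    obtain ⟨z, hz⟩ : ∃ z, lieInner z q ≠ 0 := by
      by_contra! hcon
      exact hq0 (eq_zero_of_lieInner_eq_zero fun y => (lieInner_comm _ _).trans (hcon y))
    set w := (-(1 / lieInner z q)) • (z - lieInner z e • e) with hw
    have hwe : lieInner w e = 0 := by
      simp only [hw, lieInner_smul_left, lieInner_sub_left, hee]
      ring
    have hwq : lieInner w q = -1 := by
      simp only [hw, lieInner_smul_left, lieInner_sub_left, heq]
      field_simp
      ring
    have hqw := (lieInner_comm q w).trans hwq
    refine ⟨w + (lieInner w w / 2) • q, ?_, ?_, ?_⟩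
    · simp only [lieInner_add_left, lieInner_add_right, lieInner_smul_left, lieInner_smul_right, hwq,
        hqw, hqq]
      ring
    · simp [lieInner_add_left, lieInner_smul_left, hwe, hqe]
    · simp [lieInner_add_left, lieInner_smul_left, hwq, hqq]
  have hqo := (lieInner_comm q o).trans hoq
  have heo := (lieInner_comm e o).trans hoe
  obtain ⟨F, hFS, hF⟩ := IsLieOrthonormal.exists_extension
    (f := ![e, o - (1 / 2 : ℝ) • q, 0, 0, o + (1 / 2 : ℝ) • q, 0]) (S := {0, 1, 4})
    (by
      intro i hi j hj
      simp only [Finset.mem_insert, Finset.mem_singleton] at hi hj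
      rcases hi with rfl | rfl | rfl <;> rcases hj with rfl | rfl | rfl <;>
        simp [lieSign, hee, hqq, heq, hqe, hoo, hoe, heo, hoq, hqo, lieInner_add_left,
          lieInner_add_right, lieInner_sub_left, lieInner_sub_right, lieInner_smul_left,
          lieInner_smul_right] <;> norm_num)
  have hF0 : F 0 = e := hFS 0 (by simp)
  have hF1 : F 1 = o - (1 / 2 : ℝ) • q := hFS 1 (by simp)
  have hF4 : F 4 = o + (1 / 2 : ℝ) • q := hFS 4 (by simp)
  have hFF : ∀ i j, lieInner (F i) (F j) = if i = j then lieSign i else 0 := fun i j =>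
    hF i (Finset.mem_univ _) j (Finset.mem_univ _)
  have hoF : o = (1 / 2 : ℝ) • (F 1 + F 4) := by rw [hF1, hF4]; module
  have hqF : q = F 4 - F 1 := by rw [hF1, hF4]; module
  set p := F 5 with hp
  set E : Fin 3 → LieSpace := ![F 2, F 3, e] with hE
  have hpq : IsEuclideanSubgeometry p q := by
    refine ⟨by simp [hp, hFF, lieSign], ?_, hqq, hq0⟩
    rw [hqF, lieInner_sub_right]; simp [hp, hFF]
  have hfr : IsCartesianFrame p q o E := by
    refine ⟨hoo, ?_, hoq, ?_, fun i => ⟨?_, ?_, ?_⟩⟩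
    · rw [hoF, lieInner_smul_left, lieInner_add_left]; simp [hp, hFF]
    · intro i j
      rw [hE, ← hF0]
      fin_cases i <;> fin_cases j <;> simp [hFF, lieSign]
    · rw [hE, ← hF0]; fin_cases i <;> simp [hp, hFF]
    · rw [hE, ← hF0, hqF, lieInner_sub_right]; fin_cases i <;> simp [hFF]
    · rw [hE, ← hF0, hoF, lieInner_smul_right, lieInner_add_right]; fin_cases i <;> simp [hFF]
  have hE2 : E 2 = e := rfl
  have hEe : ∀ i, i ≠ 2 → lieInner e (E i) = 0 := by
    intro i hi
    rw [← hE2, hfr.2.2.2.1, if_neg hi.symm]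
  have hqE : ∀ i, lieInner q (E i) = 0 := fun i =>
    (lieInner_comm _ _).trans (hfr.2.2.2.2 i).2.1
  have hAE : ∀ u ∈ I, ∀ i, i ≠ 2 → lieInner (deriv A u) (E i) = 0 := fun u hu i hi =>
    lieInner_deriv_A_eq_zero hA (hEe i hi) (hqE i) hu
  have hAp : ∀ u ∈ I, lieInner (deriv A u) p = 0 := fun u hu =>
    lieInner_deriv_A_eq_zero hA (hfr.2.2.2.2 2).1 ((lieInner_comm _ _).trans hpq.2.1) hu
  have hAq : ∀ u ∈ I, lieInner (deriv A u) q = 0 := fun u hu =>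
    lieInner_deriv_A_eq_zero hA heq hqq hu
  have hAe : ∀ u ∈ I, lieInner (deriv A u) e ≠ 0 := by
    intro u hu h0
    obtain ⟨a, b, hab⟩ := Submodule.mem_span_pair.1 (hA u hu)
    have h1 := h.pos_A u hu
    rw [← hab] at h0 h1
    simp only [lieInner_add_left, lieInner_add_right, lieInner_smul_left, lieInner_smul_right, hee,
      heq, hqe, hqq] at h0 h1
    have h2 : a = 0 := by linarith
    rw [h2] at h1
    linarith
  set d := lieInner (A u₀ + B v₀) q with hd
  have hCq : ∀ u ∈ I, ∀ v ∈ J, lieInner (A u + B v) q = d := fun u hu v hv =>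
    (h.C_const_of_K hKq u hv hv₀).trans (h.C_const_of_A hAq hu hu₀ v₀)
  have hd0 : d ≠ 0 := by
    intro h0
    have h1 := h.C_A1 hu₀ hv₀
    obtain ⟨a, b, hab⟩ := Submodule.mem_span_pair.1 (hA u₀ hu₀)
    have ha : a ≠ 0 := by
      have := hAe u₀ hu₀
      rw [← hab] at this
      simpa [lieInner_add_left, lieInner_smul_left, hee, hqe] using this
    rw [← hab, lieInner_add_right, lieInner_smul_right, lieInner_smul_right, ← hd, h0, mul_zero,
      add_zero] at h1
    exact h.not_orthogonal hA hu₀ hv₀ ((mul_eq_zero.1 h1).resolve_left ha) h0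
  have hKp : ∀ v ∈ J, lieInner (K v) p ≠ 0 := by
    intro v hv h0
    have h1 := hfr.eq_smul_of_null hpq (h.null_K v hv) h0 (hKq v hv)
    have h2 := h.orth u₀ hu₀ v hv
    rw [h1, lieInner_smul_left, lieInner_comm q, hCq u₀ hu₀ v hv] at h2
    rw [(mul_eq_zero.1 h2).resolve_right hd0, zero_smul] at h1
    exact h.K_ne_zero hu₀ hv h1
  set θ : ℝ → ℝ := fun u => -(1 / d) * lieInner (A u + B v₀) e with hθ
  have hθs : ContDiffOn ℝ ∞ θ I :=
    contDiffOn_const.mul (contDiffOn_lieInner_const (h.smoothC' v₀) e)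
  have hθ' : ∀ u ∈ I, deriv θ u ≠ 0 := by
    intro u hu
    have h1 := (((hasDerivAt_of_contDiffOn h.openI (h.smoothC' v₀) hu).lieInner
      (hasDerivAt_const u e)).const_mul (-(1 / d)))
    rw [deriv_C', lieInner_zero_right, add_zero] at h1
    rw [h1.deriv]
    exact mul_ne_zero (neg_ne_zero.2 (one_div_ne_zero hd0)) (hAe u hu)
  obtain ⟨κ', J', hκ', hsymm⟩ := hκ.exists_reparam hθs hθ'
  have hCp := contDiffOn_lieInner_const (h.smoothC u₀) p
  have hKps := contDiffOn_lieInner_const h.smoothK p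
  set n : Fin 3 → ℝ → ℝ := fun i t => -(1 / lieInner (K t) p) * lieInner (K t) (E i) with hn
  set c : Fin 3 → ℝ → ℝ := fun i t => -(1 / d) * (lieInner (A u₀ + B t) (E i) -
      lieInner (A u₀ + B t) p / lieInner (K t) p * lieInner (K t) (E i)) with hc
  have hns : ∀ i, ContDiffOn ℝ ∞ (n i) J := fun i => (contDiffOn_const.div hKps hKp).neg.mul
    (contDiffOn_lieInner_const h.smoothK (E i))
  have hcs : ∀ i, ContDiffOn ℝ ∞ (c i) J := fun i => contDiffOn_const.mul
    ((contDiffOn_lieInner_const (h.smoothC u₀) (E i)).sub ((hCp.div hKps hKp).mul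
      (contDiffOn_lieInner_const h.smoothK (E i))))
  have hcontact : ∀ u ∈ I, ∀ t ∈ J, ‖(!₂[n 0 t, n 1 t, 0] : EuclideanSpace ℝ (Fin 3))‖ = 1 ∧
      L (κ.symm (u, t)) = contactElement p q o E !₂[c 0 t, c 1 t, θ u] !₂[n 0 t, n 1 t, 0] := by
    intro u hu t ht
    rw [hL u hu t ht]
    have hCE : ∀ i, i ≠ 2 → lieInner (A u + B t) (E i) = lieInner (A u₀ + B t) (E i) :=
      fun i hi => h.C_const_of_A (fun u hu => hAE u hu i hi) hu hu₀ t
    have hCp' : lieInner (A u + B t) p = lieInner (A u₀ + B t) p :=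
      h.C_const_of_A hAp hu hu₀ t
    refine hfr.span_eq_contactElement_of_plane hpq (h.null_K t ht) (h.orth u hu t ht)
      (h.null_C u hu t ht) (hKq t ht) (hKp t ht) (by rw [hCq u hu t ht]; exact hd0) _ _ ?_ ?_
    · intro i
      rw [hCq u hu t ht, hCp']
      fin_cases i
      · simpa [hc] using Or.inl (by rw [hCE 0 (by decide)])
      · simpa [hc] using Or.inl (by rw [hCE 1 (by decide)])
      · have h1 := h.C_const_of_K hKe u ht hv₀
        simp [hE2, hKe t ht, hθ, h1]
    · intro i
      fin_cases i
      · simp [hn]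
      · simp [hn]
      · simp [hE2, hKe t ht]
  refine ⟨p, q, hpq, o, E, hfr, κ', J, J', hκ', c 0, c 1, n 0, n 1, hcs 0, hcs 1, hns 0, hns 1,
    fun t ht => ?_, ?_⟩
  · have h1 := (hcontact u₀ hu₀ t ht).1
    have h2 := EuclideanSpace.norm_sq_eq (!₂[n 0 t, n 1 t, 0] : EuclideanSpace ℝ (Fin 3))
    rw [h1] at h2
    simpa [Fin.sum_univ_three] using h2.symm
  · intro t ht s hs
    obtain ⟨u, hu, rfl, hus⟩ := hsymm t ht s hs
    rw [hus]
    exact (hcontact u hu t ht).2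

end ChannelNormalForm

/-- Two orthonormal spacelike vectors are part of a Cartesian frame of a Euclidean subgeometry
whose space form vector is not proportional to any of the vectors of a given smooth curve: in terms
of an orthonormal basis, the space form vector may be prescribed by three of its components. -/
lemma exists_isCartesianFrame_avoiding {J : Set ℝ} (hJ : J.OrdConnected) {K : ℝ → LieSpace}
    (hK : ContDiffOn ℝ ∞ K J) {e f : LieSpace} (hee : lieInner e e = 1) (hff : lieInner f f = 1)
    (hef : lieInner e f = 0) :
    ∃ p q o E, IsEuclideanSubgeometry p q ∧ IsCartesianFrame p q o E ∧ E 0 = e ∧ E 1 = f ∧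
      ∀ v ∈ J, ∀ s : ℝ, q ≠ s • K v := by
  have hfe := (lieInner_comm f e).trans hef
  obtain ⟨F, hFS, hF⟩ := IsLieOrthonormal.exists_extension (f := ![e, f, 0, 0, 0, 0]) (S := {0, 1})
    (by
      intro i hi j hj
      simp only [Finset.mem_insert, Finset.mem_singleton] at hi hj
      rcases hi with rfl | rfl <;> rcases hj with rfl | rfl <;> simp [lieSign, hee, hff, hef, hfe])
  have hF0 : F 0 = e := hFS 0 (by simp)
  have hF1 : F 1 = f := hFS 1 (by simp)
  have hFF : ∀ i j, lieInner (F i) (F j) = if i = j then lieSign i else 0 := fun i j =>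
    hF i (Finset.mem_univ _) j (Finset.mem_univ _)
  have hks : ContDiffOn ℝ ∞ (fun v => ![lieInner (K v) (F 2), lieInner (K v) (F 3),
      -lieInner (K v) (F 4)]) J := by
    rw [contDiffOn_pi]
    intro i
    fin_cases i
    · exact contDiffOn_lieInner_const hK _
    · exact contDiffOn_lieInner_const hK _
    · exact (contDiffOn_lieInner_const hK _).neg
  obtain ⟨x, hx, hxK⟩ := exists_not_mem_lines hJ hks
  set N := x 0 ^ 2 + x 1 ^ 2 with hN
  have hN0 : 0 < N := (sq_nonneg _).trans_lt hx
  set r := Real.sqrt N with hr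
  have hr0 : r ≠ 0 := (Real.sqrt_pos.2 hN0).ne'
  have hrr : r ^ 2 = x 0 ^ 2 + x 1 ^ 2 := Real.sq_sqrt hN0.le
  set y := Real.sqrt (N - x 2 ^ 2) with hy
  have hyy : x 2 ^ 2 + y ^ 2 = x 0 ^ 2 + x 1 ^ 2 := by
    rw [hy, Real.sq_sqrt (by linarith)]; ring
  have hyr : x 2 ^ 2 + y ^ 2 = r ^ 2 := hyy.trans hrr.symm
  set q : LieSpace := x 0 • F 2 + x 1 • F 3 + x 2 • F 4 + y • F 5 with hq
  set o : LieSpace := (1 / (2 * r ^ 2)) •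
    ((-x 0) • F 2 + (-x 1) • F 3 + x 2 • F 4 + y • F 5) with ho
  set p : LieSpace := (1 / r) • (y • F 4 + (-x 2) • F 5) with hp
  set g : LieSpace := (1 / r) • ((-x 1) • F 2 + x 0 • F 3) with hg
  set E : Fin 3 → LieSpace := ![F 0, F 1, g] with hE
  have hgg : lieInner g g = 1 := by
    simp [hg, lieInner_smul_left, lieInner_smul_right, lieInner_add_left, lieInner_add_right,
      lieInner_neg_left, lieInner_neg_right, hFF, lieSign]
    field_simp
    linarith
  have hpp : lieInner p p = -1 := by
    simp [hp, lieInner_smul_left, lieInner_smul_right, lieInner_add_left, lieInner_add_right,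
      lieInner_neg_left, lieInner_neg_right, hFF, lieSign]
    field_simp
    linarith
  have hoq : lieInner o q = -1 := by
    simp [ho, hq, lieInner_smul_left, lieInner_smul_right, lieInner_add_left, lieInner_add_right,
      lieInner_neg_left, hFF, lieSign]
    field_simp
    linarith
  have hpq : IsEuclideanSubgeometry p q := by
    refine ⟨hpp, ?_, ?_, ?_⟩
    · simp [hp, hq, lieInner_smul_left, lieInner_smul_right, lieInner_add_left, lieInner_add_right,
        lieInner_neg_left, hFF, lieSign]
      ring
    · simp [hq, lieInner_smul_left, lieInner_smul_right, lieInner_add_left, lieInner_add_right,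
        hFF, lieSign]
      linarith
    · intro h0
      rw [h0, lieInner_zero_right] at hoq
      norm_num at hoq
  have hfr : IsCartesianFrame p q o E := by
    refine ⟨?_, ?_, hoq, ?_, fun i => ⟨?_, ?_, ?_⟩⟩
    · simp [ho, lieInner_smul_left, lieInner_smul_right, lieInner_add_left, lieInner_add_right,
        lieInner_neg_left, lieInner_neg_right, hFF, lieSign]
      linear_combination (-((r ^ 2)⁻¹ * 2⁻¹) ^ 2) * hyy
    · simp [ho, hp, lieInner_smul_left, lieInner_smul_right, lieInner_add_left, lieInner_add_right,
        lieInner_neg_left, lieInner_neg_right, hFF, lieSign]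
      ring
    · intro i j
      fin_cases i <;> fin_cases j <;> simp [hE, hgg] <;>
        simp [hg, lieInner_smul_left, lieInner_smul_right, lieInner_add_left, lieInner_add_right,
          lieInner_neg_left, lieInner_neg_right, hFF, lieSign]
    · fin_cases i <;>
        simp [hE, hp, hg, lieInner_smul_left, lieInner_smul_right, lieInner_add_left,
          lieInner_add_right, lieInner_neg_left, lieInner_neg_right, hFF]
    · fin_cases i <;>
        simp [hE, hq, hg, lieInner_smul_left, lieInner_smul_right, lieInner_add_left,
          lieInner_add_right, lieInner_neg_left, hFF, lieSign]
      ring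
    · fin_cases i <;>
        simp [hE, ho, hg, lieInner_smul_left, lieInner_smul_right, lieInner_add_left,
          lieInner_add_right, lieInner_neg_left, lieInner_neg_right, hFF, lieSign]
      ring
  have hqK : ∀ v ∈ J, ∀ s : ℝ, q ≠ s • K v := by
    intro v hv s hs
    refine hxK v hv s ?_
    have h2 := congrArg (fun w => lieInner w (F 2)) hs
    have h3 := congrArg (fun w => lieInner w (F 3)) hs
    have h4 := congrArg (fun w => lieInner w (F 4)) hs
    simp [hq, lieInner_smul_left, lieInner_add_left, hFF, lieSign] at h2 h3 h4
    ext i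
    fin_cases i
    · simpa using h2
    · simpa using h3
    · simp; linarith
  exact ⟨p, q, o, E, hpq, hfr, hF0, hF1, hqK⟩

/-- The inner product vanishes on the span of two orthogonal null vectors. -/
lemma lieInner_pair_eq_zero {k c : LieSpace} (hkk : lieInner k k = 0) (hkc : lieInner k c = 0)
    (hcc : lieInner c c = 0) (a b a' b' : ℝ) :
    lieInner (a • k + b • c) (a' • k + b' • c) = 0 := by
  simp only [lieInner_add_left, lieInner_add_right, lieInner_smul_left, lieInner_smul_right, hkk,
    hkc, hcc, lieInner_comm c k]
  ring

namespace ChannelNormalForm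

variable {I J : Set ℝ} {A B K : ℝ → LieSpace} {α : ℝ → ℝ}
  {L : ℝ × ℝ → Submodule ℝ LieSpace} {W : Set (ℝ × ℝ)}
  {κ : OpenPartialHomeomorph (ℝ × ℝ) (ℝ × ℝ)}

/-- If the curvature spheres `A u + B v` move parallel to the definite plane `⟨e, f⟩`, then their
component in this plane runs on a circle. -/
lemma exists_angle (h : ChannelNormalForm I J A B K α) {u₀ v₀ : ℝ} (hu₀ : u₀ ∈ I) (hv₀ : v₀ ∈ J)
    {e f : LieSpace} (hee : lieInner e e = 1) (hff : lieInner f f = 1) (hef : lieInner e f = 0)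
    (hA : ∀ u ∈ I, deriv A u ∈ Submodule.span ℝ {e, f}) :
    ∃ (ρ : ℝ) (θ : ℝ → ℝ), ContDiffOn ℝ ∞ θ I ∧ (∀ u ∈ I, deriv θ u ≠ 0) ∧
      (∀ u ∈ I, lieInner (A u + B v₀) e = ρ * Real.cos (θ u)) ∧
      ∀ u ∈ I, lieInner (A u + B v₀) f = ρ * Real.sin (θ u) := by
  have hfe := (lieInner_comm f e).trans hef
  obtain ⟨F, hFS, hF⟩ := IsLieOrthonormal.exists_extension (f := ![e, f, 0, 0, 0, 0]) (S := {0, 1})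
    (by
      intro i hi j hj
      simp only [Finset.mem_insert, Finset.mem_singleton] at hi hj
      rcases hi with rfl | rfl <;> rcases hj with rfl | rfl <;> simp [lieSign, hee, hff, hef, hfe])
  have hF0 : F 0 = e := hFS 0 (by simp)
  have hF1 : F 1 = f := hFS 1 (by simp)
  have hFF : ∀ i j, lieInner (F i) (F j) = if i = j then lieSign i else 0 := fun i j =>
    hF i (Finset.mem_univ _) j (Finset.mem_univ _)
  have hC : ∀ w, lieInner e w = 0 → lieInner f w = 0 → ∀ u ∈ I, ∀ v,
      lieInner (A u + B v) w = lieInner (A u₀ + B v) w := fun w hew hfw u hu v =>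
    h.C_const_of_A (fun u hu => lieInner_deriv_A_eq_zero hA hew hfw hu) hu hu₀ v
  set R := lieInner (A u₀ + B v₀) e ^ 2 + lieInner (A u₀ + B v₀) f ^ 2 with hR
  have hcirc : ∀ u ∈ I, lieInner (A u + B v₀) e ^ 2 + lieInner (A u + B v₀) f ^ 2 = R := by
    have hFe : ∀ i, i ≠ 0 → lieInner e (F i) = 0 := fun i hi => by
      rw [← hF0, hFF, if_neg hi.symm]
    have hFf : ∀ i, i ≠ 1 → lieInner f (F i) = 0 := fun i hi => by
      rw [← hF1, hFF, if_neg hi.symm]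
    have key : ∀ u, lieInner (A u + B v₀) (A u + B v₀) = lieInner (A u + B v₀) e ^ 2 +
        lieInner (A u + B v₀) f ^ 2 + lieInner (A u + B v₀) (F 2) ^ 2 +
        lieInner (A u + B v₀) (F 3) ^ 2 - lieInner (A u + B v₀) (F 4) ^ 2 -
        lieInner (A u + B v₀) (F 5) ^ 2 := by
      intro u
      conv_lhs => rw [hF.expand (A u + B v₀), lieInner_sum_left]
      simp only [lieInner_smul_left, ← hF.expand (A u + B v₀)]
      simp only [Fin.sum_univ_six, lieInner_comm (F _), lieSign, hF0, hF1]
      simp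
      ring
    intro u hu
    have h1 := key u
    have h2 := key u₀
    rw [h.null_C u hu v₀ hv₀, hC (F 2) (hFe 2 (by decide)) (hFf 2 (by decide)) u hu,
      hC (F 3) (hFe 3 (by decide)) (hFf 3 (by decide)) u hu,
      hC (F 4) (hFe 4 (by decide)) (hFf 4 (by decide)) u hu,
      hC (F 5) (hFe 5 (by decide)) (hFf 5 (by decide)) u hu] at h1
    rw [h.null_C u₀ hu₀ v₀ hv₀] at h2
    linarith
  have hRpos : 0 < R := by
    by_contra hcon
    refine h.not_orthogonal hA hu₀ hv₀ ?_ ?_ <;>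
      nlinarith [sq_nonneg (lieInner (A u₀ + B v₀) e), sq_nonneg (lieInner (A u₀ + B v₀) f)]
  set ρ := Real.sqrt R with hρ
  have hρ0 : ρ ≠ 0 := (Real.sqrt_pos.2 hRpos).ne'
  have hρρ : ρ ^ 2 = R := Real.sq_sqrt hRpos.le
  have hes := contDiffOn_lieInner_const (h.smoothC' v₀) e
  have hfs := contDiffOn_lieInner_const (h.smoothC' v₀) f
  obtain ⟨θ, hθs, hθ⟩ := exists_smooth_angle h.openI h.connI (hes.div_const ρ) (hfs.div_const ρ)
    (fun u hu => by
      rw [div_pow, div_pow, ← add_div, hcirc u hu, hρρ, div_self hRpos.ne'])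
  have hθe : ∀ u ∈ I, lieInner (A u + B v₀) e = ρ * Real.cos (θ u) := fun u hu => by
    rw [← (hθ u hu).1]; field_simp
  have hθf : ∀ u ∈ I, lieInner (A u + B v₀) f = ρ * Real.sin (θ u) := fun u hu => by
    rw [← (hθ u hu).2]; field_simp
  have hθ' : ∀ u ∈ I, deriv θ u ≠ 0 := by
    intro u hu h0
    have hd := hasDerivAt_of_contDiffOn h.openI hθs hu
    rw [h0] at hd
    have h1 : ∀ w, HasDerivAt (fun u => lieInner (A u + B v₀) w) (lieInner (deriv A u) w) u := by
      intro w
      have h2 := (hasDerivAt_of_contDiffOn h.openI (h.smoothC' v₀) hu).lieInner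
        (hasDerivAt_const u w)
      rwa [deriv_C', lieInner_zero_right, add_zero] at h2
    have hAe : lieInner (deriv A u) e = 0 := by
      refine (h1 e).unique (HasDerivAt.congr_of_eventuallyEq (f := fun u => ρ * Real.cos (θ u)) ?_ ?_)
      · exact (hd.cos.const_mul ρ).congr_deriv (by ring)
      · filter_upwards [h.openI.mem_nhds hu] with t ht using hθe t ht
    have hAf : lieInner (deriv A u) f = 0 := by
      refine (h1 f).unique (HasDerivAt.congr_of_eventuallyEq (f := fun u => ρ * Real.sin (θ u)) ?_ ?_)
      · exact (hd.sin.const_mul ρ).congr_deriv (by ring)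
      · filter_upwards [h.openI.mem_nhds hu] with t ht using hθf t ht
    have h2 := lieInner_deriv_A_eq_zero hA ((lieInner_comm _ _).trans hAe)
      ((lieInner_comm _ _).trans hAf) hu
    linarith [h.pos_A u hu]
  exact ⟨ρ, θ, hθs, hθ', hθe, hθf⟩

/-- The point and the plane of a contact element can be normalised by means of `p` and `q`, unless
it contains `q`. -/
lemma det_ne_zero (h : ChannelNormalForm I J A B K α) {p q o : LieSpace} {E : Fin 3 → LieSpace}
    (hpq : IsEuclideanSubgeometry p q) (hfr : IsCartesianFrame p q o E) {u₀ t : ℝ} (hu₀ : u₀ ∈ I)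
    (ht : t ∈ J) {e f : LieSpace} (hA : ∀ u ∈ I, deriv A u ∈ Submodule.span ℝ {e, f})
    (hKe : lieInner (K t) e = 0) (hKf : lieInner (K t) f = 0) (hqe : lieInner q e = 0)
    (hqf : lieInner q f = 0) (hqK : ∀ s : ℝ, q ≠ s • K t) :
    lieInner (K t) p * lieInner (A u₀ + B t) q - lieInner (K t) q * lieInner (A u₀ + B t) p ≠ 0 := by
  intro h0
  -- Otherwise the contact element contains a vector orthogonal to `p` and `q`, hence `q` itself.
  obtain ⟨z, hz0, hz⟩ := Matrix.exists_mulVec_eq_zero_iff.2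
    (show (!![lieInner (K t) p, lieInner (A u₀ + B t) p;
      lieInner (K t) q, lieInner (A u₀ + B t) q]).det = 0 by
        rw [Matrix.det_fin_two_of, ← h0]; ring)
  have hzp := congrFun hz 0
  have hzq := congrFun hz 1
  simp [Matrix.mulVec, dotProduct, Fin.sum_univ_two] at hzp hzq
  set X := z 0 • K t + z 1 • (A u₀ + B t) with hX
  have hX0 : X ≠ 0 := by
    intro hX0
    have := LinearIndependent.pair_iff.1 (h.indep u₀ hu₀ t ht) _ _ hX0
    exact hz0 (by ext i; fin_cases i; exacts [this.1, this.2])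
  have hXp : lieInner X p = 0 := by
    rw [hX, lieInner_add_left, lieInner_smul_left, lieInner_smul_left]; linarith
  have hXq : lieInner X q = 0 := by
    rw [hX, lieInner_add_left, lieInner_smul_left, lieInner_smul_left]; linarith
  have hXX : lieInner X X = 0 :=
    lieInner_pair_eq_zero (h.null_K t ht) (h.orth u₀ hu₀ t ht) (h.null_C u₀ hu₀ t ht) _ _ _ _
  have hXq' := hfr.eq_smul_of_null hpq hXX hXp hXq
  have hXe : lieInner X e = 0 := by rw [hXq', lieInner_smul_left, hqe, mul_zero]
  have hXf : lieInner X f = 0 := by rw [hXq', lieInner_smul_left, hqf, mul_zero]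
  rw [hX, lieInner_add_left, lieInner_smul_left, lieInner_smul_left] at hXe hXf
  rw [hKe, mul_zero, zero_add] at hXe
  rw [hKf, mul_zero, zero_add] at hXf
  have hz1 : z 1 = 0 := by
    by_contra hz1
    exact h.not_orthogonal hA hu₀ ht ((mul_eq_zero.1 hXe).resolve_left hz1)
      ((mul_eq_zero.1 hXf).resolve_left hz1)
  have hc : -lieInner X o ≠ 0 := fun hc => hX0 (by rw [hXq', hc, zero_smul])
  refine hqK (z 0 / -lieInner X o) ?_
  have h2 : (-lieInner X o) • q = z 0 • K t := by
    rw [← hXq', hX, hz1, zero_smul, add_zero]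
  rw [div_eq_inv_mul, mul_smul, ← h2, smul_smul, inv_mul_cancel₀ hc, one_smul]

/-- If the curvature spheres `A u + B v` move parallel to a definite plane, the surface is a
surface of revolution. The point at infinity has to be chosen off the surface: it must not be one
of the curvature spheres `K v`, which trace out only a curve in the quadric of null lines of the
orthogonal complement of the plane. -/
lemma exists_isSurfaceOfRevolution (h : ChannelNormalForm I J A B K α)
    (hκ : IsCoordinateRectangle κ W I J)
    (hL : ∀ u ∈ I, ∀ v ∈ J, L (κ.symm (u, v)) = Submodule.span ℝ {K v, A u + B v})
    {u₀ v₀ : ℝ} (hu₀ : u₀ ∈ I) (hv₀ : v₀ ∈ J) {e f : LieSpace} (hee : lieInner e e = 1)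
    (hff : lieInner f f = 1) (hef : lieInner e f = 0) (hKe : ∀ v ∈ J, lieInner (K v) e = 0)
    (hKf : ∀ v ∈ J, lieInner (K v) f = 0) (hA : ∀ u ∈ I, deriv A u ∈ Submodule.span ℝ {e, f}) :
    ∃ p q, IsEuclideanSubgeometry p q ∧ IsSurfaceOfRevolution p q L W := by
  obtain ⟨p, q, o, E, hpq, hfr, hE0, hE1, hqK⟩ :=
    exists_isCartesianFrame_avoiding h.connJ h.smoothK hee hff hef
  have hqe : lieInner q e = 0 := hE0 ▸ (lieInner_comm _ _).trans (hfr.2.2.2.2 0).2.1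
  have hqf : lieInner q f = 0 := hE1 ▸ (lieInner_comm _ _).trans (hfr.2.2.2.2 1).2.1
  have hpe : lieInner p e = 0 := hE0 ▸ (lieInner_comm _ _).trans (hfr.2.2.2.2 0).1
  have hpf : lieInner p f = 0 := hE1 ▸ (lieInner_comm _ _).trans (hfr.2.2.2.2 1).1
  have hE2e : lieInner e (E 2) = 0 := by rw [← hE0, hfr.2.2.2.1, if_neg (by decide)]
  have hE2f : lieInner f (E 2) = 0 := by rw [← hE1, hfr.2.2.2.1, if_neg (by decide)]
  have hC : ∀ w, lieInner e w = 0 → lieInner f w = 0 → ∀ u ∈ I, ∀ v,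
      lieInner (A u + B v) w = lieInner (A u₀ + B v) w := fun w hew hfw u hu v =>
    h.C_const_of_A (fun u hu => lieInner_deriv_A_eq_zero hA hew hfw hu) hu hu₀ v
  have hCp := hC p ((lieInner_comm _ _).trans hpe) ((lieInner_comm _ _).trans hpf)
  have hCq := hC q ((lieInner_comm _ _).trans hqe) ((lieInner_comm _ _).trans hqf)
  have hC2 := hC (E 2) hE2e hE2f
  have hCe : ∀ u, ∀ v ∈ J, lieInner (A u + B v) e = lieInner (A u + B v₀) e := fun u v hv =>
    h.C_const_of_K hKe u hv hv₀
  have hCf : ∀ u, ∀ v ∈ J, lieInner (A u + B v) f = lieInner (A u + B v₀) f := fun u v hv =>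
    h.C_const_of_K hKf u hv hv₀
  obtain ⟨ρ, θ, hθs, hθ', hθe, hθf⟩ := h.exists_angle hu₀ hv₀ hee hff hef hA
  obtain ⟨κ', J', hκ', hsymm⟩ := hκ.exists_reparam hθs hθ'
  set δ : ℝ → ℝ := fun t => lieInner (K t) p * lieInner (A u₀ + B t) q -
    lieInner (K t) q * lieInner (A u₀ + B t) p with hδ
  have hδ0 : ∀ t ∈ J, δ t ≠ 0 := fun t ht h0 =>
    h.det_ne_zero hpq hfr hu₀ ht hA (hKe t ht) (hKf t ht) hqe hqf (hqK t ht) h0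
  have hKps := contDiffOn_lieInner_const h.smoothK p
  have hKqs := contDiffOn_lieInner_const h.smoothK q
  have hCps := contDiffOn_lieInner_const (h.smoothC u₀) p
  have hCqs := contDiffOn_lieInner_const (h.smoothC u₀) q
  have hδs : ContDiffOn ℝ ∞ δ J := (hKps.mul hCqs).sub (hKqs.mul hCps)
  -- the coefficients of the point and of the plane with respect to `K` and `A + B`
  set s : ℝ → ℝ := fun t => lieInner (A u₀ + B t) p / δ t with hs
  set s' : ℝ → ℝ := fun t => -lieInner (K t) p / δ t with hs'
  set σ : ℝ → ℝ := fun t => -lieInner (A u₀ + B t) q / δ t with hσ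
  set σ' : ℝ → ℝ := fun t => lieInner (K t) q / δ t with hσ'
  have hss : ContDiffOn ℝ ∞ s J := hCps.div hδs hδ0
  have hss' : ContDiffOn ℝ ∞ s' J := hKps.neg.div hδs hδ0
  have hσs : ContDiffOn ℝ ∞ σ J := hCqs.neg.div hδs hδ0
  have hσs' : ContDiffOn ℝ ∞ σ' J := hKqs.div hδs hδ0
  have hK2s := contDiffOn_lieInner_const h.smoothK (E 2)
  have hC2s := contDiffOn_lieInner_const (h.smoothC u₀) (E 2)
  set a : ℝ → ℝ := fun t => ρ * σ' t with ha
  set b : ℝ → ℝ := fun t => σ t * lieInner (K t) (E 2) + σ' t * lieInner (A u₀ + B t) (E 2) with hb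
  set m : ℝ → ℝ := fun t => ρ * s' t with hm
  set c : ℝ → ℝ := fun t => s t * lieInner (K t) (E 2) + s' t * lieInner (A u₀ + B t) (E 2) with hc
  have hcontact : ∀ u ∈ I, ∀ t ∈ J,
      ‖(!₂[Real.cos (θ u) * a t, Real.sin (θ u) * a t, b t] : EuclideanSpace ℝ (Fin 3))‖ = 1 ∧
      L (κ.symm (u, t)) = contactElement p q o E
        !₂[Real.cos (θ u) * m t, Real.sin (θ u) * m t, c t]
        !₂[Real.cos (θ u) * a t, Real.sin (θ u) * a t, b t] := by
    intro u hu t ht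
    have hnull := lieInner_pair_eq_zero (h.null_K t ht) (h.orth u hu t ht) (h.null_C u hu t ht)
    have hδt := hδ0 t ht
    have hδd : δ t = lieInner (K t) p * lieInner (A u₀ + B t) q -
      lieInner (K t) q * lieInner (A u₀ + B t) p := rfl
    have hcomp : ∀ z z' : ℝ, ∀ i : Fin 3, lieInner (z • K t + z' • (A u + B t)) (E i) =
        ![Real.cos (θ u) * (ρ * z'), Real.sin (θ u) * (ρ * z'),
          z * lieInner (K t) (E 2) + z' * lieInner (A u₀ + B t) (E 2)] i := by
      intro z z' i
      rw [lieInner_add_left, lieInner_smul_left, lieInner_smul_left]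
      fin_cases i
      · simp [hE0, hKe t ht, hCe u t ht, hθe u hu]; ring
      · simp [hE1, hKf t ht, hCf u t ht, hθf u hu]; ring
      · simp [hC2 u hu]
    have key := hfr.span_eq_contactElement hpq
      (F := s t • K t + s' t • (A u + B t)) (T := σ t • K t + σ' t • (A u + B t))
      (hnull _ _ _ _) (hnull _ _ _ _) (hnull _ _ _ _)
      (by
        simp only [lieInner_add_left (_ • K t) (_ • (A u + B t)), lieInner_smul_left, hCp u hu, hs, hs']
        field_simp; ring)
      (by
        simp only [lieInner_add_left (_ • K t) (_ • (A u + B t)), lieInner_smul_left, hCq u hu, hs, hs']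
        field_simp; rw [hδd]; ring)
      (by
        simp only [lieInner_add_left (_ • K t) (_ • (A u + B t)), lieInner_smul_left, hCq u hu, hσ, hσ']
        field_simp; ring)
      (by
        simp only [lieInner_add_left (_ • K t) (_ • (A u + B t)), lieInner_smul_left, hCp u hu, hσ, hσ']
        field_simp; rw [hδd]; ring)
      !₂[Real.cos (θ u) * m t, Real.sin (θ u) * m t, c t]
      !₂[Real.cos (θ u) * a t, Real.sin (θ u) * a t, b t]
      (fun i => (hcomp (s t) (s' t) i).symm) (fun i => (hcomp (σ t) (σ' t) i).symm)
    refine ⟨key.1, ?_⟩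
    rw [hL u hu t ht, ← key.2, span_pair_eq_of_det_ne_zero]
    have hdet : s t * σ' t - σ t * s' t = -(1 / δ t) := by
      simp only [hs, hs', hσ, hσ']
      field_simp; rw [hδd]; ring
    rw [hdet]
    exact neg_ne_zero.2 (one_div_ne_zero hδt)
  refine ⟨p, q, hpq, o, E, hfr, κ', J, J', hκ', m, c, a, b, contDiffOn_const.mul hss',
    (hss.mul hK2s).add (hss'.mul hC2s), contDiffOn_const.mul hσs',
    (hσs.mul hK2s).add (hσs'.mul hC2s), fun t ht => ?_, ?_⟩
  · have h1 := (hcontact u₀ hu₀ t ht).1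
    have h2 := EuclideanSpace.norm_sq_eq
      (!₂[Real.cos (θ u₀) * a t, Real.sin (θ u₀) * a t, b t] : EuclideanSpace ℝ (Fin 3))
    rw [h1] at h2
    simp [Fin.sum_univ_three, mul_pow] at h2
    rw [h2]
    linear_combination (-a t ^ 2) * Real.sin_sq_add_cos_sq (θ u₀)
  · intro t ht w hw
    obtain ⟨u, hu, rfl, hus⟩ := hsymm t ht w hw
    rw [hus]
    exact (hcontact u hu t ht).2

/-- A surface in normal form is a Dupin cyclide if `B` is constant; otherwise the vectors `A' u`
lie in a plane containing spacelike vectors, and the signature of this plane decides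
whether the surface is a cone, a cylinder or a surface of revolution. -/
theorem classification (h : ChannelNormalForm I J A B K α) (hκ : IsCoordinateRectangle κ W I J)
    (hL : ∀ u ∈ I, ∀ v ∈ J, L (κ.symm (u, v)) = Submodule.span ℝ {K v, A u + B v})
    (hI : I.Nonempty) (hJ : J.Nonempty) :
    (∃ e : Fin 3 → LieSpace,
      (∀ i j, lieInner (e i) (e j) = if i = j then (if i = 2 then -1 else 1) else 0) ∧
      (∀ v ∈ J, K v ∈ Submodule.span ℝ (Set.range e)) ∧
      ∀ u ∈ I, ∀ v ∈ J, ∀ i, lieInner (A u + B v) (e i) = 0) ∨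
    ∃ p q : LieSpace, IsEuclideanSubgeometry p q ∧
      (IsCone p q L W ∨ IsCylinder p q L W ∨ IsSurfaceOfRevolution p q L W) := by
  by_cases hα : ∀ v ∈ J, α v = 0
  · exact Or.inl (h.exists_dupin hI hJ hα)
  right
  push Not at hα
  obtain ⟨v₀, hv₀, hα⟩ := hα
  obtain ⟨u₀, hu₀⟩ := hI
  set x := deriv A u₀ with hx
  set y := deriv (deriv A) u₀ with hy
  have hpos : 0 < lieInner x x := h.pos_A u₀ hu₀
  set r := Real.sqrt (lieInner x x) with hr
  have hr0 : r ≠ 0 := (Real.sqrt_pos.2 hpos).ne'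
  have hrr : r * r = lieInner x x := Real.mul_self_sqrt hpos.le
  set e := (1 / r) • x with he
  have hee : lieInner e e = 1 := by
    rw [he, lieInner_smul_left, lieInner_smul_right, ← hrr]; field_simp
  set f := y - lieInner y e • e with hf
  have hef : lieInner e f = 0 := by
    rw [hf, lieInner_sub_right, lieInner_smul_right, hee, lieInner_comm e y]; ring
  have hKe : ∀ v ∈ J, lieInner (K v) e = 0 := fun v hv => by
    rw [he, lieInner_smul_right, h.K_A1 hu₀ hv, mul_zero]
  have hKf : ∀ v ∈ J, lieInner (K v) f = 0 := fun v hv => by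
    rw [hf, lieInner_sub_right, lieInner_smul_right, h.K_A2 hu₀ hv, hKe v hv]; ring
  have hxe : x = r • e + (0 : ℝ) • f := by rw [he, smul_smul]; field_simp; simp
  have hye : y = lieInner y e • e + (1 : ℝ) • f := by rw [hf]; module
  have hspan : ∀ u ∈ I, ∀ c : ℝ, c ≠ 0 → deriv A u ∈ Submodule.span ℝ {e, c • f} := by
    intro u hu c hc
    have h1 := h.deriv_A_mem_span hu₀ hv₀ hα hu
    have hxe' : x = r • e + (0 : ℝ) • (c • f) := by rw [zero_smul, hxe, zero_smul]
    have hye' : y = lieInner y e • e + (1 / c) • (c • f) := by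
      rw [smul_smul (1 / c), div_mul_cancel₀ _ hc]; exact hye
    rw [← hx, ← hy, hxe', hye', span_pair_eq_of_det_ne_zero] at h1
    · exact h1
    · simp [hr0, hc]
  rcases lt_trichotomy (lieInner f f) 0 with hff | hff | hff
  · set c := Real.sqrt (-lieInner f f) with hc
    have hc0 : c ≠ 0 := (Real.sqrt_pos.2 (by linarith)).ne'
    have hcc : c * c = -lieInner f f := Real.mul_self_sqrt (by linarith)
    obtain ⟨p, q, hpq, hcone⟩ := h.exists_isCone hκ hL hu₀ hv₀ hee (f := (1 / c) • f)
      (by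
        rw [lieInner_smul_left, lieInner_smul_right, show lieInner f f = -(c * c) by linarith]
        field_simp)
      (by rw [lieInner_smul_right, hef, mul_zero]) hKe
      (fun v hv => by rw [lieInner_smul_right, hKf v hv, mul_zero])
      (fun u hu => hspan u hu _ (one_div_ne_zero hc0))
    exact ⟨p, q, hpq, Or.inl hcone⟩
  · have hf0 : f ≠ 0 := by
      intro hf0
      have h1 := h.C_A1 hu₀ hv₀
      have h2 := h.C_A2 hu₀ hv₀
      rw [← hx, hxe, hf0] at h1
      rw [← hy, hye, hf0] at h2
      simp only [smul_zero, add_zero, lieInner_smul_right] at h1 h2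
      rw [(mul_eq_zero.1 h1).resolve_left hr0] at h2
      linarith
    obtain ⟨p, q, hpq, hcyl⟩ := h.exists_isCylinder hκ hL hu₀ hv₀ hee hff hf0 hef hKe hKf
      (fun u hu => by simpa using hspan u hu 1 one_ne_zero)
    exact ⟨p, q, hpq, Or.inr (Or.inl hcyl)⟩
  · set c := Real.sqrt (lieInner f f) with hc
    have hc0 : c ≠ 0 := (Real.sqrt_pos.2 hff).ne'
    have hcc : c * c = lieInner f f := Real.mul_self_sqrt hff.le
    obtain ⟨p, q, hpq, hrev⟩ := h.exists_isSurfaceOfRevolution hκ hL hu₀ hv₀ hee (f := (1 / c) • f)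
      (by
        rw [lieInner_smul_left, lieInner_smul_right, ← hcc]
        field_simp)
      (by rw [lieInner_smul_right, hef, mul_zero]) hKe
      (fun v hv => by rw [lieInner_smul_right, hKf v hv, mul_zero])
      (fun u hu => hspan u hu _ (one_div_ne_zero hc0))
    exact ⟨p, q, hpq, Or.inr (Or.inr hrev)⟩

end ChannelNormalForm

/-! ### Complexification -/

/-- The complexification of `ℝ^{4,2}`. -/
abbrev CLieSpace : Type := Fin 6 → ℂ

/-- The complex bilinear extension of the inner product of `ℝ^{4,2}`. -/
def cInner (x y : CLieSpace) : ℂ :=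
  -(x 0 * y 0) + x 1 * y 1 + x 2 * y 2 + x 3 * y 3 + x 4 * y 4 - x 5 * y 5

lemma cInner_comm (x y : CLieSpace) : cInner x y = cInner y x := by
  simp only [cInner]; ring

lemma cInner_add_left (x y z : CLieSpace) : cInner (x + y) z = cInner x z + cInner y z := by
  simp only [cInner, Pi.add_apply]; ring

lemma cInner_add_right (x y z : CLieSpace) : cInner x (y + z) = cInner x y + cInner x z := by
  simp only [cInner, Pi.add_apply]; ring

lemma cInner_smul_left (a : ℂ) (x y : CLieSpace) : cInner (a • x) y = a * cInner x y := by
  simp only [cInner, Pi.smul_apply, smul_eq_mul]; ring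

lemma cInner_smul_right (a : ℂ) (x y : CLieSpace) : cInner x (a • y) = a * cInner x y := by
  simp only [cInner, Pi.smul_apply, smul_eq_mul]; ring

lemma cInner_real_smul_left (a : ℝ) (x y : CLieSpace) : cInner (a • x) y = a * cInner x y := by
  simp only [cInner, Pi.smul_apply, Complex.real_smul]; ring

lemma real_smul_eq_ofReal_smul (a : ℝ) (x : CLieSpace) : a • x = (a : ℂ) • x := by
  ext i; simp

/-! ### Differentiation of complex vector fields -/

section Calculus

variable {E : Type*} [NormedAddCommGroup E] [NormedSpace ℝ E]

lemma fderiv_cInner {f g : E → CLieSpace} {x : E} (hf : DifferentiableAt ℝ f x)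
    (hg : DifferentiableAt ℝ g x) (X : E) :
    fderiv ℝ (fun y => cInner (f y) (g y)) x X =
      cInner (fderiv ℝ f x X) (g x) + cInner (f x) (fderiv ℝ g x X) := by
  have hf' := hasFDerivAt_pi'.1 hf.hasFDerivAt
  have hg' := hasFDerivAt_pi'.1 hg.hasFDerivAt
  have h := ((((((hf' 0).mul (hg' 0)).neg.add ((hf' 1).mul (hg' 1))).add
    ((hf' 2).mul (hg' 2))).add ((hf' 3).mul (hg' 3))).add ((hf' 4).mul (hg' 4))).sub
    ((hf' 5).mul (hg' 5))
  have h2 : HasFDerivAt (fun y => cInner (f y) (g y)) _ x := h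
  rw [h2.fderiv]
  simp [cInner]
  ring

lemma fderiv_complex_smul {p : E → ℂ} {f : E → CLieSpace} {x : E} (hp : DifferentiableAt ℝ p x)
    (hf : DifferentiableAt ℝ f x) (X : E) :
    fderiv ℝ (fun y => p y • f y) x X = fderiv ℝ p x X • f x + p x • fderiv ℝ f x X := by
  rw [fderiv_fun_smul hp hf]
  simp [add_comm]

lemma differentiableAt_of_contDiffOn {F : Type*} [NormedAddCommGroup F] [NormedSpace ℝ F]
    {f : E → F} {U : Set E} (hU : IsOpen U) (hf : ContDiffOn ℝ ∞ f U) {x : E} (hx : x ∈ U) :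
    DifferentiableAt ℝ f x :=
  (hf.contDiffAt (hU.mem_nhds hx)).differentiableAt (by simp)

lemma contDiffOn_fderiv_apply {F : Type*} [NormedAddCommGroup F] [NormedSpace ℝ F]
    {f : E → F} {U : Set E} (hU : IsOpen U) (hf : ContDiffOn ℝ ∞ f U) (X : E) :
    ContDiffOn ℝ ∞ (fun y => fderiv ℝ f y X) U :=
  (hf.fderiv_of_isOpen hU (by simp)).clm_apply contDiffOn_const

lemma fderiv_fderiv_comm {F : Type*} [NormedAddCommGroup F] [NormedSpace ℝ F]
    {f : E → F} {U : Set E} (hU : IsOpen U) (hf : ContDiffOn ℝ ∞ f U) {x : E} (hx : x ∈ U)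
    (X Y : E) : fderiv ℝ (fun y => fderiv ℝ f y X) x Y = fderiv ℝ (fun y => fderiv ℝ f y Y) x X := by
  have hd : DifferentiableAt ℝ (fderiv ℝ f) x :=
    differentiableAt_of_contDiffOn hU (hf.fderiv_of_isOpen hU (by simp)) hx
  have h := (hf.contDiffAt (hU.mem_nhds hx)).isSymmSndFDerivAt
    (by rw [minSmoothness_of_isRCLikeNormedField]; exact WithTop.coe_le_coe.2 (le_top : (2 : ℕ∞) ≤ ⊤))
  rw [fderiv_clm_apply hd (differentiableAt_const X), fderiv_clm_apply hd (differentiableAt_const Y)]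
  simpa using h.eq Y X

lemma fderiv_eq_of_eqOn {F : Type*} [NormedAddCommGroup F] [NormedSpace ℝ F] {f g : E → F}
    {U : Set E} (hU : IsOpen U) (h : ∀ y ∈ U, f y = g y) {x : E} (hx : x ∈ U) :
    fderiv ℝ f x = fderiv ℝ g x :=
  Filter.EventuallyEq.fderiv_eq (by filter_upwards [hU.mem_nhds hx] with y hy using h y hy)

/-- Differentiation of an identity `(f, g) = 0`. -/
lemma cInner_fderiv_of_eq_zero {f g : E → CLieSpace} {U : Set E} (hU : IsOpen U)
    (hf : ContDiffOn ℝ ∞ f U) (hg : ContDiffOn ℝ ∞ g U) (h : ∀ y ∈ U, cInner (f y) (g y) = 0)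
    {x : E} (hx : x ∈ U) (X : E) :
    cInner (fderiv ℝ f x X) (g x) + cInner (f x) (fderiv ℝ g x X) = 0 := by
  rw [← fderiv_cInner (differentiableAt_of_contDiffOn hU hf hx)
    (differentiableAt_of_contDiffOn hU hg hx), fderiv_eq_of_eqOn hU (g := fun _ => (0 : ℂ)) h hx]
  simp

lemma exists_minor_ne_zero {a b : CLieSpace} (h : LinearIndependent ℂ ![a, b]) :
    ∃ i j, a i * b j - a j * b i ≠ 0 := by
  by_contra! hcon
  rw [LinearIndependent.pair_iff] at h
  have ha : ∀ i, a i = 0 := by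
    intro i
    have := h (b i) (-a i) (by ext j; simp; linear_combination -(hcon i j))
    simpa using this.2
  exact one_ne_zero (h 1 0 (by ext j; simp [ha j])).1

lemma contDiffOn_component {f : E → CLieSpace} {U : Set E} (hf : ContDiffOn ℝ ∞ f U) (i : Fin 6) :
    ContDiffOn ℝ ∞ (fun x => f x i) U := contDiffOn_pi.1 hf i

/-- The coefficients of a smooth section with respect to a smooth frame are smooth, by
Cramer's rule. -/
lemma contDiffOn_coeff {Y Z V : E → CLieSpace} {U : Set E} (hU : IsOpen U)
    (hY : ContDiffOn ℝ ∞ Y U) (hZ : ContDiffOn ℝ ∞ Z U) (hV : ContDiffOn ℝ ∞ V U) {α β : E → ℂ}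
    (hind : ∀ x ∈ U, LinearIndependent ℂ ![Y x, Z x])
    (h : ∀ x ∈ U, V x = α x • Y x + β x • Z x) :
    ContDiffOn ℝ ∞ α U ∧ ContDiffOn ℝ ∞ β U := by
  suffices H : ∀ x ∈ U, ContDiffWithinAt ℝ ∞ α U x ∧ ContDiffWithinAt ℝ ∞ β U x from
    ⟨fun x hx => (H x hx).1, fun x hx => (H x hx).2⟩
  intro x hx
  obtain ⟨i, j, hij⟩ := exists_minor_ne_zero (hind x hx)
  have hYi := fun i => (contDiffOn_component hY i).contDiffAt (hU.mem_nhds hx)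
  have hZi := fun i => (contDiffOn_component hZ i).contDiffAt (hU.mem_nhds hx)
  have hVi := fun i => (contDiffOn_component hV i).contDiffAt (hU.mem_nhds hx)
  have hm : ContDiffAt ℝ ∞ (fun x => Y x i * Z x j - Y x j * Z x i) x :=
    ((hYi i).mul (hZi j)).sub ((hYi j).mul (hZi i))
  have hne := hm.continuousAt.eventually_ne hij
  have hVx : ∀ y ∈ U, ∀ k, V y k = α y * Y y k + β y * Z y k := fun y hy k => by
    rw [h y hy]; simp
  constructor
  · refine ContDiffAt.contDiffWithinAt (ContDiffAt.congr_of_eventuallyEq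
      (f := fun x => (V x i * Z x j - V x j * Z x i) * (Y x i * Z x j - Y x j * Z x i)⁻¹)
      ((((hVi i).mul (hZi j)).sub ((hVi j).mul (hZi i))).mul (hm.inv hij)) ?_)
    filter_upwards [hU.mem_nhds hx, hne] with y hy hyne
    rw [eq_mul_inv_iff_mul_eq₀ hyne, hVx y hy, hVx y hy]; ring
  · refine ContDiffAt.contDiffWithinAt (ContDiffAt.congr_of_eventuallyEq
      (f := fun x => (Y x i * V x j - Y x j * V x i) * (Y x i * Z x j - Y x j * Z x i)⁻¹)
      ((((hYi i).mul (hVi j)).sub ((hYi j).mul (hVi i))).mul (hm.inv hij)) ?_)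
    filter_upwards [hU.mem_nhds hx, hne] with y hy hyne
    rw [eq_mul_inv_iff_mul_eq₀ hyne, hVx y hy, hVx y hy]; ring

/-- The derivative of a section of `⟨Y, Z⟩` depends only on its value, modulo `⟨Y, Z⟩`. -/
lemma fderiv_section_sub_mem {Y Z V : E → CLieSpace} {U : Set E} (hU : IsOpen U)
    (hY : ContDiffOn ℝ ∞ Y U) (hZ : ContDiffOn ℝ ∞ Z U) (hV : ContDiffOn ℝ ∞ V U)
    (hind : ∀ x ∈ U, LinearIndependent ℂ ![Y x, Z x])
    (h : ∀ x ∈ U, V x ∈ Submodule.span ℂ {Y x, Z x}) {x : E} (hx : x ∈ U) {c d : ℂ}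
    (hcd : V x = c • Y x + d • Z x) (X : E) :
    fderiv ℝ V x X - (c • fderiv ℝ Y x X + d • fderiv ℝ Z x X) ∈
      Submodule.span ℂ {Y x, Z x} := by
  have h' : ∀ x, ∃ a b : ℂ, x ∈ U → V x = a • Y x + b • Z x := by
    intro x
    by_cases hx : x ∈ U
    · obtain ⟨a, b, hab⟩ := Submodule.mem_span_pair.1 (h x hx)
      exact ⟨a, b, fun _ => hab.symm⟩
    · exact ⟨0, 0, fun h => absurd h hx⟩
  choose a b hab using h'
  obtain ⟨ha, hb⟩ := contDiffOn_coeff hU hY hZ hV hind hab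
  have hYd := differentiableAt_of_contDiffOn hU hY hx
  have hZd := differentiableAt_of_contDiffOn hU hZ hx
  have had := differentiableAt_of_contDiffOn hU ha hx
  have hbd := differentiableAt_of_contDiffOn hU hb hx
  have hc : a x = c ∧ b x = d := by
    have h1 := LinearIndependent.pair_iff.1 (hind x hx) (a x - c) (b x - d) (by
      rw [sub_smul, sub_smul, sub_add_sub_comm, ← hab x hx, ← hcd, sub_self])
    exact ⟨sub_eq_zero.1 h1.1, sub_eq_zero.1 h1.2⟩
  rw [fderiv_eq_of_eqOn hU hab hx, fderiv_fun_add (had.fun_smul hYd) (hbd.fun_smul hZd),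
    add_apply, fderiv_complex_smul had hYd, fderiv_complex_smul hbd hZd,
    hc.1, hc.2]
  refine Submodule.mem_span_pair.2 ⟨fderiv ℝ a x X, fderiv ℝ b x X, ?_⟩
  abel

end Calculus

lemma exists_coords {X₁ X₂ : ℝ × ℝ} (h₁ : X₁ ≠ 0) (h : ∀ c : ℝ, X₂ ≠ c • X₁) (V : ℝ × ℝ) :
    ∃ a b : ℝ, V = a • X₁ + b • X₂ := by
  have hdet : X₁.1 * X₂.2 - X₁.2 * X₂.1 ≠ 0 := by
    intro hd
    by_cases h0 : X₁.1 = 0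
    · have h1 : X₁.2 ≠ 0 := fun h1 => h₁ (Prod.ext h0 h1)
      refine h (X₂.2 / X₁.2) (Prod.ext ?_ ?_)
      · have : X₁.2 * X₂.1 = 0 := by rw [h0] at hd; linarith
        simp [h0, (mul_eq_zero.1 this).resolve_left h1]
      · simp; field_simp
    · refine h (X₂.1 / X₁.1) (Prod.ext ?_ ?_)
      · simp; field_simp
      · simp; field_simp; linarith
  obtain ⟨d, hd⟩ : ∃ d, d = X₁.1 * X₂.2 - X₁.2 * X₂.1 := ⟨_, rfl⟩
  rw [← hd] at hdet
  refine ⟨(V.1 * X₂.2 - V.2 * X₂.1) / d, (X₁.1 * V.2 - X₁.2 * V.1) / d, Prod.ext ?_ ?_⟩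
  · simp; field_simp; rw [hd]; ring
  · simp; field_simp; rw [hd]; ring

/-! ### Coordinate changes -/

lemma fderiv_comp_symm {F : Type*} [NormedAddCommGroup F] [NormedSpace ℝ F]
    {κ : OpenPartialHomeomorph (ℝ × ℝ) (ℝ × ℝ)} (hκ' : ContDiffOn ℝ ∞ κ.symm κ.target)
    {f : ℝ × ℝ → F} (hf : ContDiffOn ℝ ∞ f κ.source) {w : ℝ × ℝ} (hw : w ∈ κ.target)
    (X : ℝ × ℝ) :
    fderiv ℝ (f ∘ κ.symm) w X = fderiv ℝ f (κ.symm w) (fderiv ℝ κ.symm w X) := by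
  rw [fderiv_comp w (differentiableAt_of_contDiffOn κ.open_source hf (κ.map_target hw))
    (differentiableAt_of_contDiffOn κ.open_target hκ' hw)]
  rfl

lemma fderiv_fderiv_symm {κ : OpenPartialHomeomorph (ℝ × ℝ) (ℝ × ℝ)}
    (hκ : ContDiffOn ℝ ∞ κ κ.source) (hκ' : ContDiffOn ℝ ∞ κ.symm κ.target) {w : ℝ × ℝ}
    (hw : w ∈ κ.target) (X : ℝ × ℝ) :
    fderiv ℝ κ (κ.symm w) (fderiv ℝ κ.symm w X) = X := by
  rw [← fderiv_comp_symm hκ' hκ hw, fderiv_eq_of_eqOn κ.open_target (f := κ ∘ κ.symm) (g := id)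
    (fun y hy => κ.right_inv hy) hw, fderiv_id]
  rfl

lemma fderiv_symm_fderiv {κ : OpenPartialHomeomorph (ℝ × ℝ) (ℝ × ℝ)}
    (hκ : ContDiffOn ℝ ∞ κ κ.source) (hκ' : ContDiffOn ℝ ∞ κ.symm κ.target) {w : ℝ × ℝ}
    (hw : w ∈ κ.target) (X : ℝ × ℝ) :
    fderiv ℝ κ.symm w (fderiv ℝ κ (κ.symm w) X) = X := by
  have h := fderiv_fderiv_symm (κ := κ.symm) hκ' hκ (w := κ.symm w) (κ.map_target hw) X
  rwa [κ.symm_symm, κ.right_inv hw] at h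

/-! ### Frames of curvature spheres -/

/-- Smooth complex lifts `Y`, `Z` over `W` of the two curvature sphere congruences of a Legendre
immersion, of which the first one is constant along its curvature direction (as a line): it is a
channel congruence. The last two conditions but two express that the induced metrics are
anisotropic only where the derivative is tangent to the contact element. -/
structure CurvatureFrame (Y Z : ℝ × ℝ → CLieSpace) (W : Set (ℝ × ℝ)) : Prop where
  smooth_Y : ContDiffOn ℝ ∞ Y W
  smooth_Z : ContDiffOn ℝ ∞ Z W
  indep : ∀ x ∈ W, LinearIndependent ℂ ![Y x, Z x]
  inner_YY : ∀ x ∈ W, cInner (Y x) (Y x) = 0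
  inner_YZ : ∀ x ∈ W, cInner (Y x) (Z x) = 0
  inner_ZZ : ∀ x ∈ W, cInner (Z x) (Z x) = 0
  contact_Y : ∀ x ∈ W, ∀ X, cInner (fderiv ℝ Y x X) (Z x) = 0
  contact_Z : ∀ x ∈ W, ∀ X, cInner (fderiv ℝ Z x X) (Y x) = 0
  immersion : ∀ x ∈ W, ∀ X, fderiv ℝ Y x X ∈ Submodule.span ℂ {Y x, Z x} →
    fderiv ℝ Z x X ∈ Submodule.span ℂ {Y x, Z x} → X = 0
  null_Y : ∀ x ∈ W, ∀ X, cInner (fderiv ℝ Y x X) (fderiv ℝ Y x X) = 0 →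
    fderiv ℝ Y x X ∈ Submodule.span ℂ {Y x, Z x}
  null_Z : ∀ x ∈ W, ∀ X, cInner (fderiv ℝ Z x X) (fderiv ℝ Z x X) = 0 →
    fderiv ℝ Z x X ∈ Submodule.span ℂ {Y x, Z x}
  dir_Y : ∀ x ∈ W, ∃ X, X ≠ 0 ∧ fderiv ℝ Y x X ∈ Submodule.span ℂ {Y x}
  dir_Z : ∀ x ∈ W, ∃ X, X ≠ 0 ∧ fderiv ℝ Z x X ∈ Submodule.span ℂ {Y x, Z x}

lemma span_singleton_le_pair_left {R M : Type*} [Semiring R] [AddCommMonoid M] [Module R M]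
    (a b : M) : Submodule.span R {a} ≤ Submodule.span R {a, b} :=
  Submodule.span_mono (by simp)

namespace CurvatureFrame

variable {Y Z : ℝ × ℝ → CLieSpace} {W : Set (ℝ × ℝ)}

/-- The frame in other coordinates. -/
lemma comp_symm (h : CurvatureFrame Y Z W) {κ : OpenPartialHomeomorph (ℝ × ℝ) (ℝ × ℝ)}
    (hW : κ.source = W) (hκ : ContDiffOn ℝ ∞ κ κ.source)
    (hκ' : ContDiffOn ℝ ∞ κ.symm κ.target) :
    CurvatureFrame (Y ∘ κ.symm) (Z ∘ κ.symm) κ.target := by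
  subst hW
  have hmaps : Set.MapsTo κ.symm κ.target κ.source := fun w hw => κ.map_target hw
  have chain := @fderiv_comp_symm CLieSpace _ _ κ hκ'
  have left := fun w hw => fderiv_fderiv_symm hκ hκ' (w := w) hw
  have right := fun w hw => fderiv_symm_fderiv hκ hκ' (w := w) hw
  have ne : ∀ w ∈ κ.target, ∀ X, X ≠ 0 → fderiv ℝ κ (κ.symm w) X ≠ 0 := by
    intro w hw X hX h0
    have := right w hw X
    rw [h0, map_zero] at this
    exact hX this.symm
  exact
  { smooth_Y := h.smooth_Y.comp hκ' hmaps
    smooth_Z := h.smooth_Z.comp hκ' hmaps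
    indep := fun w hw => h.indep _ (hmaps hw)
    inner_YY := fun w hw => h.inner_YY _ (hmaps hw)
    inner_YZ := fun w hw => h.inner_YZ _ (hmaps hw)
    inner_ZZ := fun w hw => h.inner_ZZ _ (hmaps hw)
    contact_Y := fun w hw X => by
      rw [chain h.smooth_Y hw]; exact h.contact_Y _ (hmaps hw) _
    contact_Z := fun w hw X => by
      rw [chain h.smooth_Z hw]; exact h.contact_Z _ (hmaps hw) _
    immersion := fun w hw X h1 h2 => by
      rw [chain h.smooth_Y hw] at h1
      rw [chain h.smooth_Z hw] at h2
      rw [← left w hw X, h.immersion _ (hmaps hw) _ h1 h2, map_zero]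
    null_Y := fun w hw X h1 => by
      rw [chain h.smooth_Y hw] at h1 ⊢
      exact h.null_Y _ (hmaps hw) _ h1
    null_Z := fun w hw X h1 => by
      rw [chain h.smooth_Z hw] at h1 ⊢
      exact h.null_Z _ (hmaps hw) _ h1
    dir_Y := fun w hw => by
      obtain ⟨X, hX, hX'⟩ := h.dir_Y _ (hmaps hw)
      refine ⟨_, ne w hw X hX, ?_⟩
      rw [chain h.smooth_Y hw, right w hw]; exact hX'
    dir_Z := fun w hw => by
      obtain ⟨X, hX, hX'⟩ := h.dir_Z _ (hmaps hw)
      refine ⟨_, ne w hw X hX, ?_⟩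
      rw [chain h.smooth_Z hw, right w hw]; exact hX' }

lemma span_smul_pair {f g : ℂ} (hf : f ≠ 0) (hg : g ≠ 0) (y z : CLieSpace) :
    Submodule.span ℂ {f • y, g • z} = Submodule.span ℂ {y, z} := by
  refine le_antisymm (Submodule.span_le.2 ?_) (Submodule.span_le.2 ?_)
  · rintro _ (rfl | rfl)
    · exact Submodule.smul_mem _ _ (Submodule.subset_span (by simp))
    · exact Submodule.smul_mem _ _ (Submodule.subset_span (by simp))
  · rintro _ (rfl | rfl)
    · exact Submodule.mem_span_pair.2 ⟨f⁻¹, 0, by simp [smul_smul, inv_mul_cancel₀ hf]⟩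
    · exact Submodule.mem_span_pair.2 ⟨0, g⁻¹, by simp [smul_smul, inv_mul_cancel₀ hg]⟩

/-- Rescaling of the lifts by functions without zeros. -/
lemma smul (hW : IsOpen W) (h : CurvatureFrame Y Z W) {f g : ℝ × ℝ → ℂ}
    (hf : ContDiffOn ℝ ∞ f W) (hg : ContDiffOn ℝ ∞ g W) (hf0 : ∀ x ∈ W, f x ≠ 0)
    (hg0 : ∀ x ∈ W, g x ≠ 0) :
    CurvatureFrame (fun x => f x • Y x) (fun x => g x • Z x) W := by
  have dY : ∀ x ∈ W, ∀ X, fderiv ℝ (fun x => f x • Y x) x X =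
      fderiv ℝ f x X • Y x + f x • fderiv ℝ Y x X := fun x hx X =>
    fderiv_complex_smul (differentiableAt_of_contDiffOn hW hf hx)
      (differentiableAt_of_contDiffOn hW h.smooth_Y hx) X
  have dZ : ∀ x ∈ W, ∀ X, fderiv ℝ (fun x => g x • Z x) x X =
      fderiv ℝ g x X • Z x + g x • fderiv ℝ Z x X := fun x hx X =>
    fderiv_complex_smul (differentiableAt_of_contDiffOn hW hg hx)
      (differentiableAt_of_contDiffOn hW h.smooth_Z hx) X
  have YY : ∀ x ∈ W, ∀ X, cInner (fderiv ℝ Y x X) (Y x) = 0 := fun x hx X => by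
    have := cInner_fderiv_of_eq_zero hW h.smooth_Y h.smooth_Y h.inner_YY hx X
    rw [cInner_comm (Y x)] at this
    linear_combination this / 2
  have ZZ : ∀ x ∈ W, ∀ X, cInner (fderiv ℝ Z x X) (Z x) = 0 := fun x hx X => by
    have := cInner_fderiv_of_eq_zero hW h.smooth_Z h.smooth_Z h.inner_ZZ hx X
    rw [cInner_comm (Z x)] at this
    linear_combination this / 2
  have memY : ∀ x ∈ W, ∀ X, fderiv ℝ (fun x => f x • Y x) x X ∈ Submodule.span ℂ {Y x, Z x} ↔
      fderiv ℝ Y x X ∈ Submodule.span ℂ {Y x, Z x} := fun x hx X => by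
    rw [dY x hx, Submodule.add_mem_iff_right _
      (Submodule.smul_mem _ _ (Submodule.subset_span (by simp))),
      Submodule.smul_mem_iff _ (hf0 x hx)]
  have memZ : ∀ x ∈ W, ∀ X, fderiv ℝ (fun x => g x • Z x) x X ∈ Submodule.span ℂ {Y x, Z x} ↔
      fderiv ℝ Z x X ∈ Submodule.span ℂ {Y x, Z x} := fun x hx X => by
    rw [dZ x hx, Submodule.add_mem_iff_right _
      (Submodule.smul_mem _ _ (Submodule.subset_span (by simp))),
      Submodule.smul_mem_iff _ (hg0 x hx)]
  exact
  { smooth_Y := hf.smul h.smooth_Y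
    smooth_Z := hg.smul h.smooth_Z
    indep := fun x hx => by
      have := LinearIndependent.pair_iff.1 (h.indep x hx)
      refine LinearIndependent.pair_iff.2 fun s t hst => ?_
      rw [smul_smul, smul_smul] at hst
      have := this _ _ hst
      exact ⟨(mul_eq_zero.1 this.1).resolve_right (hf0 x hx),
        (mul_eq_zero.1 this.2).resolve_right (hg0 x hx)⟩
    inner_YY := fun x hx => by
      rw [cInner_smul_left, cInner_smul_right, h.inner_YY x hx]; simp
    inner_YZ := fun x hx => by
      rw [cInner_smul_left, cInner_smul_right, h.inner_YZ x hx]; simp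
    inner_ZZ := fun x hx => by
      rw [cInner_smul_left, cInner_smul_right, h.inner_ZZ x hx]; simp
    contact_Y := fun x hx X => by
      rw [dY x hx, cInner_smul_right, cInner_add_left, cInner_smul_left, cInner_smul_left,
        h.inner_YZ x hx, h.contact_Y x hx]; simp
    contact_Z := fun x hx X => by
      rw [dZ x hx, cInner_smul_right, cInner_add_left, cInner_smul_left, cInner_smul_left,
        cInner_comm (Z x), h.inner_YZ x hx, h.contact_Z x hx]; simp
    immersion := fun x hx X h1 h2 => by
      rw [span_smul_pair (hf0 x hx) (hg0 x hx)] at h1 h2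
      exact h.immersion x hx X ((memY x hx X).1 h1) ((memZ x hx X).1 h2)
    null_Y := fun x hx X h1 => by
      rw [span_smul_pair (hf0 x hx) (hg0 x hx), memY x hx]
      refine h.null_Y x hx X ?_
      rw [dY x hx] at h1
      simp only [cInner_add_left, cInner_add_right, cInner_smul_left, cInner_smul_right,
        cInner_comm (Y x) (fderiv ℝ Y x X), YY x hx, h.inner_YY x hx] at h1
      simpa [hf0 x hx] using h1
    null_Z := fun x hx X h1 => by
      rw [span_smul_pair (hf0 x hx) (hg0 x hx), memZ x hx]
      refine h.null_Z x hx X ?_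
      rw [dZ x hx] at h1
      simp only [cInner_add_left, cInner_add_right, cInner_smul_left, cInner_smul_right,
        cInner_comm (Z x) (fderiv ℝ Z x X), ZZ x hx, h.inner_ZZ x hx] at h1
      simpa [hg0 x hx] using h1
    dir_Y := fun x hx => by
      obtain ⟨X, hX, hX'⟩ := h.dir_Y x hx
      obtain ⟨c, hc⟩ := Submodule.mem_span_singleton.1 hX'
      refine ⟨X, hX, Submodule.mem_span_singleton.2
        ⟨(fderiv ℝ f x X + f x * c) * (f x)⁻¹, ?_⟩⟩
      rw [dY x hx, ← hc, smul_smul, smul_smul, ← add_smul, inv_mul_cancel_right₀ (hf0 x hx)]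
    dir_Z := fun x hx => by
      obtain ⟨X, hX, hX'⟩ := h.dir_Z x hx
      refine ⟨X, hX, ?_⟩
      rwa [span_smul_pair (hf0 x hx) (hg0 x hx), memZ x hx] }

lemma inner_fderiv_Y_Y (hW : IsOpen W) (h : CurvatureFrame Y Z W) {x : ℝ × ℝ} (hx : x ∈ W)
    (X : ℝ × ℝ) : cInner (fderiv ℝ Y x X) (Y x) = 0 := by
  have := cInner_fderiv_of_eq_zero hW h.smooth_Y h.smooth_Y h.inner_YY hx X
  rw [cInner_comm (Y x)] at this
  linear_combination this / 2

lemma inner_fderiv_Z_Z (hW : IsOpen W) (h : CurvatureFrame Y Z W) {x : ℝ × ℝ} (hx : x ∈ W)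
    (X : ℝ × ℝ) : cInner (fderiv ℝ Z x X) (Z x) = 0 := by
  have := cInner_fderiv_of_eq_zero hW h.smooth_Z h.smooth_Z h.inner_ZZ hx X
  rw [cInner_comm (Z x)] at this
  linear_combination this / 2

lemma inner_fderiv_Y_of_mem (hW : IsOpen W) (h : CurvatureFrame Y Z W) {x : ℝ × ℝ} (hx : x ∈ W)
    (X : ℝ × ℝ) {v : CLieSpace} (hv : v ∈ Submodule.span ℂ {Y x, Z x}) :
    cInner (fderiv ℝ Y x X) v = 0 := by
  obtain ⟨a, b, rfl⟩ := Submodule.mem_span_pair.1 hv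
  rw [cInner_add_right, cInner_smul_right, cInner_smul_right, h.inner_fderiv_Y_Y hW hx,
    h.contact_Y x hx]
  simp

lemma inner_fderiv_Z_of_mem (hW : IsOpen W) (h : CurvatureFrame Y Z W) {x : ℝ × ℝ} (hx : x ∈ W)
    (X : ℝ × ℝ) {v : CLieSpace} (hv : v ∈ Submodule.span ℂ {Y x, Z x}) :
    cInner (fderiv ℝ Z x X) v = 0 := by
  obtain ⟨a, b, rfl⟩ := Submodule.mem_span_pair.1 hv
  rw [cInner_add_right, cInner_smul_right, cInner_smul_right, h.inner_fderiv_Z_Z hW hx,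
    h.contact_Z x hx]
  simp

/-- Two nonzero curvature directions that belong to the two different congruences form a basis. -/
lemma exists_coords_of_mem (h : CurvatureFrame Y Z W) {x : ℝ × ℝ} (hx : x ∈ W) {X₁ X₂ : ℝ × ℝ}
    (hX₁ : X₁ ≠ 0) (hX₂ : X₂ ≠ 0) (h₁ : fderiv ℝ Y x X₁ ∈ Submodule.span ℂ {Y x, Z x})
    (h₂ : fderiv ℝ Z x X₂ ∈ Submodule.span ℂ {Y x, Z x}) (V : ℝ × ℝ) :
    ∃ a b : ℝ, V = a • X₁ + b • X₂ := by
  refine exists_coords hX₁ (fun c hc => ?_) V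
  refine hX₂ (h.immersion x hx X₂ ?_ h₂)
  rw [hc, map_smul, real_smul_eq_ofReal_smul]
  exact Submodule.smul_mem _ _ h₁

lemma inner_fderiv_symm (hW : IsOpen W) (h : CurvatureFrame Y Z W) {x : ℝ × ℝ} (hx : x ∈ W)
    (X X' : ℝ × ℝ) : cInner (fderiv ℝ Y x X) (fderiv ℝ Z x X') =
      cInner (fderiv ℝ Y x X') (fderiv ℝ Z x X) := by
  have h1 := cInner_fderiv_of_eq_zero hW (contDiffOn_fderiv_apply hW h.smooth_Y X) h.smooth_Z
    (fun y hy => h.contact_Y y hy X) hx X'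
  have h2 := cInner_fderiv_of_eq_zero hW (contDiffOn_fderiv_apply hW h.smooth_Y X') h.smooth_Z
    (fun y hy => h.contact_Y y hy X') hx X
  rw [fderiv_fderiv_comm hW h.smooth_Y hx] at h1
  linear_combination h1 - h2

/-- The derivatives of the two curvature sphere congruences are orthogonal. -/
lemma inner_fderiv_fderiv (hW : IsOpen W) (h : CurvatureFrame Y Z W) {x : ℝ × ℝ} (hx : x ∈ W)
    (X X' : ℝ × ℝ) : cInner (fderiv ℝ Y x X) (fderiv ℝ Z x X') = 0 := by
  obtain ⟨X₁, hX₁, h₁⟩ := h.dir_Y x hx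
  obtain ⟨X₂, hX₂, h₂⟩ := h.dir_Z x hx
  have h₁' := span_singleton_le_pair_left _ (Z x) h₁
  have e1 : ∀ V, cInner (fderiv ℝ Y x X₁) (fderiv ℝ Z x V) = 0 := fun V => by
    rw [cInner_comm]; exact h.inner_fderiv_Z_of_mem hW hx V h₁'
  have e2 : ∀ V, cInner (fderiv ℝ Y x X₂) (fderiv ℝ Z x V) = 0 := fun V => by
    rw [h.inner_fderiv_symm hW hx]; exact h.inner_fderiv_Y_of_mem hW hx V h₂
  obtain ⟨a, b, rfl⟩ := h.exists_coords_of_mem hx hX₁ hX₂ h₁' h₂ X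
  rw [map_add, map_smul, map_smul, cInner_add_left, cInner_real_smul_left, cInner_real_smul_left,
    e1, e2]
  simp

/-- If the sum `m = Y + Z` satisfies a Moutard equation in the directions `U`, `V`, then these
are conjugate for the metrics induced by `Y` and by `Z`. -/
lemma inner_eq_zero_of_moutard (hW : IsOpen W) (h : CurvatureFrame Y Z W) {U V : ℝ × ℝ}
    {x : ℝ × ℝ} (hx : x ∈ W) {c : ℂ}
    (hm : fderiv ℝ (fun z => fderiv ℝ (Y + Z) z U) x V = c • (Y x + Z x)) :
    cInner (fderiv ℝ Y x U) (fderiv ℝ Y x V) = 0 ∧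
      cInner (fderiv ℝ Z x U) (fderiv ℝ Z x V) = 0 := by
  have hmS : ContDiffOn ℝ ∞ (Y + Z) W := h.smooth_Y.add h.smooth_Z
  have hadd : ∀ y ∈ W, ∀ X, fderiv ℝ (Y + Z) y X = fderiv ℝ Y y X + fderiv ℝ Z y X :=
    fun y hy X => by
      rw [fderiv_add (differentiableAt_of_contDiffOn hW h.smooth_Y hy)
        (differentiableAt_of_contDiffOn hW h.smooth_Z hy), add_apply]
  have h1 := cInner_fderiv_of_eq_zero hW (contDiffOn_fderiv_apply hW hmS U) h.smooth_Y
    (fun y hy => by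
      rw [hadd y hy, cInner_add_left, h.inner_fderiv_Y_Y hW hy, h.contact_Z y hy, add_zero]) hx V
  have h2 := cInner_fderiv_of_eq_zero hW (contDiffOn_fderiv_apply hW hmS U) h.smooth_Z
    (fun y hy => by
      rw [hadd y hy, cInner_add_left, h.inner_fderiv_Z_Z hW hy, h.contact_Y y hy, add_zero]) hx V
  have n1 := h.inner_fderiv_fderiv hW hx V U
  have n2 := h.inner_fderiv_fderiv hW hx U V
  rw [cInner_comm] at n1
  rw [hm, hadd x hx] at h1 h2
  simp only [cInner_add_left, cInner_smul_left, h.inner_YY x hx, h.inner_YZ x hx, h.inner_ZZ x hx,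
    cInner_comm (Z x) (Y x), n1, n2] at h1 h2
  constructor
  · linear_combination h1
  · linear_combination h2

lemma inner_Y_ne_zero_or (h : CurvatureFrame Y Z W) {U V : ℝ × ℝ}
    (hUV : ∀ X, ∃ a b : ℝ, X = a • U + b • V) {x : ℝ × ℝ} (hx : x ∈ W) :
    cInner (fderiv ℝ Y x U) (fderiv ℝ Y x U) ≠ 0 ∨
      cInner (fderiv ℝ Y x V) (fderiv ℝ Y x V) ≠ 0 := by
  by_contra! hcon
  obtain ⟨X₂, hX₂, h₂⟩ := h.dir_Z x hx
  obtain ⟨a, b, hab⟩ := hUV X₂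
  refine hX₂ (h.immersion x hx X₂ ?_ h₂)
  rw [hab, map_add, map_smul, map_smul, real_smul_eq_ofReal_smul, real_smul_eq_ofReal_smul]
  exact add_mem (Submodule.smul_mem _ _ (h.null_Y x hx U hcon.1))
    (Submodule.smul_mem _ _ (h.null_Y x hx V hcon.2))

/-- Two directions `U`, `V` that are conjugate for the metrics induced by `Y` and by `Z` are
the curvature directions, in one order or the other: if `p U + q V` is the curvature direction of `Y`,
the inner products with `Y_U` and `Y_V` show that one of `p`, `q` vanishes, and likewise for `Z`. -/
lemma directions (hW : IsOpen W) (h : CurvatureFrame Y Z W) {U V : ℝ × ℝ}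
    (hUV : ∀ X, ∃ a b : ℝ, X = a • U + b • V) {x : ℝ × ℝ} (hx : x ∈ W)
    (hY : cInner (fderiv ℝ Y x U) (fderiv ℝ Y x V) = 0)
    (hZ : cInner (fderiv ℝ Z x U) (fderiv ℝ Z x V) = 0) :
    (cInner (fderiv ℝ Y x V) (fderiv ℝ Y x V) ≠ 0 →
        fderiv ℝ Y x U ∈ Submodule.span ℂ {Y x} ∧
          fderiv ℝ Z x V ∈ Submodule.span ℂ {Y x, Z x}) ∧
      (cInner (fderiv ℝ Y x U) (fderiv ℝ Y x U) = 0 ∨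
        cInner (fderiv ℝ Y x V) (fderiv ℝ Y x V) = 0) := by
  obtain ⟨X₁, hX₁, h₁⟩ := h.dir_Y x hx
  obtain ⟨p, q, hpq⟩ := hUV X₁
  have h₁' := span_singleton_le_pair_left _ (Z x) h₁
  have e1 := h.inner_fderiv_Y_of_mem hW hx U h₁'
  have e2 := h.inner_fderiv_Y_of_mem hW hx V h₁'
  rw [hpq, map_add, map_smul, map_smul, cInner_comm, cInner_add_left, cInner_real_smul_left,
    cInner_real_smul_left] at e1 e2
  rw [cInner_comm (fderiv ℝ Y x V) (fderiv ℝ Y x U), hY] at e1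
  rw [hY] at e2
  simp only [mul_zero, add_zero, zero_add, mul_eq_zero, Complex.ofReal_eq_zero] at e1 e2
  refine ⟨fun hne => ?_, ?_⟩
  · have hq := e2.resolve_right hne
    have hp : (p : ℂ) ≠ 0 := by
      rintro hp
      have hp' : p = 0 := by exact_mod_cast hp
      exact hX₁ (by rw [hpq, hp', hq]; simp)
    have hYU : fderiv ℝ Y x U ∈ Submodule.span ℂ {Y x} := by
      rw [hpq, hq, zero_smul, add_zero, map_smul, real_smul_eq_ofReal_smul] at h₁
      exact (Submodule.smul_mem_iff _ hp).1 h₁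
    refine ⟨hYU, ?_⟩
    have hU0 : U ≠ 0 := by
      rintro rfl
      exact hX₁ (by rw [hpq, hq]; simp)
    have hYU' := span_singleton_le_pair_left _ (Z x) hYU
    have hZU : cInner (fderiv ℝ Z x U) (fderiv ℝ Z x U) ≠ 0 := fun h0 =>
      hU0 (h.immersion x hx U hYU' (h.null_Z x hx U h0))
    obtain ⟨X₂, hX₂, h₂⟩ := h.dir_Z x hx
    obtain ⟨r, s, hrs⟩ := hUV X₂
    have e3 := h.inner_fderiv_Z_of_mem hW hx U h₂
    rw [hrs, map_add, map_smul, map_smul, cInner_comm, cInner_add_left, cInner_real_smul_left,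
      cInner_real_smul_left, cInner_comm (fderiv ℝ Z x V) (fderiv ℝ Z x U), hZ, mul_zero, add_zero,
      mul_eq_zero, Complex.ofReal_eq_zero] at e3
    have hr := e3.resolve_right hZU
    have hs : (s : ℂ) ≠ 0 := by
      rintro hs
      have hs' : s = 0 := by exact_mod_cast hs
      exact hX₂ (by rw [hrs, hs', hr]; simp)
    rw [hrs, hr, zero_smul, zero_add, map_smul, real_smul_eq_ofReal_smul] at h₂
    exact (Submodule.smul_mem_iff _ hs).1 h₂
  · by_contra! hcon
    exact hX₁ (by rw [hpq, e1.resolve_right hcon.1, e2.resolve_right hcon.2]; simp)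

end CurvatureFrame

/-- On a preconnected set, one of two continuous functions whose zero sets partition the set
vanishes identically. -/
lemma eq_zero_or_eq_zero_of_isPreconnected {R : Set (ℝ × ℝ)} (hR : IsOpen R)
    (hc : IsPreconnected R) {f g : ℝ × ℝ → ℂ} (hf : ContinuousOn f R) (hg : ContinuousOn g R)
    (h0 : ∀ x ∈ R, f x = 0 ∨ g x = 0) (h1 : ∀ x ∈ R, f x ≠ 0 ∨ g x ≠ 0) :
    (∀ x ∈ R, f x ≠ 0) ∨ ∀ x ∈ R, g x ≠ 0 := by
  have of := hf.isOpen_inter_preimage hR (isOpen_ne (x := (0 : ℂ)))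
  have og := hg.isOpen_inter_preimage hR (isOpen_ne (x := (0 : ℂ)))
  have h := (isPreconnected_iff_subset_of_disjoint.1 hc) _ _ of og
    (fun x hx => (h1 x hx).imp (fun h => ⟨hx, h⟩) (fun h => ⟨hx, h⟩))
    (Set.eq_empty_iff_forall_notMem.2 fun x hx => (h0 x hx.1).elim hx.2.1.2 hx.2.2.2)
  exact h.imp (fun h x hx => (h hx).2) (fun h x hx => (h hx).2)

/-! ### Moutard equations in curvature coordinates -/

namespace CurvatureFrame

variable {Y Z : ℝ × ℝ → CLieSpace} {W : Set (ℝ × ℝ)}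

/-- A Moutard equation for `Y + Z` in the curvature directions `U`, `V` forces the lift `Y` to be
constant along `U`, and `Z` to be a sum of functions of one variable each. Indeed, if
`Y_U = ρ Y` and `Z_V = α Y + β Z`, the equation reads `ρ_V Y + ρ Y_V + (α Y + β Z)_U = c (Y + Z)`,
and the inner products with `Y_V` and `Z_U` yield `ρ = β = 0`. -/
lemma eq_zero_of_moutard (hW : IsOpen W) (h : CurvatureFrame Y Z W) {U V : ℝ × ℝ}
    (hUV : ∀ X, ∃ a b : ℝ, X = a • U + b • V) (hU : U ≠ 0)
    (hdir : ∀ x ∈ W, fderiv ℝ Y x U ∈ Submodule.span ℂ {Y x} ∧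
      fderiv ℝ Z x V ∈ Submodule.span ℂ {Y x, Z x})
    (hm : ∀ x ∈ W, ∃ c : ℂ,
      fderiv ℝ (fun z => fderiv ℝ (Y + Z) z U) x V = c • (Y x + Z x)) :
    ∀ x ∈ W, fderiv ℝ Y x U = 0 ∧ fderiv ℝ Z x V ∈ Submodule.span ℂ {Y x} ∧
      fderiv ℝ (fun z => fderiv ℝ Z z V) x U = 0 := by
  have hex : ∀ x, ∃ ρ α β : ℂ, x ∈ W → fderiv ℝ Y x U = ρ • Y x ∧
      fderiv ℝ Z x V = α • Y x + β • Z x := by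
    intro x
    by_cases hx : x ∈ W
    · obtain ⟨ρ, hρ⟩ := Submodule.mem_span_singleton.1 (hdir x hx).1
      obtain ⟨α, β, hαβ⟩ := Submodule.mem_span_pair.1 (hdir x hx).2
      exact ⟨ρ, α, β, fun _ => ⟨hρ.symm, hαβ.symm⟩⟩
    · exact ⟨0, 0, 0, fun h => absurd h hx⟩
  choose ρ α β hc using hex
  have hYU : ContDiffOn ℝ ∞ (fun x => fderiv ℝ Y x U) W := contDiffOn_fderiv_apply hW h.smooth_Y U
  have hZV : ContDiffOn ℝ ∞ (fun x => fderiv ℝ Z x V) W := contDiffOn_fderiv_apply hW h.smooth_Z V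
  have hZU : ContDiffOn ℝ ∞ (fun x => fderiv ℝ Z x U) W := contDiffOn_fderiv_apply hW h.smooth_Z U
  have hρs := (contDiffOn_coeff hW h.smooth_Y h.smooth_Z hYU (α := ρ) (β := fun _ => 0) h.indep
    (fun x hx => by rw [(hc x hx).1]; simp)).1
  obtain ⟨hαs, hβs⟩ := contDiffOn_coeff hW h.smooth_Y h.smooth_Z hZV (α := α) (β := β) h.indep
    (fun x hx => (hc x hx).2)
  have split : ∀ x ∈ W, fderiv ℝ (fun z => fderiv ℝ (Y + Z) z U) x V =
      fderiv ℝ (fun z => fderiv ℝ Y z U) x V + fderiv ℝ (fun z => fderiv ℝ Z z V) x U := by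
    intro x hx
    rw [fderiv_eq_of_eqOn hW (g := fun z => fderiv ℝ Y z U + fderiv ℝ Z z U) (fun y hy => by
      rw [fderiv_add (differentiableAt_of_contDiffOn hW h.smooth_Y hy)
        (differentiableAt_of_contDiffOn hW h.smooth_Z hy), add_apply]) hx,
      fderiv_fun_add (differentiableAt_of_contDiffOn hW hYU hx)
      (differentiableAt_of_contDiffOn hW hZU hx), add_apply,
      fderiv_fderiv_comm hW h.smooth_Z hx U V]
  have hzero : ∀ x ∈ W, ρ x = 0 ∧ β x = 0 := by
    intro x hx
    obtain ⟨c, hcx⟩ := hm x hx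
    have hYd := differentiableAt_of_contDiffOn hW h.smooth_Y hx
    have hZd := differentiableAt_of_contDiffOn hW h.smooth_Z hx
    have hρd := differentiableAt_of_contDiffOn hW hρs hx
    have hαd := differentiableAt_of_contDiffOn hW hαs hx
    have hβd := differentiableAt_of_contDiffOn hW hβs hx
    rw [split x hx, fderiv_eq_of_eqOn hW (fun y hy => (hc y hy).1) hx,
      fderiv_eq_of_eqOn hW (fun y hy => (hc y hy).2) hx,
      fderiv_fun_add (hαd.fun_smul hYd) (hβd.fun_smul hZd), add_apply,
      fderiv_complex_smul hρd hYd, fderiv_complex_smul hαd hYd,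
      fderiv_complex_smul hβd hZd, (hc x hx).1] at hcx
    have hYU' := span_singleton_le_pair_left _ (Z x) (hdir x hx).1
    have hYV : cInner (fderiv ℝ Y x V) (fderiv ℝ Y x V) ≠ 0 :=
      (h.inner_Y_ne_zero_or hUV hx).resolve_left
        (not_not.2 (h.inner_fderiv_Y_of_mem hW hx U hYU'))
    have hZU : cInner (fderiv ℝ Z x U) (fderiv ℝ Z x U) ≠ 0 := fun h0 =>
      hU (h.immersion x hx U hYU' (h.null_Z x hx U h0))
    have e1 := congrArg (cInner (fderiv ℝ Y x V)) hcx
    have e2 := congrArg (cInner (fderiv ℝ Z x U)) hcx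
    have n2 := h.inner_fderiv_fderiv hW hx V U
    have n3 := n2
    rw [cInner_comm] at n3
    simp only [cInner_add_right, cInner_smul_right, h.inner_fderiv_Y_Y hW hx, h.contact_Y x hx,
      h.inner_fderiv_Z_Z hW hx, h.contact_Z x hx, n2, n3, mul_zero, add_zero, zero_add,
      mul_eq_zero] at e1 e2
    exact ⟨e1.resolve_right hYV, e2.resolve_right hZU⟩
  intro x hx
  have hY0 : ∀ y ∈ W, fderiv ℝ Y y U = 0 := fun y hy => by
    rw [(hc y hy).1, (hzero y hy).1, zero_smul]
  have hZ0 : ∀ y ∈ W, fderiv ℝ Z y V = α y • Y y := fun y hy => by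
    rw [(hc y hy).2, (hzero y hy).2, zero_smul, add_zero]
  refine ⟨hY0 x hx, hZ0 x hx ▸ Submodule.smul_mem _ _ (Submodule.mem_span_singleton_self _), ?_⟩
  obtain ⟨c, hcx⟩ := hm x hx
  rw [split x hx, fderiv_eq_of_eqOn hW (g := fun _ => (0 : CLieSpace)) hY0 hx] at hcx
  have hval : fderiv ℝ (fun z => fderiv ℝ Z z V) x U = fderiv ℝ α x U • Y x := by
    rw [fderiv_eq_of_eqOn hW hZ0 hx,
      fderiv_complex_smul (differentiableAt_of_contDiffOn hW hαs hx)
        (differentiableAt_of_contDiffOn hW h.smooth_Y hx), hY0 x hx, smul_zero, add_zero]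
  have hc0 : c = 0 := by
    have := (LinearIndependent.pair_iff.1 (h.indep x hx) (fderiv ℝ α x U - c) (-c) (by
      rw [sub_smul, ← hval, neg_smul]
      simp only [fderiv_fun_const, Pi.zero_apply, zero_apply, zero_add] at hcx
      rw [hcx, smul_add]; abel)).2
    exact neg_eq_zero.1 this
  rw [hc0, zero_smul] at hcx
  simpa using hcx

/-- If the sum of the two lifts of a curvature frame is a Moutard lift with respect to
coordinates on a rectangle, then one of the coordinate directions `U` is, everywhere, the curvature
direction of `Y`, along which `Y` is constant. -/
lemma exists_directions_of_moutard (hW : IsOpen W) (hWc : IsPreconnected W)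
    (h : CurvatureFrame Y Z W)
    (hm : ∀ x ∈ W, ∃ c : ℂ,
      fderiv ℝ (fun z => fderiv ℝ (Y + Z) z (1, 0)) x (0, 1) = c • (Y x + Z x)) :
    ∃ U V : ℝ × ℝ, ((U = (1, 0) ∧ V = (0, 1)) ∨ (U = (0, 1) ∧ V = (1, 0))) ∧
      ∀ x ∈ W, fderiv ℝ Y x U = 0 ∧ fderiv ℝ Z x V ∈ Submodule.span ℂ {Y x} ∧
        fderiv ℝ (fun z => fderiv ℝ Z z V) x U = 0 := by
  have hUV : ∀ X : ℝ × ℝ, ∃ a b : ℝ, X = a • ((1, 0) : ℝ × ℝ) + b • ((0, 1) : ℝ × ℝ) :=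
    fun X => ⟨X.1, X.2, by ext <;> simp⟩
  have hVU : ∀ X : ℝ × ℝ, ∃ a b : ℝ, X = a • ((0, 1) : ℝ × ℝ) + b • ((1, 0) : ℝ × ℝ) :=
    fun X => ⟨X.2, X.1, by ext <;> simp⟩
  have hm' : ∀ x ∈ W, ∃ c : ℂ,
      fderiv ℝ (fun z => fderiv ℝ (Y + Z) z (0, 1)) x (1, 0) = c • (Y x + Z x) := by
    intro x hx
    rw [fderiv_fderiv_comm hW (f := Y + Z) (h.smooth_Y.add h.smooth_Z) hx]
    exact hm x hx
  have cont : ∀ X, ContinuousOn (fun x => cInner (fderiv ℝ Y x X) (fderiv ℝ Y x X)) W := by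
    intro X
    have hs := (contDiffOn_fderiv_apply hW h.smooth_Y X).continuousOn
    have hi := fun i => continuousOn_pi.1 hs i
    exact (((((((hi 0).mul (hi 0)).neg.add ((hi 1).mul (hi 1))).add ((hi 2).mul (hi 2))).add
      ((hi 3).mul (hi 3))).add ((hi 4).mul (hi 4))).sub ((hi 5).mul (hi 5)))
  have hinner : ∀ x ∈ W, _ := fun x hx =>
    let ⟨_, hcx⟩ := hm x hx
    h.inner_eq_zero_of_moutard hW hx hcx
  have hinner' : ∀ x ∈ W, _ := fun x hx =>
    let ⟨_, hcx⟩ := hm' x hx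
    h.inner_eq_zero_of_moutard hW hx hcx
  have hd := fun x hx => h.directions hW hUV hx (hinner x hx).1 (hinner x hx).2
  have hd' := fun x hx => h.directions hW hVU hx (hinner' x hx).1 (hinner' x hx).2
  rcases eq_zero_or_eq_zero_of_isPreconnected hW hWc (cont (1, 0)) (cont (0, 1))
    (fun x hx => (hd x hx).2) (fun x hx => h.inner_Y_ne_zero_or hUV hx) with hne | hne
  · exact ⟨(0, 1), (1, 0), Or.inr ⟨rfl, rfl⟩, h.eq_zero_of_moutard hW hVU (by simp)
      (fun x hx => (hd' x hx).1 (hne x hx)) hm'⟩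
  · exact ⟨(1, 0), (0, 1), Or.inl ⟨rfl, rfl⟩, h.eq_zero_of_moutard hW hUV (by simp)
      (fun x hx => (hd x hx).1 (hne x hx)) hm⟩

/-- If `Y + Z` is a Moutard lift, then `Y` is constant along its curvature direction and the
derivative of `Z` along its own curvature direction is a multiple of `Y`. Moreover, the coordinates can
be numbered so that `Y` depends on the second one only and `Z` has vanishing mixed derivative. -/
lemma exists_directions_of_isCoordinateRectangle (h : CurvatureFrame Y Z W)
    {κ : OpenPartialHomeomorph (ℝ × ℝ) (ℝ × ℝ)} {I J : Set ℝ} (hκ : IsCoordinateRectangle κ W I J)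
    (hm : ∀ w ∈ κ.target, ∃ c : ℂ,
      fderiv ℝ (fun z => fderiv ℝ ((Y + Z) ∘ κ.symm) z (1, 0)) w (0, 1) =
        c • (Y + Z) (κ.symm w)) :
    (∀ x ∈ W, ∃ E₁ E₂ : ℝ × ℝ, E₁ ≠ 0 ∧ E₂ ≠ 0 ∧ fderiv ℝ Y x E₁ = 0 ∧
        fderiv ℝ Z x E₂ ∈ Submodule.span ℂ {Y x}) ∧
      ∃ (κ' : OpenPartialHomeomorph (ℝ × ℝ) (ℝ × ℝ)) (I' J' : Set ℝ),
        IsCoordinateRectangle κ' W I' J' ∧ ∀ w ∈ κ'.target,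
          fderiv ℝ (Y ∘ κ'.symm) w (1, 0) = 0 ∧
          fderiv ℝ (Z ∘ κ'.symm) w (0, 1) ∈ Submodule.span ℂ {Y (κ'.symm w)} ∧
          fderiv ℝ (fun z => fderiv ℝ (Z ∘ κ'.symm) z (0, 1)) w (1, 0) = 0 := by
  obtain ⟨rfl, hT, hI, hIc, hJ, hJc, hs, hs'⟩ := id hκ
  have hc : IsPreconnected κ.target := by
    rw [hT]; exact hIc.isPreconnected.prod hJc.isPreconnected
  have hf := h.comp_symm rfl hs hs'
  obtain ⟨U, V, hUV, hd⟩ := hf.exists_directions_of_moutard κ.open_target hc hm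
  constructor
  · intro x hx
    have hw := κ.map_source hx
    have ne : ∀ X : ℝ × ℝ, X ≠ 0 → fderiv ℝ κ.symm (κ x) X ≠ 0 := fun X hX h0 => hX (by
      rw [← fderiv_fderiv_symm hs hs' hw X, h0, map_zero])
    obtain ⟨h1, h2, -⟩ := hd _ hw
    rw [fderiv_comp_symm hs' h.smooth_Y hw, κ.left_inv hx] at h1
    rw [fderiv_comp_symm hs' h.smooth_Z hw, Function.comp_apply, κ.left_inv hx] at h2
    refine ⟨_, _, ne U ?_, ne V ?_, h1, h2⟩ <;> rcases hUV with ⟨rfl, rfl⟩ | ⟨rfl, rfl⟩ <;> simp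
  · rcases hUV with ⟨rfl, rfl⟩ | ⟨rfl, rfl⟩
    · exact ⟨κ, I, J, hκ, hd⟩
    · obtain ⟨κ', hκ', hsw⟩ := hκ.swap
      have hcomp : ∀ f : ℝ × ℝ → CLieSpace, f ∘ κ'.symm = (f ∘ κ.symm) ∘ Prod.swap := fun f => by
        ext1 w; simp [hsw]
      have hfd : ∀ (f : ℝ × ℝ → CLieSpace) (w X : ℝ × ℝ),
          fderiv ℝ (f ∘ Prod.swap) w X = fderiv ℝ f w.swap X.swap := fun f w X => by
        have := (ContinuousLinearEquiv.prodComm ℝ ℝ ℝ).comp_right_fderiv (f := f) (x := w)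
        exact DFunLike.congr_fun this X
      refine ⟨κ', J, I, hκ', fun w hw => ?_⟩
      have hw' : w.swap ∈ κ.target := by
        rw [hκ'.2.1] at hw; rw [hT]; exact ⟨hw.2, hw.1⟩
      obtain ⟨h1, h2, h3⟩ := hd _ hw'
      have hfun : (fun z => fderiv ℝ ((Z ∘ κ.symm) ∘ Prod.swap) z (0, 1)) =
          (fun z => fderiv ℝ (Z ∘ κ.symm) z (1, 0)) ∘ Prod.swap := by
        ext1 z; exact hfd _ _ _
      rw [hcomp, hcomp, hfun, hfd, hfd, hfd, hsw]
      exact ⟨h1, h2, h3⟩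

/-- If both `Y + Z` and `G (Y - Z)` are Moutard lifts, then `dG = 0`: the curvature directions are the
same for both pairs of lifts, and `Y` and `G Y` are both constant along the first one, while the
derivatives of `Z` and `G Z` along the second one are both multiples of `Y`. -/
lemma fderiv_eq_zero_of_directions (hW : IsOpen W) (h : CurvatureFrame Y Z W) {G : ℝ × ℝ → ℂ}
    (hG : ContDiffOn ℝ ∞ G W) (hG0 : ∀ x ∈ W, G x ≠ 0) {x : ℝ × ℝ} (hx : x ∈ W)
    (hd : ∃ E₁ E₂ : ℝ × ℝ, E₁ ≠ 0 ∧ E₂ ≠ 0 ∧ fderiv ℝ Y x E₁ = 0 ∧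
        fderiv ℝ Z x E₂ ∈ Submodule.span ℂ {Y x})
    (hd' : ∃ E₁ E₂ : ℝ × ℝ, E₁ ≠ 0 ∧ E₂ ≠ 0 ∧ fderiv ℝ (fun y => G y • Y y) x E₁ = 0 ∧
        fderiv ℝ (fun y => -G y • Z y) x E₂ ∈ Submodule.span ℂ {G x • Y x}) :
    fderiv ℝ G x = 0 := by
  obtain ⟨E₁, E₂, h₁, h₂, hY, hZ⟩ := hd
  obtain ⟨F₁, F₂, f₁, f₂, hY', hZ'⟩ := hd'
  have hYd := differentiableAt_of_contDiffOn hW h.smooth_Y hx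
  have hZd := differentiableAt_of_contDiffOn hW h.smooth_Z hx
  have hGd := differentiableAt_of_contDiffOn hW hG hx
  have hYmem : fderiv ℝ Y x E₁ ∈ Submodule.span ℂ {Y x, Z x} := by rw [hY]; exact zero_mem _
  have hZmem := span_singleton_le_pair_left _ (Z x) hZ
  have hbas := h.exists_coords_of_mem hx h₁ h₂ hYmem hZmem
  have hY0 : Y x ≠ 0 := (h.indep x hx).ne_zero 0
  have memY : Y x ∈ Submodule.span ℂ {Y x, Z x} := Submodule.subset_span (by simp)
  have memZ : Z x ∈ Submodule.span ℂ {Y x, Z x} := Submodule.subset_span (by simp)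
  rw [fderiv_complex_smul hGd hYd] at hY'
  rw [fderiv_complex_smul hGd.fun_neg hZd, fderiv_fun_neg] at hZ'
  have g1 : fderiv ℝ G x E₁ = 0 := by
    obtain ⟨a, b, hab⟩ := hbas F₁
    have hb : b = 0 := by
      by_contra hb
      refine h₂ (h.immersion x hx E₂ ?_ hZmem)
      rw [hab, map_add, map_add, map_smul (fderiv ℝ Y x), map_smul (fderiv ℝ Y x), hY, smul_zero,
        zero_add, real_smul_eq_ofReal_smul b, smul_smul, add_comm] at hY'
      have hne : G x * (b : ℂ) ≠ 0 := mul_ne_zero (hG0 x hx) (by exact_mod_cast hb)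
      rw [← Submodule.smul_mem_iff _ hne, eq_neg_of_add_eq_zero_left hY']
      exact neg_mem (Submodule.smul_mem _ _ memY)
    rw [hb, zero_smul, add_zero] at hab
    have ha : a ≠ 0 := by rintro rfl; exact f₁ (by simpa using hab)
    rw [hab, map_smul, map_smul, hY, smul_zero, smul_zero, add_zero] at hY'
    simpa [ha, hY0] using hY'
  have g2 : fderiv ℝ G x E₂ = 0 := by
    obtain ⟨a, b, hab⟩ := hbas F₂
    have hle : Submodule.span ℂ {G x • Y x} ≤ Submodule.span ℂ {Y x} :=
      Submodule.span_le.2 (by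
        rintro _ rfl
        exact Submodule.smul_mem _ _ (Submodule.mem_span_singleton_self _))
    have hZ'' := hle hZ'
    have ha : a = 0 := by
      by_contra ha
      refine h₁ (h.immersion x hx E₁ hYmem ?_)
      have h3 := span_singleton_le_pair_left _ (Z x) hZ''
      rw [Submodule.add_mem_iff_right _ (Submodule.smul_mem _ _ memZ),
        Submodule.smul_mem_iff _ (neg_ne_zero.2 (hG0 x hx)), hab, map_add, map_smul, map_smul,
        real_smul_eq_ofReal_smul, real_smul_eq_ofReal_smul,
        Submodule.add_mem_iff_left _ (Submodule.smul_mem _ _ hZmem),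
        Submodule.smul_mem_iff _ (by exact_mod_cast ha)] at h3
      exact h3
    rw [ha, zero_smul, zero_add] at hab
    have hb : b ≠ 0 := by rintro rfl; exact f₂ (by simpa using hab)
    rw [hab, map_smul (fderiv ℝ Z x), real_smul_eq_ofReal_smul b,
      Submodule.add_mem_iff_left _ (Submodule.smul_mem _ _ (Submodule.smul_mem _ _ hZ))] at hZ''
    obtain ⟨r, hr⟩ := Submodule.mem_span_singleton.1 hZ''
    have := (LinearIndependent.pair_iff.1 (h.indep x hx) r (-((-fderiv ℝ G x) (b • E₂)))
      (by rw [hr, neg_smul, add_neg_cancel])).2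
    simpa [hb] using this
  refine ContinuousLinearMap.ext fun X => ?_
  obtain ⟨a, b, rfl⟩ := hbas X
  rw [map_add, map_smul, map_smul, g1, g2]
  simp

end CurvatureFrame

/-! ### Real structure of the complexification -/

/-- The real part of a complex vector. -/
def reVec : CLieSpace →L[ℝ] LieSpace :=
  ContinuousLinearMap.pi fun i => Complex.reCLM.comp (ContinuousLinearMap.proj i)

/-- The imaginary part of a complex vector. -/
def imVec : CLieSpace →L[ℝ] LieSpace :=
  ContinuousLinearMap.pi fun i => Complex.imCLM.comp (ContinuousLinearMap.proj i)

/-- The inclusion of the real vectors into the complex ones. -/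
def ofRealVec : LieSpace →L[ℝ] CLieSpace :=
  ContinuousLinearMap.pi fun i => Complex.ofRealCLM.comp (ContinuousLinearMap.proj i)

@[simp] lemma reVec_apply (z : CLieSpace) (i : Fin 6) : reVec z i = (z i).re := rfl

@[simp] lemma imVec_apply (z : CLieSpace) (i : Fin 6) : imVec z i = (z i).im := rfl

@[simp] lemma ofRealVec_apply (k : LieSpace) (i : Fin 6) : ofRealVec k i = (k i : ℂ) := rfl

@[simp] lemma reVec_ofRealVec (k : LieSpace) : reVec (ofRealVec k) = k := by
  ext i; simp

@[simp] lemma imVec_ofRealVec (k : LieSpace) : imVec (ofRealVec k) = 0 := by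
  ext i; simp

lemma cInner_ofRealVec (k l : LieSpace) :
    cInner (ofRealVec k) (ofRealVec l) = (lieInner k l : ℂ) := by
  simp [cInner, lieInner]

lemma cInner_eq (z w : CLieSpace) :
    cInner z w = ((lieInner (reVec z) (reVec w) - lieInner (imVec z) (imVec w) : ℝ) : ℂ)
      + ((lieInner (reVec z) (imVec w) + lieInner (imVec z) (reVec w) : ℝ) : ℂ) *
        Complex.I := by
  apply Complex.ext
  · simp [cInner, lieInner]; ring
  · simp [cInner, lieInner]; ring

lemma reVec_smul (c : ℂ) (z : CLieSpace) :
    reVec (c • z) = c.re • reVec z - c.im • imVec z := by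
  ext i; simp

lemma imVec_smul (c : ℂ) (z : CLieSpace) :
    imVec (c • z) = c.re • imVec z + c.im • reVec z := by
  ext i; simp

/-- The complexification of a subspace of `ℝ^{4,2}`. -/
def complexify (P : Submodule ℝ LieSpace) : Submodule ℂ CLieSpace where
  carrier := {z | reVec z ∈ P ∧ imVec z ∈ P}
  add_mem' := fun h h' => by
    simp only [Set.mem_ofPred_eq, map_add]
    exact ⟨add_mem h.1 h'.1, add_mem h.2 h'.2⟩
  zero_mem' := by simp
  smul_mem' := fun c z h => by
    simp only [Set.mem_ofPred_eq, reVec_smul, imVec_smul]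
    exact ⟨sub_mem (P.smul_mem _ h.1) (P.smul_mem _ h.2),
      add_mem (P.smul_mem _ h.2) (P.smul_mem _ h.1)⟩

lemma mem_complexify {P : Submodule ℝ LieSpace} {z : CLieSpace} :
    z ∈ complexify P ↔ reVec z ∈ P ∧ imVec z ∈ P := Iff.rfl

@[simp] lemma ofRealVec_mem_complexify {P : Submodule ℝ LieSpace} {k : LieSpace} :
    ofRealVec k ∈ complexify P ↔ k ∈ P := by
  simp [mem_complexify]

lemma complexify_span_pair (k l : LieSpace) :
    complexify (Submodule.span ℝ {k, l}) =
      Submodule.span ℂ {ofRealVec k, ofRealVec l} := by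
  refine le_antisymm (fun z hz => ?_) (Submodule.span_le.2 ?_)
  · obtain ⟨a, b, h1⟩ := Submodule.mem_span_pair.1 hz.1
    obtain ⟨c, d, h2⟩ := Submodule.mem_span_pair.1 hz.2
    refine Submodule.mem_span_pair.2 ⟨⟨a, c⟩, ⟨b, d⟩, ?_⟩
    ext i
    have h1 := congrFun h1 i
    have h2 := congrFun h2 i
    apply Complex.ext
    · simpa using h1
    · simpa [add_comm] using h2
  · rintro _ (rfl | rfl)
    · exact ofRealVec_mem_complexify.2 (Submodule.subset_span (by simp))
    · exact ofRealVec_mem_complexify.2 (Submodule.subset_span (by simp))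

/-- Independent vectors of a plane span it. -/
lemma span_pair_eq_of_linearIndependent {𝕜 M : Type*} [Field 𝕜] [AddCommGroup M] [Module 𝕜 M]
    {a b c d : M} (hcd : LinearIndependent 𝕜 ![c, d]) (hc : c ∈ Submodule.span 𝕜 {a, b})
    (hd : d ∈ Submodule.span 𝕜 {a, b}) : Submodule.span 𝕜 {a, b} = Submodule.span 𝕜 {c, d} := by
  classical
  have hle : Submodule.span 𝕜 {c, d} ≤ Submodule.span 𝕜 {a, b} :=
    Submodule.span_le.2 (by rintro _ (rfl | rfl) <;> assumption)
  have : FiniteDimensional 𝕜 (Submodule.span 𝕜 {a, b}) :=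
    FiniteDimensional.span_of_finite 𝕜 (by simp)
  refine (Submodule.eq_of_le_of_finrank_le hle ?_).symm
  have h1 := finrank_span_eq_card hcd
  rw [Matrix.range_cons, Matrix.range_cons, Matrix.range_empty, Set.union_empty,
    Set.singleton_union] at h1
  rw [h1]
  have h2 := finrank_span_finset_le_card (R := 𝕜) ({a, b} : Finset M)
  simp only [Finset.coe_insert, Finset.coe_singleton] at h2
  exact (h2.trans Finset.card_le_two).trans (by simp)

lemma linearIndependent_ofRealVec {k l : LieSpace} (h : LinearIndependent ℝ ![k, l]) :
    LinearIndependent ℂ ![ofRealVec k, ofRealVec l] := by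
  rw [LinearIndependent.pair_iff] at h ⊢
  intro s t hst
  have hi := fun i => congrFun hst i
  have h1 := h s.re t.re (by
    ext i; simpa using congrArg Complex.re (hi i))
  have h2 := h s.im t.im (by
    ext i; simpa using congrArg Complex.im (hi i))
  exact ⟨Complex.ext h1.1 h2.1, Complex.ext h1.2 h2.2⟩

lemma cInner_eq_zero_of_mem_complexify {P Q : Submodule ℝ LieSpace}
    (h : ∀ a ∈ P, ∀ b ∈ Q, lieInner a b = 0) {z w : CLieSpace} (hz : z ∈ complexify P)
    (hw : w ∈ complexify Q) : cInner z w = 0 := by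
  rw [cInner_eq, h _ hz.1 _ hw.1, h _ hz.2 _ hw.2, h _ hz.1 _ hw.2, h _ hz.2 _ hw.1]
  simp

lemma fderiv_continuousLinearMap_apply {F G : Type*} [NormedAddCommGroup F] [NormedSpace ℝ F]
    [NormedAddCommGroup G] [NormedSpace ℝ G] (A : F →L[ℝ] G) {f : ℝ × ℝ → F} {x : ℝ × ℝ}
    (hf : DifferentiableAt ℝ f x) (X : ℝ × ℝ) :
    fderiv ℝ (fun y => A (f y)) x X = A (fderiv ℝ f x X) := by
  have h : HasFDerivAt (fun y => A (f y)) (A.comp (fderiv ℝ f x)) x :=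
    A.hasFDerivAt.comp x hf.hasFDerivAt
  rw [h.fderiv]
  rfl

/-! ### The shape operator of a Legendre immersion -/

/-- Every pair of independent elements of `L x` extends to a local frame of sections. -/
lemma IsLegendreImmersion.exists_frame {L : ℝ × ℝ → Submodule ℝ LieSpace} {D : Set (ℝ × ℝ)}
    (hL : IsLegendreImmersion L D) {x : ℝ × ℝ} (hx : x ∈ D) {k₁ k₂ : LieSpace} (h₁ : k₁ ∈ L x)
    (h₂ : k₂ ∈ L x) (hk : LinearIndependent ℝ ![k₁, k₂]) :
    ∃ U ⊆ D, IsOpen U ∧ x ∈ U ∧ ∃ σ τ : ℝ × ℝ → LieSpace, IsSection L U σ ∧ IsSection L U τ ∧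
      (∀ y ∈ U, LinearIndependent ℝ ![σ y, τ y] ∧ L y = Submodule.span ℝ {σ y, τ y}) ∧
      σ x = k₁ ∧ τ x = k₂ := by
  obtain ⟨U, hUD, hU, hxU, σ, τ, hσ, hτ, hfr⟩ := hL.smooth x hx
  rw [(hfr x hxU).2] at h₁ h₂
  obtain ⟨a, b, rfl⟩ := Submodule.mem_span_pair.1 h₁
  obtain ⟨c, d, rfl⟩ := Submodule.mem_span_pair.1 h₂
  have hdet := ((LinearIndependent.pair_add_smul_add_smul_iff a b c d).1 hk).2
  have mem : ∀ p q : ℝ, ∀ y ∈ U, p • σ y + q • τ y ∈ L y := fun p q y hy =>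
    add_mem (Submodule.smul_mem _ _ (hσ.2 y hy)) (Submodule.smul_mem _ _ (hτ.2 y hy))
  have sm : ∀ p q : ℝ, IsSection L U (fun y => p • σ y + q • τ y) := fun p q =>
    ⟨(hσ.1.const_smul p).add (hτ.1.const_smul q), mem p q⟩
  refine ⟨U, hUD, hU, hxU, _, _, sm a b, sm c d, fun y hy => ?_, rfl, rfl⟩
  have hind := (LinearIndependent.pair_add_smul_add_smul_iff a b c d).2 ⟨(hfr y hy).1, hdet⟩
  refine ⟨hind, ?_⟩
  rw [(hfr y hy).2]
  exact span_pair_eq_of_linearIndependent hind (Submodule.mem_span_pair.2 ⟨_, _, rfl⟩)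
    (Submodule.mem_span_pair.2 ⟨_, _, rfl⟩)

/-- The derivatives at `x`, modulo the contact element, of the sections through two independent
curvature spheres `k₁`, `k₂` at `x`: `T₁` and `T₂` are the differentials of particular sections with
values `k₁` and `k₂`, and `X₁`, `X₂` are the curvature directions. -/
structure CurvatureData (L : ℝ × ℝ → Submodule ℝ LieSpace) (x : ℝ × ℝ) (k₁ k₂ : LieSpace)
    (T₁ T₂ : ℝ × ℝ →L[ℝ] LieSpace) (X₁ X₂ : ℝ × ℝ) : Prop where
  ne_zero₁ : X₁ ≠ 0
  ne_zero₂ : X₂ ≠ 0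
  mem₁ : T₁ X₁ ∈ L x
  mem₂ : T₂ X₂ ∈ L x
  immersion : ∀ X, T₁ X ∈ L x → T₂ X ∈ L x → X = 0
  contact₁ : ∀ X, ∀ l ∈ L x, lieInner (T₁ X) l = 0
  contact₂ : ∀ X, ∀ l ∈ L x, lieInner (T₂ X) l = 0
  orth : ∀ X X', lieInner (T₁ X) (T₂ X') = 0
  deriv_section : ∀ (U : Set (ℝ × ℝ)) (V : ℝ × ℝ → CLieSpace), IsOpen U → x ∈ U →
    ContDiffOn ℝ ∞ V U → (∀ y ∈ U, V y ∈ complexify (L y)) → ∀ c d : ℂ,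
    V x = c • ofRealVec k₁ + d • ofRealVec k₂ → ∀ X,
    fderiv ℝ V x X - (c • ofRealVec (T₁ X) + d • ofRealVec (T₂ X)) ∈ complexify (L x)

lemma CurvatureData.exists_coords {L : ℝ × ℝ → Submodule ℝ LieSpace} {x : ℝ × ℝ}
    {k₁ k₂ : LieSpace} {T₁ T₂ : ℝ × ℝ →L[ℝ] LieSpace} {X₁ X₂ : ℝ × ℝ}
    (h : CurvatureData L x k₁ k₂ T₁ T₂ X₁ X₂) (V : ℝ × ℝ) : ∃ a b : ℝ, V = a • X₁ + b • X₂ := by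
  refine _root_.exists_coords h.ne_zero₁ (fun c hc => h.ne_zero₂ (h.immersion X₂ ?_ h.mem₂)) V
  rw [hc, map_smul]
  exact Submodule.smul_mem _ _ h.mem₁

/-- Two distinct curvature spheres determine curvature data: a frame of sections through them provides
the derivatives, and the contact condition makes these derivatives orthogonal to each other. -/
lemma IsLegendreImmersion.exists_curvatureData {L : ℝ × ℝ → Submodule ℝ LieSpace}
    {D : Set (ℝ × ℝ)} (hL : IsLegendreImmersion L D) {x : ℝ × ℝ} (hx : x ∈ D) {k₁ k₂ : LieSpace}
    (h₁ : IsCurvatureSphere L x k₁) (h₂ : IsCurvatureSphere L x k₂)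
    (hk : LinearIndependent ℝ ![k₁, k₂]) :
    ∃ (T₁ T₂ : ℝ × ℝ →L[ℝ] LieSpace) (X₁ X₂ : ℝ × ℝ), CurvatureData L x k₁ k₂ T₁ T₂ X₁ X₂ := by
  obtain ⟨U, hUD, hU, hxU, σ, τ, hσ, hτ, hfr, rfl, rfl⟩ := hL.exists_frame hx h₁.1 h₂.1 hk
  obtain ⟨-, -, X₁, hX₁, h₁⟩ := h₁
  obtain ⟨-, -, X₂, hX₂, h₂⟩ := h₂
  have h₁' := h₁ U hU hxU σ hσ rfl
  have h₂' := h₂ U hU hxU τ hτ rfl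
  have cs : ∀ {ρ : ℝ × ℝ → LieSpace}, IsSection L U ρ →
      ContDiffOn ℝ ∞ (fun y => ofRealVec (ρ y)) U := fun hρ => ofRealVec.contDiff.comp_contDiffOn hρ.1
  have dcs : ∀ {ρ : ℝ × ℝ → LieSpace}, IsSection L U ρ → ∀ y ∈ U, ∀ X,
      fderiv ℝ (fun y => ofRealVec (ρ y)) y X = ofRealVec (fderiv ℝ ρ y X) := fun hρ y hy X =>
    fderiv_continuousLinearMap_apply ofRealVec (differentiableAt_of_contDiffOn hU hρ.1 hy) X
  have hspan : ∀ y ∈ U, complexify (L y) =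
      Submodule.span ℂ {ofRealVec (σ y), ofRealVec (τ y)} := fun y hy => by
    rw [(hfr y hy).2, complexify_span_pair]
  have contact : ∀ {ρ : ℝ × ℝ → LieSpace}, IsSection L U ρ → ∀ X, ∀ l ∈ L x,
      lieInner (fderiv ℝ ρ x X) l = 0 := by
    intro ρ hρ X l hl
    rw [(hfr x hxU).2] at hl
    obtain ⟨a, b, rfl⟩ := Submodule.mem_span_pair.1 hl
    rw [lieInner_add_right, lieInner_smul_right, lieInner_smul_right,
      hL.contact U hUD hU ρ σ hρ hσ x hxU, hL.contact U hUD hU ρ τ hρ hτ x hxU]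
    simp
  have deriv_section : ∀ (U' : Set (ℝ × ℝ)) (V : ℝ × ℝ → CLieSpace), IsOpen U' → x ∈ U' →
      ContDiffOn ℝ ∞ V U' → (∀ y ∈ U', V y ∈ complexify (L y)) → ∀ c d : ℂ,
      V x = c • ofRealVec (σ x) + d • ofRealVec (τ x) → ∀ X,
      fderiv ℝ V x X - (c • ofRealVec (fderiv ℝ σ x X) + d • ofRealVec (fderiv ℝ τ x X)) ∈
        complexify (L x) := by
    intro U' V hU' hxU' hV hmem c d hcd X
    have := fderiv_section_sub_mem (hU.inter hU') ((cs hσ).mono Set.inter_subset_left)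
      ((cs hτ).mono Set.inter_subset_left) (hV.mono Set.inter_subset_right)
      (fun y hy => linearIndependent_ofRealVec (hfr y hy.1).1)
      (fun y hy => hspan y hy.1 ▸ hmem y hy.2) ⟨hxU, hxU'⟩ hcd X
    rwa [← hspan x hxU, dcs hσ x hxU, dcs hτ x hxU] at this
  have immersion : ∀ X, fderiv ℝ σ x X ∈ L x → fderiv ℝ τ x X ∈ L x → X = 0 := by
    intro X hσX hτX
    refine hL.immersion x hx X fun U' _ hU' hxU' ρ hρ => ?_
    have hρx := hρ.2 x hxU'
    rw [(hfr x hxU).2] at hρx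
    obtain ⟨a, b, hab⟩ := Submodule.mem_span_pair.1 hρx
    have := deriv_section U' (fun y => ofRealVec (ρ y)) hU' hxU'
      (ofRealVec.contDiff.comp_contDiffOn hρ.1)
      (fun y hy => ofRealVec_mem_complexify.2 (hρ.2 y hy)) a b
      (by rw [← hab, map_add, map_smul, map_smul, real_smul_eq_ofReal_smul,
        real_smul_eq_ofReal_smul]) X
    rw [fderiv_continuousLinearMap_apply ofRealVec (differentiableAt_of_contDiffOn hU' hρ.1 hxU')] at this
    rw [sub_mem_comm_iff, Submodule.sub_mem_iff_right _ (add_mem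
      (Submodule.smul_mem _ _ (ofRealVec_mem_complexify.2 hσX))
      (Submodule.smul_mem _ _ (ofRealVec_mem_complexify.2 hτX)))] at this
    exact ofRealVec_mem_complexify.1 this
  -- Differentiating `(dσ(X), τ) = 0` once more shows that `(dσ(X), dτ(X'))` is symmetric.
  have symm : ∀ X X', lieInner (fderiv ℝ σ x X) (fderiv ℝ τ x X') =
      lieInner (fderiv ℝ σ x X') (fderiv ℝ τ x X) := by
    intro X X'
    have key : ∀ X X', cInner (fderiv ℝ (fun y => fderiv ℝ (fun y => ofRealVec (σ y)) y X) x X')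
        (ofRealVec (τ x)) + (lieInner (fderiv ℝ σ x X) (fderiv ℝ τ x X') : ℂ) = 0 := by
      intro X X'
      have := cInner_fderiv_of_eq_zero hU (contDiffOn_fderiv_apply hU (cs hσ) X) (cs hτ)
        (fun y hy => by
          rw [dcs hσ y hy, cInner_ofRealVec, hL.contact U hUD hU σ τ hσ hτ y hy]; simp) hxU X'
      rwa [dcs hσ x hxU, dcs hτ x hxU, cInner_ofRealVec] at this
    have h1 := key X X'
    have h2 := key X' X
    rw [fderiv_fderiv_comm hU (cs hσ) hxU] at h1
    have h3 : (lieInner (fderiv ℝ σ x X) (fderiv ℝ τ x X') : ℂ) =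
      lieInner (fderiv ℝ σ x X') (fderiv ℝ τ x X) := by linear_combination h1 - h2
    exact_mod_cast h3
  refine ⟨fderiv ℝ σ x, fderiv ℝ τ x, X₁, X₂, hX₁, hX₂, h₁', h₂', immersion, contact hσ,
    contact hτ, fun X X' => ?_, deriv_section⟩
  obtain ⟨a, b, rfl⟩ := _root_.exists_coords (X₂ := X₂) hX₁ (fun c hc => hX₂ (immersion X₂
    (by rw [hc, map_smul]; exact Submodule.smul_mem _ _ h₁') h₂')) X
  rw [map_add, map_smul, map_smul, lieInner_add_left, lieInner_smul_left, lieInner_smul_left,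
    symm X₂, lieInner_comm (fderiv ℝ σ x X₁), contact hτ X' _ h₁', contact hσ X' _ h₂']
  simp

/-- The orthogonal complement of a contact element is positive semidefinite, and its null vectors
belong to the contact element. -/
lemma IsLegendreImmersion.mem_of_null {L : ℝ × ℝ → Submodule ℝ LieSpace} {D : Set (ℝ × ℝ)}
    (hL : IsLegendreImmersion L D) {x : ℝ × ℝ} (hx : x ∈ D) {w : LieSpace}
    (hw : ∀ l ∈ L x, lieInner w l = 0) :
    0 ≤ lieInner w w ∧ (lieInner w w = 0 → w ∈ L x) := by
  obtain ⟨U, hUD, hU, hxU, σ, τ, hσ, hτ, hfr⟩ := hL.smooth x hx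
  have hs := hσ.2 x hxU
  have ht := hτ.2 x hxU
  rw [(hfr x hxU).2]
  exact nonneg_of_orthogonal_null_plane (hfr x hxU).1 (hL.null x hx _ hs _ hs)
    (hL.null x hx _ hs _ ht) (hL.null x hx _ ht _ ht) (hw _ hs) (hw _ ht)

/-! ### The curvature frame of a channel Ω-patch -/

lemma exists_ne_zero_apply_eq_zero (φ : ℝ × ℝ →L[ℝ] ℝ) : ∃ X : ℝ × ℝ, X ≠ 0 ∧ φ X = 0 := by
  have hφ : ∀ X : ℝ × ℝ, φ X = X.1 * φ (1, 0) + X.2 * φ (0, 1) := fun X => by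
    have : X = X.1 • ((1, 0) : ℝ × ℝ) + X.2 • ((0, 1) : ℝ × ℝ) := by ext <;> simp
    conv_lhs => rw [this, map_add, map_smul, map_smul]
    simp
  by_cases h : φ (1, 0) = 0
  · exact ⟨(1, 0), by simp, h⟩
  · refine ⟨(φ (0, 1), -φ (1, 0)), fun h0 => h (by simpa using congrArg Prod.snd h0), ?_⟩
    rw [hφ]; simp; ring

/-- Locally, a channel surface envelops a smooth lift `w` of a sphere congruence that is constant in
some direction. -/
lemma IsChannel.exists_lift {L : ℝ × ℝ → Submodule ℝ LieSpace} {D : Set (ℝ × ℝ)}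
    (h : IsChannel L D) : ∃ s : ℝ × ℝ → Submodule ℝ LieSpace, (∀ x ∈ D, s x ≤ L x) ∧
      ∀ x ∈ D, ∃ U ⊆ D, IsOpen U ∧ x ∈ U ∧ ∃ w : ℝ × ℝ → LieSpace, ContDiffOn ℝ ∞ w U ∧
        (∀ y ∈ U, w y ≠ 0 ∧ s y = Submodule.span ℝ {w y}) ∧
        ∃ X : ℝ × ℝ, X ≠ 0 ∧ fderiv ℝ w x X = 0 := by
  obtain ⟨s, hs, h⟩ := h
  refine ⟨s, hs, fun x hx => ?_⟩
  obtain ⟨U, hUD, hU, hxU, t, T, γ, ht, hT, hm, hγ, hw⟩ := h x hx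
  obtain ⟨X, hX, hX0⟩ := exists_ne_zero_apply_eq_zero (fderiv ℝ t x)
  refine ⟨U, hUD, hU, hxU, γ ∘ t, hγ.comp ht hm, hw, X, hX, ?_⟩
  rw [fderiv_comp x (differentiableAt_of_contDiffOn hT hγ (hm hxU))
    (differentiableAt_of_contDiffOn hU ht hxU), ContinuousLinearMap.comp_apply, hX0, map_zero]

/-- A sphere congruence that is constant in some direction consists of curvature spheres. -/
lemma CurvatureData.eq_zero_or_eq_zero {L : ℝ × ℝ → Submodule ℝ LieSpace} {D : Set (ℝ × ℝ)}
    (hL : IsLegendreImmersion L D) {x : ℝ × ℝ} (hx : x ∈ D) {k₁ k₂ : LieSpace}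
    {T₁ T₂ : ℝ × ℝ →L[ℝ] LieSpace} {X₁ X₂ : ℝ × ℝ} (h : CurvatureData L x k₁ k₂ T₁ T₂ X₁ X₂)
    {α β : ℝ} {X : ℝ × ℝ} (hX : X ≠ 0) (hm : α • T₁ X + β • T₂ X ∈ L x) : α = 0 ∨ β = 0 := by
  obtain ⟨p, q, rfl⟩ := h.exists_coords X
  have n₁ : lieInner (T₁ X₂) (T₁ X₂) ≠ 0 := fun h0 => h.ne_zero₂ (h.immersion X₂
    ((hL.mem_of_null hx (h.contact₁ X₂)).2 h0) h.mem₂)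
  have n₂ : lieInner (T₂ X₁) (T₂ X₁) ≠ 0 := fun h0 => h.ne_zero₁ (h.immersion X₁ h.mem₁
    ((hL.mem_of_null hx (h.contact₂ X₁)).2 h0))
  have e1 := h.contact₁ X₂ _ hm
  have e2 := h.contact₂ X₁ _ hm
  simp only [map_add, map_smul, lieInner_add_right, lieInner_smul_right, h.orth,
    lieInner_comm (T₂ X₁) (T₁ _), h.contact₁ X₂ _ h.mem₁, h.contact₂ X₁ _ h.mem₂, mul_zero,
    add_zero, zero_add, mul_eq_zero, n₁, n₂, or_false] at e1 e2
  by_contra! hcon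
  exact hX (by rw [e1.resolve_left hcon.1, e2.resolve_left hcon.2]; simp)

lemma IsLegendreImmersion.eq_span {L : ℝ × ℝ → Submodule ℝ LieSpace} {D : Set (ℝ × ℝ)}
    (hL : IsLegendreImmersion L D) {x : ℝ × ℝ} (hx : x ∈ D) {k₁ k₂ : LieSpace} (h₁ : k₁ ∈ L x)
    (h₂ : k₂ ∈ L x) (hk : LinearIndependent ℝ ![k₁, k₂]) : L x = Submodule.span ℝ {k₁, k₂} := by
  obtain ⟨V, -, -, hxV, σ, τ, -, -, hfr⟩ := hL.smooth x hx
  rw [(hfr x hxV).2] at h₁ h₂ ⊢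
  exact span_pair_eq_of_linearIndependent hk h₁ h₂

lemma SeparateHarmonically.symm {m m' : CLieSpace} {k₁ k₂ : LieSpace}
    (h : SeparateHarmonically m m' k₁ k₂) : SeparateHarmonically m m' k₂ k₁ := by
  obtain ⟨a, b, c, d, h1, h2, h3, h4⟩ := h
  refine ⟨b, a, d, c, fun i => by rw [h1, add_comm], fun i => by rw [h2, add_comm], ?_, ?_⟩
  · intro h0; exact h3 (by linear_combination -h0)
  · linear_combination h4

/-- Harmonic separation makes the coefficient vectors of `m` and `m'` with respect to the curvature
spheres `(a, b)` and `(G a, -G b)`. -/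
lemma SeparateHarmonically.exists_factor {m m' : CLieSpace} {k₁ k₂ : LieSpace}
    (h : SeparateHarmonically m m' k₁ k₂) : ∃ a b G : ℂ, a ≠ 0 ∧ b ≠ 0 ∧ G ≠ 0 ∧
      m = a • ofRealVec k₁ + b • ofRealVec k₂ ∧
      m' = G • a • ofRealVec k₁ - G • b • ofRealVec k₂ := by
  obtain ⟨a, b, c, d, h1, h2, h3, h4⟩ := h
  have ha : a ≠ 0 := by rintro rfl; exact h3 (by linear_combination -h4)
  have hb : b ≠ 0 := by rintro rfl; exact h3 (by linear_combination h4)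
  have hc : c ≠ 0 := by rintro rfl; exact h3 (by linear_combination h4)
  refine ⟨a, b, c / a, ha, hb, div_ne_zero hc ha, ?_, ?_⟩
  · ext i; simp [h1]
  · have hd : d = -(c / a * b) := by field_simp; linear_combination h4
    ext i
    simp [h2, hd]
    field_simp
    ring

/-- Pointwise, the channel congruence is one of the curvature sphere congruences. -/
lemma exists_adapted_curvatureSpheres {L : ℝ × ℝ → Submodule ℝ LieSpace} {D : Set (ℝ × ℝ)}
    (hL : IsLegendreImmersion L D) {s : ℝ × ℝ → Submodule ℝ LieSpace}
    (hs : ∀ x ∈ D, s x ≤ L x) {x : ℝ × ℝ} (hx : x ∈ D)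
    (hlift : ∃ U ⊆ D, IsOpen U ∧ x ∈ U ∧ ∃ w : ℝ × ℝ → LieSpace, ContDiffOn ℝ ∞ w U ∧
        (∀ y ∈ U, w y ≠ 0 ∧ s y = Submodule.span ℝ {w y}) ∧
        ∃ X : ℝ × ℝ, X ≠ 0 ∧ fderiv ℝ w x X = 0) {m m' : CLieSpace}
    (h : ∃ k₁ k₂ : LieSpace, IsCurvatureSphere L x k₁ ∧ IsCurvatureSphere L x k₂ ∧
      LinearIndependent ℝ ![k₁, k₂] ∧ SeparateHarmonically m m' k₁ k₂) :
    ∃ k₁ k₂ : LieSpace, IsCurvatureSphere L x k₁ ∧ IsCurvatureSphere L x k₂ ∧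
      LinearIndependent ℝ ![k₁, k₂] ∧ SeparateHarmonically m m' k₁ k₂ ∧ k₁ ∈ s x := by
  obtain ⟨k₁, k₂, h₁, h₂, hk, hsep⟩ := h
  obtain ⟨U, hUD, hU, hxU, w, hw, hws, X, hX, hwX⟩ := hlift
  have hwL : ∀ y ∈ U, w y ∈ L y := fun y hy => hs y (hUD hy) (by
    rw [(hws y hy).2]; exact Submodule.mem_span_singleton_self _)
  obtain ⟨T₁, T₂, X₁, X₂, hT⟩ := hL.exists_curvatureData hx h₁ h₂ hk
  have hspan := hL.eq_span hx h₁.1 h₂.1 hk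
  have hwx := hwL x hxU
  rw [hspan] at hwx
  obtain ⟨α, β, hαβ⟩ := Submodule.mem_span_pair.1 hwx
  have hmem := hT.deriv_section U (fun y => ofRealVec (w y)) hU hxU
    (ofRealVec.contDiff.comp_contDiffOn hw)
    (fun y hy => ofRealVec_mem_complexify.2 (hwL y hy)) α β
    (by rw [← hαβ, map_add, map_smul, map_smul, real_smul_eq_ofReal_smul,
        real_smul_eq_ofReal_smul]) X
  rw [fderiv_continuousLinearMap_apply ofRealVec (differentiableAt_of_contDiffOn hU hw hxU), hwX,
    map_zero, zero_sub, Submodule.neg_mem_iff, ← real_smul_eq_ofReal_smul,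
    ← real_smul_eq_ofReal_smul, ← map_smul ofRealVec α, ← map_smul ofRealVec β,
    ← map_add, ofRealVec_mem_complexify] at hmem
  have hw0 := (hws x hxU).1
  have hsx := (hws x hxU).2
  rcases hT.eq_zero_or_eq_zero hL hx hX hmem with rfl | rfl
  · rw [zero_smul, zero_add] at hαβ
    have hβ : β ≠ 0 := by rintro rfl; exact hw0 (by rw [← hαβ, zero_smul])
    refine ⟨k₂, k₁, h₂, h₁, LinearIndependent.pair_symm_iff.1 hk, hsep.symm, ?_⟩
    rw [hsx, ← hαβ, Submodule.mem_span_singleton]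
    exact ⟨β⁻¹, by rw [smul_smul, inv_mul_cancel₀ hβ, one_smul]⟩
  · rw [zero_smul, add_zero] at hαβ
    have hα : α ≠ 0 := by rintro rfl; exact hw0 (by rw [← hαβ, zero_smul])
    refine ⟨k₁, k₂, h₁, h₂, hk, hsep, ?_⟩
    rw [hsx, ← hαβ, Submodule.mem_span_singleton]
    exact ⟨α⁻¹, by rw [smul_smul, inv_mul_cancel₀ hα, one_smul]⟩

/-- Write `m = Y + Z` and `m' = G (Y - Z)` with multiples `Y`, `Z` of the curvature spheres; this is
possible by harmonic separation. The function `G` is smooth, since it is determined by the position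
of the smooth channel congruence `⟨Y⟩` with respect to `m` and `m'`. -/
lemma contDiffOn_factor {m m' Y Z : ℝ × ℝ → CLieSpace} {G : ℝ × ℝ → ℂ} {W : Set (ℝ × ℝ)}
    (hm : ContDiffOn ℝ ∞ m W) (hm' : ContDiffOn ℝ ∞ m' W)
    (hG : ∀ x ∈ W, G x ≠ 0) (hind : ∀ x ∈ W, LinearIndependent ℂ ![Y x, Z x])
    (h : ∀ x ∈ W, m x = Y x + Z x) (h' : ∀ x ∈ W, m' x = G x • Y x - G x • Z x)
    (hs : ∀ x ∈ W, ∃ U ⊆ W, IsOpen U ∧ x ∈ U ∧ ∃ w : ℝ × ℝ → CLieSpace, ContDiffOn ℝ ∞ w U ∧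
      ∀ y ∈ U, w y ≠ 0 ∧ w y ∈ Submodule.span ℂ {Y y}) : ContDiffOn ℝ ∞ G W := by
  intro x hx
  obtain ⟨U, hUW, hU, hxU, w, hw, hwY⟩ := hs x hx
  have hex : ∀ y, ∃ r : ℂ, y ∈ U → r ≠ 0 ∧ w y = r • Y y := by
    intro y
    by_cases hy : y ∈ U
    · obtain ⟨r, hr⟩ := Submodule.mem_span_singleton.1 (hwY y hy).2
      refine ⟨r, fun _ => ⟨?_, hr.symm⟩⟩
      rintro rfl
      exact (hwY y hy).1 (by rw [← hr, zero_smul])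
    · exact ⟨0, fun h => absurd h hy⟩
  choose r hr using hex
  have hind' : ∀ y ∈ U, LinearIndependent ℂ ![m y, m' y] := fun y hy => by
    have := (LinearIndependent.pair_add_smul_add_smul_iff (R := ℂ) 1 1 (G y) (-G y)).2
      ⟨hind y (hUW hy), fun h0 => hG y (hUW hy) (by linear_combination -h0 / 2)⟩
    rwa [one_smul, one_smul, neg_smul, ← sub_eq_add_neg, ← h y (hUW hy), ← h' y (hUW hy)] at this
  obtain ⟨h1, h2⟩ := contDiffOn_coeff hU (hm.mono hUW) (hm'.mono hUW) hw hind'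
    (α := fun y => r y / 2) (β := fun y => r y / 2 * (G y)⁻¹) (fun y hy => by
      rw [(hr y hy).2, h y (hUW hy), h' y (hUW hy)]
      have hGy := hG y (hUW hy)
      match_scalars <;> field_simp <;> ring)
  have h3 : ContDiffAt ℝ ∞ (fun y => (r y / 2) * (r y / 2 * (G y)⁻¹)⁻¹) x :=
    (h1.contDiffAt (hU.mem_nhds hxU)).mul ((h2.contDiffAt (hU.mem_nhds hxU)).inv
      (mul_ne_zero (div_ne_zero (hr x hxU).1 two_ne_zero) (inv_ne_zero (hG x hx))))
  refine (h3.congr_of_eventuallyEq ?_).contDiffWithinAt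
  filter_upwards [hU.mem_nhds hxU] with y hy
  have := (hr y hy).1
  have hGy := hG y (hUW hy)
  field_simp

/-- Smooth multiples of the two curvature spheres of a Legendre immersion form a curvature frame if
the first curvature sphere congruence is a channel congruence. -/
lemma IsLegendreImmersion.curvatureFrame {L : ℝ × ℝ → Submodule ℝ LieSpace} {D W : Set (ℝ × ℝ)}
    (hL : IsLegendreImmersion L D) (hW : IsOpen W) (hWD : W ⊆ D) {Y Z : ℝ × ℝ → CLieSpace}
    (hY : ContDiffOn ℝ ∞ Y W) (hZ : ContDiffOn ℝ ∞ Z W)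
    (h : ∀ x ∈ W, ∃ (k₁ k₂ : LieSpace) (a b : ℂ), IsCurvatureSphere L x k₁ ∧
      IsCurvatureSphere L x k₂ ∧ LinearIndependent ℝ ![k₁, k₂] ∧ a ≠ 0 ∧ b ≠ 0 ∧
      Y x = a • ofRealVec k₁ ∧ Z x = b • ofRealVec k₂)
    (hs : ∀ x ∈ W, ∃ U ⊆ W, IsOpen U ∧ x ∈ U ∧ ∃ w : ℝ × ℝ → CLieSpace, ContDiffOn ℝ ∞ w U ∧
      (∀ y ∈ U, w y ≠ 0 ∧ w y ∈ Submodule.span ℂ {Y y}) ∧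
      ∃ X : ℝ × ℝ, X ≠ 0 ∧ fderiv ℝ w x X = 0) : CurvatureFrame Y Z W := by
  have hYL : ∀ x ∈ W, Y x ∈ complexify (L x) := fun x hx => by
    obtain ⟨k₁, k₂, a, b, h₁, h₂, hk, ha, hb, hYx, hZx⟩ := h x hx
    rw [hYx]
    exact Submodule.smul_mem _ _ (ofRealVec_mem_complexify.2 h₁.1)
  have hZL : ∀ x ∈ W, Z x ∈ complexify (L x) := fun x hx => by
    obtain ⟨k₁, k₂, a, b, h₁, h₂, hk, ha, hb, hYx, hZx⟩ := h x hx
    rw [hZx]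
    exact Submodule.smul_mem _ _ (ofRealVec_mem_complexify.2 h₂.1)
  have indep : ∀ x ∈ W, LinearIndependent ℂ ![Y x, Z x] := fun x hx => by
    obtain ⟨k₁, k₂, a, b, h₁, h₂, hk, ha, hb, hYx, hZx⟩ := h x hx
    rw [hYx, hZx]
    exact (LinearIndependent.pair_smul_smul_iff ha.isUnit hb.isUnit).2
      (linearIndependent_ofRealVec hk)
  have hspan : ∀ x ∈ W, Submodule.span ℂ {Y x, Z x} = complexify (L x) := fun x hx => by
    obtain ⟨k₁, k₂, a, b, h₁, h₂, hk, ha, hb, hYx, hZx⟩ := h x hx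
    have hLx := hL.eq_span (hWD hx) h₁.1 h₂.1 hk
    have e1 := hYL x hx
    have e2 := hZL x hx
    rw [hLx, complexify_span_pair] at e1 e2 ⊢
    exact (span_pair_eq_of_linearIndependent (indep x hx) e1 e2).symm
  -- Modulo the contact element, the derivatives are multiples of real vectors orthogonal to it.
  have deriv : ∀ x ∈ W, ∃ (T₁ T₂ : ℝ × ℝ →L[ℝ] LieSpace) (X₂ : ℝ × ℝ) (a b : ℂ), a ≠ 0 ∧ b ≠ 0 ∧
      X₂ ≠ 0 ∧ T₂ X₂ ∈ L x ∧ (∀ X, T₁ X ∈ L x → T₂ X ∈ L x → X = 0) ∧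
      (∀ X, ∀ l ∈ L x, lieInner (T₁ X) l = 0) ∧ (∀ X, ∀ l ∈ L x, lieInner (T₂ X) l = 0) ∧
      (∀ X, ∃ l ∈ complexify (L x), fderiv ℝ Y x X = a • ofRealVec (T₁ X) + l) ∧
      (∀ X, ∃ l ∈ complexify (L x), fderiv ℝ Z x X = b • ofRealVec (T₂ X) + l) := by
    intro x hx
    obtain ⟨k₁, k₂, a, b, h₁, h₂, hk, ha, hb, hYx, hZx⟩ := h x hx
    obtain ⟨T₁, T₂, X₁, X₂, hT⟩ := hL.exists_curvatureData (hWD hx) h₁ h₂ hk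
    refine ⟨T₁, T₂, X₂, a, b, ha, hb, hT.ne_zero₂, hT.mem₂, hT.immersion, hT.contact₁,
      hT.contact₂, fun X => ⟨_, hT.deriv_section W Y hW hx hY hYL a 0 (by rw [hYx]; simp) X, ?_⟩,
      fun X => ⟨_, hT.deriv_section W Z hW hx hZ hZL 0 b (by rw [hZx]; simp) X, ?_⟩⟩
    · simp
    · simp
  have null : ∀ x ∈ W, ∀ z ∈ complexify (L x), ∀ w ∈ complexify (L x), cInner z w = 0 :=
    fun x hx z hz w hw => cInner_eq_zero_of_mem_complexify (hL.null x (hWD hx)) hz hw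
  have orth : ∀ x ∈ W, ∀ v : LieSpace, (∀ l ∈ L x, lieInner v l = 0) →
      ∀ z ∈ complexify (L x), cInner (ofRealVec v) z = 0 := fun x hx v hv z hz => by
    rw [cInner_eq, reVec_ofRealVec, imVec_ofRealVec, hv _ hz.1, hv _ hz.2]
    simp [lieInner_zero_left]
  have mem : ∀ (x : ℝ × ℝ) (c : ℂ) (v : LieSpace) (l : CLieSpace), c ≠ 0 → l ∈ complexify (L x) →
      (c • ofRealVec v + l ∈ complexify (L x) ↔ v ∈ L x) := fun x c v l hc hl => by
    rw [Submodule.add_mem_iff_left _ hl, Submodule.smul_mem_iff _ hc, ofRealVec_mem_complexify]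
  have isotropic : ∀ x ∈ W, ∀ (c : ℂ) (v : LieSpace) (l : CLieSpace), c ≠ 0 →
      (∀ l ∈ L x, lieInner v l = 0) → l ∈ complexify (L x) →
      cInner (c • ofRealVec v + l) (c • ofRealVec v + l) = 0 → v ∈ L x := by
    intro x hx c v l hc hv hl h0
    rw [cInner_add_left, cInner_add_right, cInner_add_right, null x hx l hl l hl, cInner_comm l,
      cInner_smul_left, cInner_smul_left, orth x hx v hv l hl, cInner_smul_right,
      cInner_ofRealVec] at h0
    exact (hL.mem_of_null (hWD hx) hv).2 (by simpa [hc] using h0)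
  exact
  { smooth_Y := hY
    smooth_Z := hZ
    indep := indep
    inner_YY := fun x hx => null x hx _ (hYL x hx) _ (hYL x hx)
    inner_YZ := fun x hx => null x hx _ (hYL x hx) _ (hZL x hx)
    inner_ZZ := fun x hx => null x hx _ (hZL x hx) _ (hZL x hx)
    contact_Y := fun x hx X => by
      obtain ⟨T₁, T₂, X₂, a, b, ha, hb, hX₂, hm, hi, hc₁, hc₂, hd₁, hd₂⟩ := deriv x hx
      obtain ⟨l, hl, e⟩ := hd₁ X
      rw [e, cInner_add_left, cInner_smul_left, orth x hx _ (hc₁ X) _ (hZL x hx),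
        null x hx _ hl _ (hZL x hx)]
      simp
    contact_Z := fun x hx X => by
      obtain ⟨T₁, T₂, X₂, a, b, ha, hb, hX₂, hm, hi, hc₁, hc₂, hd₁, hd₂⟩ := deriv x hx
      obtain ⟨l, hl, e⟩ := hd₂ X
      rw [e, cInner_add_left, cInner_smul_left, orth x hx _ (hc₂ X) _ (hYL x hx),
        null x hx _ hl _ (hYL x hx)]
      simp
    immersion := fun x hx X h1 h2 => by
      obtain ⟨T₁, T₂, X₂, a, b, ha, hb, hX₂, hm, hi, hc₁, hc₂, hd₁, hd₂⟩ := deriv x hx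
      obtain ⟨l, hl, e⟩ := hd₁ X
      obtain ⟨l', hl', e'⟩ := hd₂ X
      rw [hspan x hx, e, mem x a _ l ha hl] at h1
      rw [hspan x hx, e', mem x b _ l' hb hl'] at h2
      exact hi X h1 h2
    null_Y := fun x hx X h0 => by
      obtain ⟨T₁, T₂, X₂, a, b, ha, hb, hX₂, hm, hi, hc₁, hc₂, hd₁, hd₂⟩ := deriv x hx
      obtain ⟨l, hl, e⟩ := hd₁ X
      rw [e] at h0
      rw [hspan x hx, e, mem x a _ l ha hl]
      exact isotropic x hx a _ l ha (hc₁ X) hl h0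
    null_Z := fun x hx X h0 => by
      obtain ⟨T₁, T₂, X₂, a, b, ha, hb, hX₂, hm, hi, hc₁, hc₂, hd₁, hd₂⟩ := deriv x hx
      obtain ⟨l, hl, e⟩ := hd₂ X
      rw [e] at h0
      rw [hspan x hx, e, mem x b _ l hb hl]
      exact isotropic x hx b _ l hb (hc₂ X) hl h0
    dir_Y := fun x hx => by
      obtain ⟨U, hUW, hU, hxU, w, hw, hwY, X, hX, hwX⟩ := hs x hx
      refine ⟨X, hX, ?_⟩
      have hex : ∀ y, ∃ r : ℂ, y ∈ U → w y = r • Y y := by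
        intro y
        by_cases hy : y ∈ U
        · obtain ⟨r, hr⟩ := Submodule.mem_span_singleton.1 (hwY y hy).2
          exact ⟨r, fun _ => hr.symm⟩
        · exact ⟨0, fun h => absurd h hy⟩
      choose r hr using hex
      have hrs := (contDiffOn_coeff hU (hY.mono hUW) (hZ.mono hUW) hw
        (fun y hy => indep y (hUW hy)) (α := r) (β := fun _ => 0)
        (fun y hy => by rw [hr y hy]; simp)).1
      rw [fderiv_eq_of_eqOn hU hr hxU, fderiv_complex_smul (differentiableAt_of_contDiffOn hU hrs hxU)
        (differentiableAt_of_contDiffOn hW hY hx)] at hwX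
      have hr0 : r x ≠ 0 := fun h0 => (hwY x hxU).1 (by rw [hr x hxU, h0, zero_smul])
      rw [← Submodule.smul_mem_iff _ hr0, eq_neg_of_add_eq_zero_right hwX]
      exact neg_mem (Submodule.smul_mem _ _ (Submodule.mem_span_singleton_self _))
    dir_Z := fun x hx => by
      obtain ⟨T₁, T₂, X₂, a, b, ha, hb, hX₂, hm, hi, hc₁, hc₂, hd₁, hd₂⟩ := deriv x hx
      obtain ⟨l, hl, e⟩ := hd₂ X₂
      refine ⟨X₂, hX₂, ?_⟩
      rw [hspan x hx, e, mem x b _ l hb hl]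
      exact hm }

/-- On a channel Ω-patch, the isothermic congruences are `m = Y + Z` and `m' = G (Y - Z)` with
a curvature frame `Y`, `Z` and a smooth function `G`. -/
lemma exists_curvatureFrame {L : ℝ × ℝ → Submodule ℝ LieSpace} {D W : Set (ℝ × ℝ)}
    (hL : IsLegendreImmersion L D) (hchannel : IsChannel L D) (hW : IsOpen W) (hWD : W ⊆ D)
    {m m' : ℝ × ℝ → CLieSpace} (hm : ContDiffOn ℝ ∞ m W) (hm' : ContDiffOn ℝ ∞ m' W)
    (hsep : ∀ x ∈ W, ∃ k₁ k₂ : LieSpace, IsCurvatureSphere L x k₁ ∧ IsCurvatureSphere L x k₂ ∧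
      LinearIndependent ℝ ![k₁, k₂] ∧ SeparateHarmonically (m x) (m' x) k₁ k₂) :
    ∃ (Y Z : ℝ × ℝ → CLieSpace) (G : ℝ × ℝ → ℂ), CurvatureFrame Y Z W ∧ ContDiffOn ℝ ∞ G W ∧
      (∀ x ∈ W, G x ≠ 0) ∧ (∀ x ∈ W, m x = Y x + Z x) ∧
      (∀ x ∈ W, m' x = G x • Y x - G x • Z x) ∧
      ∀ x ∈ W, ∃ (k₁ k₂ : LieSpace) (a b : ℂ), IsCurvatureSphere L x k₁ ∧
        IsCurvatureSphere L x k₂ ∧ LinearIndependent ℝ ![k₁, k₂] ∧ a ≠ 0 ∧ b ≠ 0 ∧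
        Y x = a • ofRealVec k₁ ∧ Z x = b • ofRealVec k₂ := by
  obtain ⟨s, hs, hlift⟩ := hchannel.exists_lift
  have hex : ∀ x, ∃ (k₁ k₂ : LieSpace) (a b G : ℂ), x ∈ W → IsCurvatureSphere L x k₁ ∧
      IsCurvatureSphere L x k₂ ∧ LinearIndependent ℝ ![k₁, k₂] ∧ a ≠ 0 ∧ b ≠ 0 ∧ G ≠ 0 ∧
      m x = a • ofRealVec k₁ + b • ofRealVec k₂ ∧
      m' x = G • a • ofRealVec k₁ - G • b • ofRealVec k₂ ∧ k₁ ∈ s x := by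
    intro x
    by_cases hx : x ∈ W
    · obtain ⟨k₁, k₂, h₁, h₂, hk, hsep, hks⟩ :=
        exists_adapted_curvatureSpheres hL hs (hWD hx) (hlift x (hWD hx)) (hsep x hx)
      obtain ⟨a, b, G, ha, hb, hG, e1, e2⟩ := hsep.exists_factor
      exact ⟨k₁, k₂, a, b, G, fun _ => ⟨h₁, h₂, hk, ha, hb, hG, e1, e2, hks⟩⟩
    · exact ⟨0, 0, 0, 0, 0, fun h => absurd h hx⟩
  choose k₁ k₂ a b G h using hex
  have hG0 : ∀ x ∈ W, G x ≠ 0 := fun x hx => (h x hx).2.2.2.2.2.1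
  have e1 : ∀ x ∈ W, m x = a x • ofRealVec (k₁ x) + b x • ofRealVec (k₂ x) :=
    fun x hx => (h x hx).2.2.2.2.2.2.1
  have e2 : ∀ x ∈ W, m' x = G x • a x • ofRealVec (k₁ x) - G x • b x • ofRealVec (k₂ x) :=
    fun x hx => (h x hx).2.2.2.2.2.2.2.1
  have hY : ∀ x ∈ W, (2⁻¹ : ℂ) • (m x + (G x)⁻¹ • m' x) = a x • ofRealVec (k₁ x) :=
    fun x hx => by
      have := hG0 x hx
      rw [e1 x hx, e2 x hx]
      match_scalars <;> field_simp <;> ring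
  have hZ : ∀ x ∈ W, (2⁻¹ : ℂ) • (m x - (G x)⁻¹ • m' x) = b x • ofRealVec (k₂ x) :=
    fun x hx => by
      have := hG0 x hx
      rw [e1 x hx, e2 x hx]
      match_scalars <;> field_simp <;> ring
  have hlift' : ∀ x ∈ W, ∃ U ⊆ W, IsOpen U ∧ x ∈ U ∧ ∃ w : ℝ × ℝ → CLieSpace,
      ContDiffOn ℝ ∞ w U ∧ (∀ y ∈ U, w y ≠ 0 ∧ w y ∈ Submodule.span ℂ
        {a y • ofRealVec (k₁ y)}) ∧ ∃ X : ℝ × ℝ, X ≠ 0 ∧ fderiv ℝ w x X = 0 := by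
    intro x hx
    obtain ⟨U, -, hU, hxU, w, hw, hws, X, hX, hwX⟩ := hlift x (hWD hx)
    refine ⟨U ∩ W, Set.inter_subset_right, hU.inter hW, ⟨hxU, hx⟩, fun y => ofRealVec (w y),
      (ofRealVec.contDiff.comp_contDiffOn hw).mono Set.inter_subset_left, fun y hy => ⟨?_, ?_⟩,
      X, hX, ?_⟩
    · intro (h0 : ofRealVec (w y) = 0)
      exact (hws y hy.1).1 (by rw [← reVec_ofRealVec (w y), h0, map_zero])
    · have hk := (h y hy.2).2.2.2.2.2.2.2.2
      rw [(hws y hy.1).2] at hk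
      obtain ⟨r, hr⟩ := Submodule.mem_span_singleton.1 hk
      have hr0 : r ≠ 0 := by
        rintro rfl
        exact (h y hy.2).1.2.1 (by rw [← hr, zero_smul])
      refine Submodule.mem_span_singleton.2 ⟨(r : ℂ)⁻¹ * (a y)⁻¹, ?_⟩
      have ha := (h y hy.2).2.2.2.1
      rw [← hr, map_smul, real_smul_eq_ofReal_smul, smul_smul, smul_smul]
      have hr0' : (r : ℂ) ≠ 0 := by exact_mod_cast hr0
      rw [show (r : ℂ)⁻¹ * (a y)⁻¹ * a y * r = 1 by field_simp, one_smul]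
    · rw [fderiv_continuousLinearMap_apply ofRealVec (differentiableAt_of_contDiffOn hU hw hxU), hwX,
        map_zero]
  have hG : ContDiffOn ℝ ∞ G W := contDiffOn_factor (Y := fun x => a x • ofRealVec (k₁ x))
    (Z := fun x => b x • ofRealVec (k₂ x)) hm hm' hG0
    (fun x hx => (LinearIndependent.pair_smul_smul_iff (h x hx).2.2.2.1.isUnit
      (h x hx).2.2.2.2.1.isUnit).2 (linearIndependent_ofRealVec (h x hx).2.2.1)) e1 e2
    (fun x hx => by
      obtain ⟨U, hUW, hU, hxU, w, hw, hws, -⟩ := hlift' x hx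
      exact ⟨U, hUW, hU, hxU, w, hw, hws⟩)
  have hGinv : ContDiffOn ℝ ∞ (fun x => (G x)⁻¹) W := fun x hx =>
    (((hG.contDiffAt (hW.mem_nhds hx)).inv (hG0 x hx))).contDiffWithinAt
  have hform : ∀ x ∈ W, ∃ (k₁ k₂ : LieSpace) (α β : ℂ), IsCurvatureSphere L x k₁ ∧
      IsCurvatureSphere L x k₂ ∧ LinearIndependent ℝ ![k₁, k₂] ∧ α ≠ 0 ∧ β ≠ 0 ∧
      (2⁻¹ : ℂ) • (m x + (G x)⁻¹ • m' x) = α • ofRealVec k₁ ∧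
      (2⁻¹ : ℂ) • (m x - (G x)⁻¹ • m' x) = β • ofRealVec k₂ := fun x hx =>
    ⟨k₁ x, k₂ x, a x, b x, (h x hx).1, (h x hx).2.1, (h x hx).2.2.1, (h x hx).2.2.2.1,
      (h x hx).2.2.2.2.1, hY x hx, hZ x hx⟩
  refine ⟨fun x => (2⁻¹ : ℂ) • (m x + (G x)⁻¹ • m' x), fun x => (2⁻¹ : ℂ) • (m x - (G x)⁻¹ • m' x),
    G, hL.curvatureFrame hW hWD ((hm.add (hGinv.smul hm')).const_smul _)
      ((hm.sub (hGinv.smul hm')).const_smul _) hform ?_, hG, hG0, ?_, ?_, hform⟩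
  · intro x hx
    obtain ⟨U, hUW, hU, hxU, w, hw, hws, X⟩ := hlift' x hx
    exact ⟨U, hUW, hU, hxU, w, hw, fun y hy => by
      simp only [hY y (hUW hy)]
      exact hws y hy, X⟩
  · intro x hx
    simp only [hY x hx, hZ x hx]
    exact e1 x hx
  · intro x hx
    simp only [hY x hx, hZ x hx]
    exact e2 x hx

/-! ### Separation of variables -/

section Separation

variable {F : Type*} [NormedAddCommGroup F] [NormedSpace ℝ F] {I J : Set ℝ}

lemma hasDerivAt_fst {f : ℝ × ℝ → F} {u v : ℝ} (hf : DifferentiableAt ℝ f (u, v)) :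
    HasDerivAt (fun s => f (s, v)) (fderiv ℝ f (u, v) (1, 0)) u :=
  hf.hasFDerivAt.comp_hasDerivAt u ((hasDerivAt_id u).prodMk (hasDerivAt_const u v))

lemma hasDerivAt_snd {f : ℝ × ℝ → F} {u v : ℝ} (hf : DifferentiableAt ℝ f (u, v)) :
    HasDerivAt (fun s => f (u, s)) (fderiv ℝ f (u, v) (0, 1)) v :=
  hf.hasFDerivAt.comp_hasDerivAt v ((hasDerivAt_const v u).prodMk (hasDerivAt_id v))

lemma eq_of_fderiv_fst_eq_zero (hI : IsOpen I) (hIc : I.OrdConnected) (hJ : IsOpen J)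
    {f : ℝ × ℝ → F} (hf : ContDiffOn ℝ ∞ f (I ×ˢ J))
    (h : ∀ w ∈ I ×ˢ J, fderiv ℝ f w (1, 0) = 0) {u u' v : ℝ} (hu : u ∈ I) (hu' : u' ∈ I)
    (hv : v ∈ J) : f (u, v) = f (u', v) := by
  have hd : ∀ s ∈ I, HasDerivAt (fun s => f (s, v)) 0 s := fun s hs => by
    have := hasDerivAt_fst (differentiableAt_of_contDiffOn (hI.prod hJ) hf
      (show (s, v) ∈ I ×ˢ J from ⟨hs, hv⟩))
    rwa [h _ ⟨hs, hv⟩] at this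
  exact hI.is_const_of_deriv_eq_zero hIc.isPreconnected
    (fun s hs => (hd s hs).differentiableAt.differentiableWithinAt) (fun s hs => (hd s hs).deriv)
    hu hu'

lemma eq_of_fderiv_snd_eq_zero (hI : IsOpen I) (hJ : IsOpen J) (hJc : J.OrdConnected)
    {f : ℝ × ℝ → F} (hf : ContDiffOn ℝ ∞ f (I ×ˢ J))
    (h : ∀ w ∈ I ×ˢ J, fderiv ℝ f w (0, 1) = 0) {u v v' : ℝ} (hu : u ∈ I) (hv : v ∈ J)
    (hv' : v' ∈ J) : f (u, v) = f (u, v') := by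
  have hd : ∀ s ∈ J, HasDerivAt (fun s => f (u, s)) 0 s := fun s hs => by
    have := hasDerivAt_snd (differentiableAt_of_contDiffOn (hI.prod hJ) hf
      (show (u, s) ∈ I ×ˢ J from ⟨hu, hs⟩))
    rwa [h _ ⟨hu, hs⟩] at this
  exact hJ.is_const_of_deriv_eq_zero hJc.isPreconnected
    (fun s hs => (hd s hs).differentiableAt.differentiableWithinAt) (fun s hs => (hd s hs).deriv)
    hv hv'

/-- A function on a rectangle with vanishing mixed derivative is a sum of functions of one
variable. -/
lemma eq_add_sub_of_mixed_eq_zero (hI : IsOpen I) (hIc : I.OrdConnected) (hJ : IsOpen J)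
    (hJc : J.OrdConnected) {f : ℝ × ℝ → F} (hf : ContDiffOn ℝ ∞ f (I ×ˢ J))
    (h : ∀ w ∈ I ×ˢ J, fderiv ℝ (fun z => fderiv ℝ f z (0, 1)) w (1, 0) = 0) {u u₀ v v₀ : ℝ}
    (hu : u ∈ I) (hu₀ : u₀ ∈ I) (hv : v ∈ J) (hv₀ : v₀ ∈ J) :
    f (u, v) = f (u, v₀) + (f (u₀, v) - f (u₀, v₀)) := by
  have hR := hI.prod hJ
  have hdiff : ∀ s ∈ I, ∀ t ∈ J, DifferentiableAt ℝ f (s, t) := fun s hs t ht =>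
    differentiableAt_of_contDiffOn hR hf ⟨hs, ht⟩
  have hfu : ∀ s ∈ I, fderiv ℝ f (s, v) (1, 0) = fderiv ℝ f (s, v₀) (1, 0) := fun s hs =>
    eq_of_fderiv_snd_eq_zero hI hJ hJc (f := fun z => fderiv ℝ f z (1, 0))
      (contDiffOn_fderiv_apply hR hf (1, 0)) (fun w hw => by
        rw [fderiv_fderiv_comm hR hf hw]; exact h w hw) hs hv hv₀
  have hd : ∀ s ∈ I, HasDerivAt (fun s => f (s, v) - f (s, v₀)) 0 s := fun s hs => by
    have := (hasDerivAt_fst (hdiff s hs v hv)).sub (hasDerivAt_fst (hdiff s hs v₀ hv₀))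
    rwa [hfu s hs, sub_self] at this
  have := hI.is_const_of_deriv_eq_zero hIc.isPreconnected
    (fun s hs => (hd s hs).differentiableAt.differentiableWithinAt) (fun s hs => (hd s hs).deriv)
    hu hu₀
  rw [← sub_eq_iff_eq_add']
  exact this

end Separation

lemma exists_channelNormalForm {I J : Set ℝ} (hI : IsOpen I) (hIc : I.OrdConnected) (hJ : IsOpen J)
    (hJc : J.OrdConnected) (hIn : I.Nonempty) (hJn : J.Nonempty) {y n : ℝ × ℝ → LieSpace}
    (hy : ContDiffOn ℝ ∞ y (I ×ˢ J)) (hn : ContDiffOn ℝ ∞ n (I ×ˢ J))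
    (hyy : ∀ w ∈ I ×ˢ J, lieInner (y w) (y w) = 0) (hyn : ∀ w ∈ I ×ˢ J, lieInner (y w) (n w) = 0)
    (hnn : ∀ w ∈ I ×ˢ J, lieInner (n w) (n w) = 0)
    (hind : ∀ w ∈ I ×ˢ J, LinearIndependent ℝ ![y w, n w])
    (hyu : ∀ w ∈ I ×ˢ J, fderiv ℝ y w (1, 0) = 0)
    (hnv : ∀ w ∈ I ×ˢ J, fderiv ℝ n w (0, 1) ∈ Submodule.span ℝ {y w})
    (hnvu : ∀ w ∈ I ×ˢ J, fderiv ℝ (fun z => fderiv ℝ n z (0, 1)) w (1, 0) = 0)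
    (hyv : ∀ w ∈ I ×ˢ J, 0 < lieInner (fderiv ℝ y w (0, 1)) (fderiv ℝ y w (0, 1)))
    (hnu : ∀ w ∈ I ×ˢ J, 0 < lieInner (fderiv ℝ n w (1, 0)) (fderiv ℝ n w (1, 0))) :
    ∃ (A B K : ℝ → LieSpace) (α : ℝ → ℝ), ChannelNormalForm I J A B K α ∧
      ∀ u ∈ I, ∀ v ∈ J, y (u, v) = K v ∧ n (u, v) = A u + B v := by
  obtain ⟨u₀, hu₀⟩ := hIn
  obtain ⟨v₀, hv₀⟩ := hJn
  have hR := hI.prod hJ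
  have hex : ∀ v, ∃ a : ℝ, v ∈ J → fderiv ℝ n (u₀, v) (0, 1) = a • y (u₀, v) := by
    intro v
    by_cases hv : v ∈ J
    · obtain ⟨a, ha⟩ := Submodule.mem_span_singleton.1 (hnv (u₀, v) ⟨hu₀, hv⟩)
      exact ⟨a, fun _ => ha.symm⟩
    · exact ⟨0, fun h => absurd h hv⟩
  choose α hα using hex
  have hK : ∀ u ∈ I, ∀ v ∈ J, y (u, v) = y (u₀, v) := fun u hu v hv =>
    eq_of_fderiv_fst_eq_zero hI hIc hJ hy hyu hu hu₀ hv
  have hAB : ∀ u ∈ I, ∀ v ∈ J, n (u, v) = n (u, v₀) + (n (u₀, v) - n (u₀, v₀)) :=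
    fun u hu v hv => eq_add_sub_of_mixed_eq_zero hI hIc hJ hJc hn hnvu hu hu₀ hv hv₀
  have hsnd : ∀ u ∈ I, ∀ v ∈ J, ∀ {f : ℝ × ℝ → LieSpace}, ContDiffOn ℝ ∞ f (I ×ˢ J) →
      HasDerivAt (fun s => f (u, s)) (fderiv ℝ f (u, v) (0, 1)) v := fun u hu v hv f hf =>
    hasDerivAt_snd (differentiableAt_of_contDiffOn hR hf ⟨hu, hv⟩)
  have smooth_snd : ∀ {f : ℝ × ℝ → LieSpace}, ContDiffOn ℝ ∞ f (I ×ˢ J) →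
      ContDiffOn ℝ ∞ (fun v => f (u₀, v)) J := fun hf =>
    hf.comp (contDiffOn_const.prodMk contDiffOn_id) (fun v hv => ⟨hu₀, hv⟩)
  refine ⟨fun u => n (u, v₀), fun v => n (u₀, v) - n (u₀, v₀), fun v => y (u₀, v), α,
    ?_, fun u hu v hv => ⟨hK u hu v hv, hAB u hu v hv⟩⟩
  exact
  { openI := hI
    openJ := hJ
    connI := hIc
    connJ := hJc
    smoothA := hn.comp (contDiffOn_id.prodMk contDiffOn_const) (fun u hu => ⟨hu, hv₀⟩)
    smoothB := (smooth_snd hn).sub contDiffOn_const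
    smoothK := smooth_snd hy
    null_K := fun v hv => hyy (u₀, v) ⟨hu₀, hv⟩
    orth := fun u hu v hv => by
      rw [← hK u hu v hv, ← hAB u hu v hv]; exact hyn (u, v) ⟨hu, hv⟩
    null_C := fun u hu v hv => by
      rw [← hAB u hu v hv]; exact hnn (u, v) ⟨hu, hv⟩
    indep := fun u hu v hv => by
      rw [← hK u hu v hv, ← hAB u hu v hv]; exact hind (u, v) ⟨hu, hv⟩
    deriv_B := fun v hv => by
      rw [← hα v hv]; exact ((hsnd u₀ hu₀ v hv hn).sub_const _).deriv
    pos_K := fun v hv => by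
      rw [(hsnd u₀ hu₀ v hv hy).deriv]; exact hyv (u₀, v) ⟨hu₀, hv⟩
    pos_A := fun u hu => by
      rw [(hasDerivAt_fst (differentiableAt_of_contDiffOn hR hn
        (show (u, v₀) ∈ I ×ˢ J from ⟨hu, hv₀⟩))).deriv]
      exact hnu (u, v₀) ⟨hu, hv₀⟩ }

/-! ### Real lifts -/

lemma ofRealVec_reVec {z : CLieSpace} (h : imVec z = 0) : ofRealVec (reVec z) = z := by
  ext i
  apply Complex.ext
  · simp
  · simpa using (congrFun h i).symm

lemma ofRealVec_fderiv_reVec {U : Set (ℝ × ℝ)} (hU : IsOpen U) {f : ℝ × ℝ → CLieSpace}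
    (hf : ContDiffOn ℝ ∞ f U) (him : ∀ x ∈ U, imVec (f x) = 0) {x : ℝ × ℝ} (hx : x ∈ U)
    (X : ℝ × ℝ) : ofRealVec (fderiv ℝ (fun y => reVec (f y)) x X) = fderiv ℝ f x X := by
  have hd := differentiableAt_of_contDiffOn hU hf hx
  rw [fderiv_continuousLinearMap_apply reVec hd]
  refine ofRealVec_reVec ?_
  rw [← fderiv_continuousLinearMap_apply imVec hd,
    fderiv_eq_of_eqOn hU (g := fun _ => (0 : LieSpace)) him hx]
  simp

lemma mem_span_of_ofRealVec_mem {k l : LieSpace}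
    (h : ofRealVec k ∈ Submodule.span ℂ {ofRealVec l}) : k ∈ Submodule.span ℝ {l} := by
  obtain ⟨c, hc⟩ := Submodule.mem_span_singleton.1 h
  refine Submodule.mem_span_singleton.2 ⟨c.re, ?_⟩
  have := congrArg reVec hc
  rwa [reVec_smul, reVec_ofRealVec, imVec_ofRealVec, smul_zero, sub_zero, reVec_ofRealVec] at this

/-- If the isothermic congruences `Y + Z` and `g (Y - Z)` are real or complex conjugate, then
constant multiples of `Y` and `Z` are real. In the second case `|g| = 1`, and the factors are `h`
and `i h` with `h ^ 2 = g`. -/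
lemma exists_const_smul_real {Y Z : ℝ × ℝ → CLieSpace} {W : Set (ℝ × ℝ)} (hWn : W.Nonempty) {g : ℂ}
    (h : ∀ x ∈ W, ∃ (k₁ k₂ : LieSpace) (a b : ℂ), LinearIndependent ℝ ![k₁, k₂] ∧ a ≠ 0 ∧ b ≠ 0 ∧
      Y x = a • ofRealVec k₁ ∧ Z x = b • ofRealVec k₂)
    (hreal : (∀ x ∈ W, star (Y x + Z x) = Y x + Z x) ∨
      ∀ x ∈ W, g • Y x - g • Z x = star (Y x + Z x)) :
    ∃ c₁ c₂ : ℂ, c₁ ≠ 0 ∧ c₂ ≠ 0 ∧ ∀ x ∈ W, imVec (c₁ • Y x) = 0 ∧ imVec (c₂ • Z x) = 0 := by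
  have him : ∀ (c : ℂ) (k : LieSpace), (starRingEnd ℂ) c = c → imVec (c • ofRealVec k) = 0 :=
    fun c k hc => by
      rw [imVec_smul, reVec_ofRealVec, imVec_ofRealVec, Complex.conj_eq_iff_im.1 hc]
      simp
  have hstar : ∀ (a b : ℂ) (k₁ k₂ : LieSpace), star (a • ofRealVec k₁ + b • ofRealVec k₂) =
      (starRingEnd ℂ) a • ofRealVec k₁ + (starRingEnd ℂ) b • ofRealVec k₂ := fun a b k₁ k₂ => by
    ext i
    simp
  rcases hreal with hreal | hconj
  · refine ⟨1, 1, one_ne_zero, one_ne_zero, fun x hx => ?_⟩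
    obtain ⟨k₁, k₂, a, b, hk, ha, hb, hY, hZ⟩ := h x hx
    have e := hreal x hx
    rw [hY, hZ, hstar, ← sub_eq_zero, add_sub_add_comm, ← sub_smul, ← sub_smul] at e
    have := LinearIndependent.pair_iff.1 (linearIndependent_ofRealVec hk) _ _ e
    rw [hY, hZ, one_smul, one_smul]
    exact ⟨him a k₁ (sub_eq_zero.1 this.1), him b k₂ (sub_eq_zero.1 this.2)⟩
  · have key : ∀ x ∈ W, ∃ (k₁ k₂ : LieSpace) (a b : ℂ), a ≠ 0 ∧ Y x = a • ofRealVec k₁ ∧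
        Z x = b • ofRealVec k₂ ∧ (starRingEnd ℂ) a = g * a ∧ (starRingEnd ℂ) b = -(g * b) := by
      intro x hx
      obtain ⟨k₁, k₂, a, b, hk, ha, hb, hY, hZ⟩ := h x hx
      have e := hconj x hx
      rw [hY, hZ, hstar, eq_comm, ← sub_eq_zero, smul_smul, smul_smul] at e
      have := LinearIndependent.pair_iff.1 (linearIndependent_ofRealVec hk)
        ((starRingEnd ℂ) a - g * a) ((starRingEnd ℂ) b + g * b) (by rw [← e]; module)
      exact ⟨k₁, k₂, a, b, ha, hY, hZ, sub_eq_zero.1 this.1, eq_neg_of_add_eq_zero_left this.2⟩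
    obtain ⟨r, hr⟩ := IsAlgClosed.exists_pow_nat_eq g two_pos
    have hr1 : (starRingEnd ℂ) r * r = 1 := by
      obtain ⟨x, hx⟩ := hWn
      obtain ⟨k₁, k₂, a, b, ha, -, -, e, -⟩ := key x hx
      have hg : ‖g‖ = 1 := by
        have := congrArg norm e
        rw [Complex.norm_conj, norm_mul] at this
        have hna : ‖a‖ ≠ 0 := norm_ne_zero_iff.2 ha
        field_simp at this
        exact this.symm
      have hrn : ‖r‖ ^ 2 = 1 := by rw [← norm_pow, hr, hg]
      rw [mul_comm, Complex.mul_conj, Complex.normSq_eq_norm_sq, hrn, Complex.ofReal_one]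
    have hr0 : r ≠ 0 := by rintro rfl; simp at hr1
    refine ⟨r, Complex.I * r, hr0, mul_ne_zero Complex.I_ne_zero hr0, fun x hx => ?_⟩
    obtain ⟨k₁, k₂, a, b, ha, hY, hZ, ea, eb⟩ := key x hx
    rw [hY, hZ, smul_smul, smul_smul]
    constructor
    · refine him _ _ ?_
      rw [map_mul, ea, ← hr]
      linear_combination r * a * hr1
    · refine him _ _ ?_
      rw [map_mul, map_mul, eb, ← hr, Complex.conj_I]
      linear_combination Complex.I * r * b * hr1

/-! ### Classification -/

lemma moutard_congr {f g : ℝ × ℝ → CLieSpace} {U : Set (ℝ × ℝ)} (hU : IsOpen U)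
    (h : ∀ y ∈ U, f y = g y) {w : ℝ × ℝ} (hw : w ∈ U) (X X' : ℝ × ℝ) :
    fderiv ℝ (fun z => fderiv ℝ f z X) w X' = fderiv ℝ (fun z => fderiv ℝ g z X) w X' := by
  rw [fderiv_eq_of_eqOn hU (g := fun z => fderiv ℝ g z X)
    (fun y hy => by rw [fderiv_eq_of_eqOn hU h hy]) hw]

lemma IsCoordinateRectangle.isOpen {κ : OpenPartialHomeomorph (ℝ × ℝ) (ℝ × ℝ)}
    {W : Set (ℝ × ℝ)} {I J : Set ℝ} (h : IsCoordinateRectangle κ W I J) : IsOpen W :=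
  h.1 ▸ κ.open_source

lemma IsCoordinateRectangle.isPreconnected {κ : OpenPartialHomeomorph (ℝ × ℝ) (ℝ × ℝ)}
    {W : Set (ℝ × ℝ)} {I J : Set ℝ} (h : IsCoordinateRectangle κ W I J) : IsPreconnected W := by
  obtain ⟨rfl, hT, -, hIc, -, hJc, -, hs⟩ := h
  rw [← κ.symm_image_target_eq_source]
  refine IsPreconnected.image ?_ _ hs.continuousOn
  rw [hT]
  exact hIc.isPreconnected.prod hJc.isPreconnected

lemma isDupinCyclide_empty (L : ℝ × ℝ → Submodule ℝ LieSpace) : IsDupinCyclide L ∅ := by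
  refine ⟨![Pi.single 1 1, Pi.single 2 1, Pi.single 0 1], fun i j => ?_, by simp⟩
  fin_cases i <;> fin_cases j <;> simp [lieInner]

/-- A channel Ω-patch has real lifts `Y`, `Z` of its two curvature sphere congruences that satisfy
`Y_u = 0`, `Z_v ∈ ⟨Y⟩` and `Z_uv = 0` in suitable coordinates. -/
lemma exists_real_lifts {L : ℝ × ℝ → Submodule ℝ LieSpace} {D W : Set (ℝ × ℝ)}
    (hL : IsLegendreImmersion L D) (hchannel : IsChannel L D) (hWD : W ⊆ D) (hWn : W.Nonempty)
    (h : IsOmegaPatch L W) :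
    ∃ (Y Z : ℝ × ℝ → CLieSpace) (κ : OpenPartialHomeomorph (ℝ × ℝ) (ℝ × ℝ)) (I J : Set ℝ),
      CurvatureFrame Y Z W ∧ IsCoordinateRectangle κ W I J ∧
      (∀ x ∈ W, imVec (Y x) = 0 ∧ imVec (Z x) = 0) ∧
      (∀ x ∈ W, ∃ (k₁ k₂ : LieSpace) (a b : ℂ), IsCurvatureSphere L x k₁ ∧
        IsCurvatureSphere L x k₂ ∧ LinearIndependent ℝ ![k₁, k₂] ∧ a ≠ 0 ∧ b ≠ 0 ∧
        Y x = a • ofRealVec k₁ ∧ Z x = b • ofRealVec k₂) ∧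
      ∀ w ∈ κ.target, fderiv ℝ (Y ∘ κ.symm) w (1, 0) = 0 ∧
        fderiv ℝ (Z ∘ κ.symm) w (0, 1) ∈ Submodule.span ℂ {Y (κ.symm w)} ∧
        fderiv ℝ (fun z => fderiv ℝ (Z ∘ κ.symm) z (0, 1)) w (1, 0) = 0 := by
  obtain ⟨m, m', ⟨hm, -, κ, I, J, hκ, hmκ⟩, ⟨hm', -, κ', I', J', hκ', hmκ'⟩, hreal, hsep⟩ := h
  have hW := hκ.isOpen
  obtain ⟨Y, Z, G, hfr, hG, hG0, e, e', hform⟩ :=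
    exists_curvatureFrame hL hchannel hW hWD hm hm' hsep
  have hfr' := hfr.smul hW hG hG.neg hG0 (fun x hx => neg_ne_zero.2 (hG0 x hx))
  have htgt : ∀ {κ : OpenPartialHomeomorph (ℝ × ℝ) (ℝ × ℝ)} {I J : Set ℝ},
      IsCoordinateRectangle κ W I J → ∀ w ∈ κ.target, κ.symm w ∈ W := fun h w hw =>
    h.1 ▸ OpenPartialHomeomorph.map_target _ hw
  have hd := hfr.exists_directions_of_isCoordinateRectangle hκ (fun w hw => by
    obtain ⟨c, hc⟩ := hmκ w hw
    refine ⟨c, ?_⟩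
    rw [Pi.add_apply, ← e _ (htgt hκ w hw), ← hc]
    exact moutard_congr κ.open_target (fun y hy => (e _ (htgt hκ y hy)).symm) hw _ _)
  have hsum : ∀ x ∈ W, ((fun x => G x • Y x) + fun x => -G x • Z x) x = m' x := fun x hx => by
    rw [e' x hx, Pi.add_apply, neg_smul, sub_eq_add_neg]
  have hd' := hfr'.exists_directions_of_isCoordinateRectangle hκ' (fun w hw => by
    obtain ⟨c, hc⟩ := hmκ' w hw
    refine ⟨c, ?_⟩
    rw [hsum _ (htgt hκ' w hw), ← hc]
    exact moutard_congr κ'.open_target (fun y hy => hsum _ (htgt hκ' y hy)) hw _ _)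
  have hdG : ∀ x ∈ W, fderiv ℝ G x = 0 := fun x hx =>
    hfr.fderiv_eq_zero_of_directions hW hG hG0 hx (hd.1 x hx) (hd'.1 x hx)
  obtain ⟨g, hg⟩ := hW.exists_is_const_of_fderiv_eq_zero hκ.isPreconnected
    (fun x hx => (differentiableAt_of_contDiffOn hW hG hx).differentiableWithinAt)
    (fun x hx => hdG x hx)
  obtain ⟨c₁, c₂, hc₁, hc₂, him⟩ := exists_const_smul_real (Y := Y) (Z := Z) (g := g) hWn
    (fun x hx => by
      obtain ⟨k₁, k₂, a, b, -, -, hrest⟩ := hform x hx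
      exact ⟨k₁, k₂, a, b, hrest⟩)
    (hreal.imp (fun hr x hx => by rw [← e x hx]; exact (hr x hx).1)
      (fun hr x hx => by rw [← hg x hx, ← e' x hx, ← e x hx]; exact hr x hx))
  obtain ⟨κ₂, I₂, J₂, hκ₂, hd₂⟩ := hd.2
  have hdiff : ∀ {f : ℝ × ℝ → CLieSpace}, ContDiffOn ℝ ∞ f W →
      ContDiffOn ℝ ∞ (f ∘ κ₂.symm) κ₂.target := fun hf => hf.comp hκ₂.2.2.2.2.2.2.2 (htgt hκ₂)
  have hsm : ∀ {f : ℝ × ℝ → CLieSpace} (c : ℂ), ContDiffOn ℝ ∞ f W → ∀ w ∈ κ₂.target, ∀ X,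
      fderiv ℝ ((fun x => c • f x) ∘ κ₂.symm) w X = c • fderiv ℝ (f ∘ κ₂.symm) w X :=
    fun {f} c hf w hw X => by
      rw [show (fun x => c • f x) ∘ κ₂.symm = fun y => c • (f ∘ κ₂.symm) y from rfl,
        fderiv_complex_smul (differentiableAt_const c)
          (differentiableAt_of_contDiffOn κ₂.open_target (hdiff hf) hw)]
      simp
  refine ⟨fun x => c₁ • Y x, fun x => c₂ • Z x, κ₂, I₂, J₂, hfr.smul hW contDiffOn_const
    contDiffOn_const (fun _ _ => hc₁) (fun _ _ => hc₂), hκ₂, him, fun x hx => ?_, fun w hw => ?_⟩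
  · obtain ⟨k₁, k₂, a, b, h₁, h₂, hk, ha, hb, hY, hZ⟩ := hform x hx
    exact ⟨k₁, k₂, c₁ * a, c₂ * b, h₁, h₂, hk, mul_ne_zero hc₁ ha, mul_ne_zero hc₂ hb,
      by simp only [hY, smul_smul], by simp only [hZ, smul_smul]⟩
  · obtain ⟨h1, h2, h3⟩ := hd₂ w hw
    refine ⟨by rw [hsm c₁ hfr.smooth_Y w hw, h1, smul_zero], ?_, ?_⟩
    · rw [hsm c₂ hfr.smooth_Z w hw]
      refine Submodule.smul_mem _ _ ?_
      rw [Submodule.span_singleton_smul_eq hc₁.isUnit]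
      exact h2
    · have hd := differentiableAt_of_contDiffOn κ₂.open_target
        (contDiffOn_fderiv_apply κ₂.open_target (hdiff hfr.smooth_Z) (0, 1)) hw
      have := fderiv_complex_smul (differentiableAt_const (𝕜 := ℝ) (x := w) c₂) hd (1, 0)
      rw [fderiv_eq_of_eqOn κ₂.open_target (fun y hy => hsm c₂ hfr.smooth_Z y hy (0, 1)) hw, this,
        h3]
      simp

/-- The real lifts of the curvature spheres of a channel Ω-patch provide the normal form. -/
theorem IsOmegaPatch.classification {L : ℝ × ℝ → Submodule ℝ LieSpace} {D W : Set (ℝ × ℝ)}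
    (hL : IsLegendreImmersion L D) (hchannel : IsChannel L D) (hWD : W ⊆ D)
    (h : IsOmegaPatch L W) : IsDupinOrConeCylinderRevolution L W := by
  rcases W.eq_empty_or_nonempty with rfl | hWn
  · exact Or.inl (isDupinCyclide_empty L)
  obtain ⟨Y, Z, κ, I, J, hfrW, hκ, him, hform, hd⟩ := exists_real_lifts hL hchannel hWD hWn h
  obtain ⟨hsrc, hT, hI, hIc, hJ, hJc, hs, hs'⟩ := id hκ
  have htgt : ∀ w ∈ κ.target, κ.symm w ∈ W := fun w hw => hsrc ▸ κ.map_target hw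
  have hfr := hfrW.comp_symm hsrc hs hs'
  have hO := κ.open_target
  have eY : ∀ w ∈ κ.target, ofRealVec (reVec ((Y ∘ κ.symm) w)) = (Y ∘ κ.symm) w := fun w hw =>
    ofRealVec_reVec (him _ (htgt w hw)).1
  have eZ : ∀ w ∈ κ.target, ofRealVec (reVec ((Z ∘ κ.symm) w)) = (Z ∘ κ.symm) w := fun w hw =>
    ofRealVec_reVec (him _ (htgt w hw)).2
  have dY := fun w hw X => ofRealVec_fderiv_reVec hO hfr.smooth_Y
    (fun w hw => (him _ (htgt w hw)).1) (x := w) hw X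
  have dZ := fun w hw X => ofRealVec_fderiv_reVec hO hfr.smooth_Z
    (fun w hw => (him _ (htgt w hw)).2) (x := w) hw X
  have hind : ∀ w ∈ κ.target,
      LinearIndependent ℝ ![reVec ((Y ∘ κ.symm) w), reVec ((Z ∘ κ.symm) w)] := fun w hw => by
    have := hfr.indep w hw
    rw [← eY w hw, ← eZ w hw, LinearIndependent.pair_iff] at this
    refine LinearIndependent.pair_iff.2 fun s t hst => ?_
    have := this s t (by
      rw [← real_smul_eq_ofReal_smul, ← real_smul_eq_ofReal_smul, ← map_smul, ← map_smul ofRealVec t,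
        ← map_add, hst, map_zero])
    exact_mod_cast this
  have inner0 : ∀ {k l : LieSpace}, cInner (ofRealVec k) (ofRealVec l) = 0 → lieInner k l = 0 :=
    fun h => by rw [cInner_ofRealVec] at h; exact_mod_cast h
  have hyy : ∀ w ∈ κ.target, lieInner (reVec ((Y ∘ κ.symm) w)) (reVec ((Y ∘ κ.symm) w)) = 0 :=
    fun w hw => inner0 (by rw [eY w hw]; exact hfr.inner_YY w hw)
  have hyn : ∀ w ∈ κ.target, lieInner (reVec ((Y ∘ κ.symm) w)) (reVec ((Z ∘ κ.symm) w)) = 0 :=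
    fun w hw => inner0 (by rw [eY w hw, eZ w hw]; exact hfr.inner_YZ w hw)
  have hnn : ∀ w ∈ κ.target, lieInner (reVec ((Z ∘ κ.symm) w)) (reVec ((Z ∘ κ.symm) w)) = 0 :=
    fun w hw => inner0 (by rw [eZ w hw]; exact hfr.inner_ZZ w hw)
  have hYu : ∀ w ∈ κ.target,
      fderiv ℝ (Y ∘ κ.symm) w (1, 0) ∈ Submodule.span ℂ {(Y ∘ κ.symm) w, (Z ∘ κ.symm) w} :=
    fun w hw => by rw [(hd w hw).1]; exact zero_mem _
  have hZv : ∀ w ∈ κ.target,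
      fderiv ℝ (Z ∘ κ.symm) w (0, 1) ∈ Submodule.span ℂ {(Y ∘ κ.symm) w, (Z ∘ κ.symm) w} :=
    fun w hw => span_singleton_le_pair_left _ _ (hd w hw).2.1
  -- The derivatives across the curvature directions are spacelike: otherwise the coordinate vector
  -- would be in the kernel of the immersion.
  have hpy : ∀ w ∈ κ.target, 0 < lieInner (fderiv ℝ (fun y => reVec ((Y ∘ κ.symm) y)) w (0, 1))
      (fderiv ℝ (fun y => reVec ((Y ∘ κ.symm) y)) w (0, 1)) := fun w hw => by
    refine lt_of_le_of_ne (nonneg_of_orthogonal_null_plane (hind w hw) (hyy w hw) (hyn w hw)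
      (hnn w hw) (inner0 ?_) (inner0 ?_)).1 (fun h0 => ?_)
    · rw [dY w hw, eY w hw]; exact hfr.inner_fderiv_Y_Y hO hw _
    · rw [dY w hw, eZ w hw]; exact hfr.contact_Y w hw _
    · have hn := hfr.null_Y w hw (0, 1) (by
        rw [← dY w hw, cInner_ofRealVec, ← h0, Complex.ofReal_zero])
      simpa using hfr.immersion w hw (0, 1) hn (hZv w hw)
  have hpn : ∀ w ∈ κ.target, 0 < lieInner (fderiv ℝ (fun y => reVec ((Z ∘ κ.symm) y)) w (1, 0))
      (fderiv ℝ (fun y => reVec ((Z ∘ κ.symm) y)) w (1, 0)) := fun w hw => by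
    refine lt_of_le_of_ne (nonneg_of_orthogonal_null_plane (hind w hw) (hyy w hw) (hyn w hw)
      (hnn w hw) (inner0 ?_) (inner0 ?_)).1 (fun h0 => ?_)
    · rw [dZ w hw, eY w hw]; exact hfr.contact_Z w hw _
    · rw [dZ w hw, eZ w hw]; exact hfr.inner_fderiv_Z_Z hO hw _
    · have hn := hfr.null_Z w hw (1, 0) (by
        rw [← dZ w hw, cInner_ofRealVec, ← h0, Complex.ofReal_zero])
      simpa using hfr.immersion w hw (1, 0) (hYu w hw) hn
  have hyu : ∀ w ∈ κ.target, fderiv ℝ (fun y => reVec ((Y ∘ κ.symm) y)) w (1, 0) = 0 :=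
    fun w hw => by
      rw [fderiv_continuousLinearMap_apply reVec
        (differentiableAt_of_contDiffOn hO hfr.smooth_Y hw), (hd w hw).1, map_zero]
  have hnv : ∀ w ∈ κ.target, fderiv ℝ (fun y => reVec ((Z ∘ κ.symm) y)) w (0, 1) ∈
      Submodule.span ℝ {reVec ((Y ∘ κ.symm) w)} := fun w hw => by
    refine mem_span_of_ofRealVec_mem ?_
    rw [dZ w hw, eY w hw]
    exact (hd w hw).2.1
  have hnvu : ∀ w ∈ κ.target, fderiv ℝ (fun z => fderiv ℝ (fun y => reVec ((Z ∘ κ.symm) y)) z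
      (0, 1)) w (1, 0) = 0 := fun w hw => by
    rw [fderiv_eq_of_eqOn hO (fun y hy => fderiv_continuousLinearMap_apply reVec
      (differentiableAt_of_contDiffOn hO hfr.smooth_Z hy) (0, 1)) hw,
      fderiv_continuousLinearMap_apply reVec (differentiableAt_of_contDiffOn hO
        (contDiffOn_fderiv_apply hO hfr.smooth_Z (0, 1)) hw), (hd w hw).2.2, map_zero]
  have hIJ : (I ×ˢ J).Nonempty := by
    obtain ⟨x, hx⟩ := hWn
    rw [← hT]
    exact ⟨κ x, κ.map_source (hsrc.symm ▸ hx)⟩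
  have hys : ContDiffOn ℝ ∞ (fun y => reVec ((Y ∘ κ.symm) y)) κ.target :=
    reVec.contDiff.comp_contDiffOn hfr.smooth_Y
  have hns : ContDiffOn ℝ ∞ (fun y => reVec ((Z ∘ κ.symm) y)) κ.target :=
    reVec.contDiff.comp_contDiffOn hfr.smooth_Z
  have hspheres : ∀ x ∈ W, ∃ k₁ k₂ : LieSpace, IsCurvatureSphere L x k₁ ∧
      IsCurvatureSphere L x k₂ ∧ LinearIndependent ℝ ![k₁, k₂] ∧
      k₁ ∈ Submodule.span ℝ {reVec (Y x)} ∧ k₂ ∈ Submodule.span ℝ {reVec (Z x)} := by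
    intro x hx
    obtain ⟨k₁, k₂, a, b, h₁, h₂, hk, ha, hb, hY, hZ⟩ := hform x hx
    refine ⟨k₁, k₂, h₁, h₂, hk, mem_span_of_ofRealVec_mem ?_, mem_span_of_ofRealVec_mem ?_⟩
    · rw [ofRealVec_reVec (him x hx).1, hY]
      exact Submodule.mem_span_singleton.2 ⟨a⁻¹, by rw [smul_smul, inv_mul_cancel₀ ha, one_smul]⟩
    · rw [ofRealVec_reVec (him x hx).2, hZ]
      exact Submodule.mem_span_singleton.2 ⟨b⁻¹, by rw [smul_smul, inv_mul_cancel₀ hb, one_smul]⟩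
  have hLspan : ∀ x ∈ W, L x = Submodule.span ℝ {reVec (Y x), reVec (Z x)} := by
    intro x hx
    obtain ⟨k₁, k₂, h₁, h₂, hk, hk₁, hk₂⟩ := hspheres x hx
    rw [hL.eq_span (hWD hx) h₁.1 h₂.1 hk]
    refine (span_pair_eq_of_linearIndependent hk (Submodule.span_mono (by simp) hk₁)
      (Submodule.span_mono (by simp) hk₂)).symm
  rw [hT] at hyy hyn hnn hind hyu hnv hnvu hpy hpn hys hns
  obtain ⟨A, B, K, α, hN, hyK⟩ := exists_channelNormalForm hI hIc hJ hJc hIJ.fst hIJ.snd hys hns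
    hyy hyn hnn hind hyu hnv hnvu hpy hpn
  rcases hN.classification hκ (L := L) (fun u hu v hv => by
    rw [← (hyK u hu v hv).1, ← (hyK u hu v hv).2]
    exact hLspan _ (htgt _ (hT ▸ ⟨hu, hv⟩))) hIJ.fst hIJ.snd with ⟨e, he, hKe, hAe⟩ | hE
  · refine Or.inl ⟨e, he, fun x hx => ?_⟩
    obtain ⟨k₁, k₂, h₁, h₂, -, hk₁, hk₂⟩ := hspheres x hx
    have hxs : x ∈ κ.source := hsrc.symm ▸ hx
    have hw : κ x ∈ I ×ˢ J := hT ▸ κ.map_source hxs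
    obtain ⟨eK, eN⟩ := hyK (κ x).1 hw.1 (κ x).2 hw.2
    simp only [Prod.mk.eta, Function.comp_apply, κ.left_inv hxs] at eK eN
    rw [eK] at hk₁
    rw [eN] at hk₂
    refine ⟨k₁, k₂, h₁, h₂, (Submodule.span_singleton_le_iff_mem _ _).2 (hKe _ hw.2) hk₁,
      fun i => ?_⟩
    obtain ⟨c, rfl⟩ := Submodule.mem_span_singleton.1 hk₂
    rw [lieInner_smul_left, hAe _ hw.1 _ hw.2, mul_zero]
  · exact Or.inr hE

end

/-- A channel Ω-surface is, near each of its points and on every patch that carries globally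
defined Moutard lifts, a Dupin cyclide or, in a suitably chosen Euclidean subgeometry, a cone,
a cylinder or a surface of revolution. -/
theorem mainTheorem2 (L : ℝ × ℝ → Submodule ℝ LieSpace) (D : Set (ℝ × ℝ)) (hD : IsOpen D)
    (hL : IsLegendreImmersion L D) (hchannel : IsChannel L D) (hΩ : IsOmegaSurface L D) :
    (∀ x ∈ D, ∃ W ⊆ D, IsOpen W ∧ x ∈ W ∧ IsDupinOrConeCylinderRevolution L W) ∧
      ∀ W ⊆ D, IsOmegaPatch L W → IsDupinOrConeCylinderRevolution L W := by
  have key : ∀ W ⊆ D, IsOmegaPatch L W → IsDupinOrConeCylinderRevolution L W := fun W hWD h =>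
    h.classification hL hchannel hWD
  refine ⟨fun x hx => ?_, key⟩
  obtain ⟨W, hWD, hxW, h⟩ := hΩ x hx
  obtain ⟨-, -, ⟨-, -, κ, I, J, hκ, -⟩, -⟩ := id h
  exact ⟨W, hWD, hκ.isOpen, hxW, key W hWD h⟩
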